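/- A mixed graph $G$ on a finite nonempty set $V$ with $|V|=n$ consists of a set $U$ of undirected edges (no loops) and a set $D$ of directed edges; two vertices may be joined both by an undirected and by a directed edge. $G$ is acyclic if it has no directed cycle. A mixed cycle is a cycle (of length at least $3$) in the underlying undirected graph with at least one directed edge (where two vertices are joined by both kinds of edges, the cycle uses one of them); a near cycle is a mixed cycle of length three with exactly one undirected edge. Let $m(G)$ be the minimum number of undirected edges on a mixed cycle of $G$, with $m(G)=n$ if there is no mixed cycle. A (weak) coloring of $G$ is a map $f:V\to\mathbb N$ with $f(u)\ne f(v)$ for $uv\in U$ and $f(u)\le f(v)$ for $(u,v)\in D$; $\chi(G)$ is the least number of colors of a coloring. Let a finite group $\mathfrak G$ act on $G$ by automorphisms. For $\mathfrak g\in\mathfrak G$ let $\chi(G,\mathfrak G,\mathbf x;\mathfrak g)=\sum_f\prod_{v\in V}x_{f(v)}$, summed over the colorings with $f\circ\mathfrak g^{-1}=f$, and let $\chi(G,\mathfrak G,x;\mathfrak g)$ be the polynomial whose value at $k\in\mathbb N$ is the number of such colorings with values in $[k]$. For $S=\{s_1<\dots<s_k\}\subseteq[n-1]$, $s_0=0$,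 $s_{k+1}=n$, let $M_{S,n}=\sum_{i_1<\dots<i_{k+1}}\prod_j x_{i_j}^{s_j-s_{j-1}}$ and $F_{S,n}=\sum_{S\subseteq T\subseteq[n-1]}M_{T,n}$. An effective character is the character of a finite-dimensional complex representation of $\mathfrak G$ (possibly zero), and $\varphi\le_{\mathfrak G}\psi$ means that $\psi-\varphi$ is an effective character. Suppose $G$ is acyclic. Let $P$ be the poset on $V$ given by the reflexive transitive closure of the directed edges, and $\Delta(P)$ the simplicial complex of chains of order ideals of $P$ other than $\emptyset$ and $V$. Let $\Phi(G)\subseteq\Delta(P)$ be the set of chains $I_1\subset\dots\subset I_k$ such that, with $I_0=\emptyset$ and $I_{k+1}=V$, no set $I_{j+1}\setminus I_j$ ($0\le j\le k$) contains an undirected edge, and let $\Gamma(G)=\Delta(P)\setminus\Phi(G)$. For $\ell\ge 0$, $\Phi(G)$ satisfies Serre's condition $(S_\ell)$ over a field $K$ if for all $\sigma\in\Delta(P)$ and all $i\le\min(\dim\operatorname{lk}_{\Phi(G)}(\sigma),\ell-1)$ we have $\widetilde H_{i-1}(\operatorname{lk}_{\Delta(P)}(\sigma),\operatorname{lk}_{\Gamma(G)}(\sigma);K)=0$.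 **Theorem.** Let $G$ be an acyclic mixed graph on $n\ge1$ vertices with no near cycles, let $\mathfrak G$ be a finite group acting on $G$, and put $m=m(G)$, $\chi=\chi(G)$, $d=n-1$. Then $\Phi(G)$ satisfies $(S_m)$ over every field. For every $S\subseteq[n-1]$ with $|S|\le m$, the coefficient $[F_{S,n}]\chi(G,\mathfrak G,\mathbf x)$ is an effective character. Write $$\chi(G,\mathfrak G,x)=\sum_{i=0}^n f_{i-2}\binom xi=\sum_{i=0}^n h_{i-1}\binom{x+n-i}{n},$$ with class functions $f_{-2},\dots,f_{n-2}$ and $h_{-1},\dots,h_{n-1}$ (and $f_i=0$, $h_i=0$ for all other $i$). Then: 1. $h_i\ge_{\mathfrak G}0$ for $i\le m$. 2. For $0\le i\le m$, $\displaystyle\sum_{j=m}^{d}\binom{i+j-m}{i}h_j\ge_{\mathfrak G}0$. If moreover $m\ge\chi$, then: 3. $(d-i)f_{i-1}\le_{\mathfrak G}(i-\chi+2)f_i$ for all $i\ge\chi$. 4. $f_{i-1}\le_{\mathfrak G}f_i$ for $\chi-1\le i\le\lfloor(d+\chi-2)/2\rfloor$. 5. $f_{i-1}\le_{\mathfrak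 G}f_{d+\chi-i-2}$ for $\chi-1\le i\le\lfloor(d+\chi-1)/2\rfloor$. (4 and 5 say that the sequence $(f_{\chi-2},\dots,f_{d-1})$, which is what remains after the initial zeros of the $f$-vector are removed, is strongly flawless with respect to $\le_{\mathfrak G}$.) -/

import Mathlib

noncomputable section

/-! ### Relative simplicial complexes and Serre's condition -/

namespace RelComplex

variable {W : Type*} [DecidableEq W]

/-- The link of `σ` in a family `Φ` of finite sets. -/
def link (Φ : Set (Finset W)) (σ : Finset W) : Set (Finset W) :=
  {τ | Disjoint σ τ ∧ σ ∪ τ ∈ Φ}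

/-- `dim Φ ≥ i`: some face of `Φ` has dimension (cardinality minus one) at least `i`. -/
def DimGE (Φ : Set (Finset W)) (i : ℤ) : Prop :=
  ∃ τ ∈ Φ, i ≤ (τ.card : ℤ) - 1

variable (K : Type*) [Field K] (κ : W → ℕ)

open Classical in
/-- The boundary of a face `σ` in the relative chain complex `C(Δ)/C(Γ)`, where `Φ = Δ \ Γ`:
the alternating sum of the codimension-one faces of `σ`, those outside `Φ` being zero.
The vertices of `σ` are ordered by the coloring `κ`, which is injective on every face of a
balanced complex. -/
def faceBoundary (Φ : Set (Finset W)) (σ : Finset W) : Finset W →₀ K :=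
  ∑ v ∈ σ, if σ.erase v ∈ Φ then
    Finsupp.single (σ.erase v) ((-1 : K) ^ (σ.filter fun w => κ w < κ v).card) else 0

/-- The boundary map of the relative chain complex with basis `Φ`. -/
def boundary (Φ : Set (Finset W)) : (Finset W →₀ K) →ₗ[K] (Finset W →₀ K) :=
  Finsupp.linearCombination K (faceBoundary K κ Φ)

/-- Relative chains spanned by the faces of `Φ` with `i` vertices, that is, of dimension `i - 1`. -/
def chains (Φ : Set (Finset W)) (i : ℕ) : Submodule K (Finset W →₀ K) :=
  Finsupp.supported K K {σ | σ ∈ Φ ∧ σ.card = i}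

/-- Cycles of dimension `i - 1`. -/
def cycles (Φ : Set (Finset W)) (i : ℕ) : Submodule K (Finset W →₀ K) :=
  chains K Φ i ⊓ LinearMap.ker (boundary K κ Φ)

/-- Boundaries of dimension `i - 1`. -/
def boundaries (Φ : Set (Finset W)) (i : ℕ) : Submodule K (Finset W →₀ K) :=
  (chains K Φ (i + 1)).map (boundary K κ Φ)

/-- The reduced relative homology of the pair `(Δ, Γ)` in dimension `i - 1`, with
coefficients in `K`, is zero: every cycle is a boundary. The empty face, of dimension `-1`,
belongs to the chain complex. -/
def ReducedHomologyVanishes (Δ Γ : Set (Finset W)) (i : ℕ) : Prop :=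
  cycles K κ (Δ \ Γ) i ≤ boundaries K κ (Δ \ Γ) i

/-- Serre's condition `(S_ℓ)` over `K` for the relative complex presented by `(Δ, Γ)`:
for every `σ ∈ Δ` and every `i ≤ min (dim (lk σ)) (ℓ - 1)`, the reduced homology of
`(lk_Δ σ, lk_Γ σ)` in dimension `i - 1` vanishes. -/
def SatisfiesSerre (Δ Γ : Set (Finset W)) (ℓ : ℕ) : Prop :=
  ∀ σ ∈ Δ, ∀ i : ℕ, DimGE (link Δ σ \ link Γ σ) i → (i : ℤ) ≤ (ℓ : ℤ) - 1 →
    ReducedHomologyVanishes K κ (link Δ σ) (link Γ σ) i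

end RelComplex

/-! ### Quasisymmetric functions -/

namespace QSymFun

/-- For `S = {s₁ < ⋯ < s_k} ⊆ [n-1]`, the sequence `s₀ = 0, s₁, …, s_k, s_{k+1} = n`. -/
def cut (n : ℕ) (S : Finset ℕ) (j : ℕ) : ℕ :=
  Nat.nth (fun x => x ∈ insert 0 (insert n S)) j

/-- The monomial quasisymmetric function `M_{S,n}`, the sum of
`x_{i_1}^{s_1 - s_0} ⋯ x_{i_{k+1}}^{s_{k+1} - s_k}` over all `i_1 < ⋯ < i_{k+1}`: the coefficient
of a monomial is the number of index sequences that produce it. -/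
def monomialQ (n : ℕ) (S : Finset ℕ) : MvPowerSeries ℕ ℂ := fun μ =>
  (Nat.card {i : Fin (S.card + 1) → ℕ // StrictMono i ∧
    ∑ j, Finsupp.single (i j) (cut n S (j + 1) - cut n S j) = μ} : ℂ)

/-- The fundamental quasisymmetric function `F_{S,n} = ∑_{S ⊆ T ⊆ [n-1]} M_{T,n}`. -/
def fundamentalQ (n : ℕ) (S : Finset ℕ) : MvPowerSeries ℕ ℂ :=
  ∑ T ∈ (Finset.Icc 1 (n - 1)).powerset with S ⊆ T, monomialQ n T

end QSymFun

/-- A complex valued function on a group is an effective character if it is the character of a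
finite-dimensional complex representation (possibly zero). -/
def IsEffectiveCharacter {H : Type*} [Group H] (φ : H → ℂ) : Prop :=
  ∃ (k : ℕ) (ρ : Representation ℂ H (Fin k → ℂ)), φ = ρ.character

/-- `φ ≤ ψ` in the effective order: `ψ - φ` is an effective character. -/
def EffLE {H : Type*} [Group H] (φ ψ : H → ℂ) : Prop :=
  IsEffectiveCharacter (ψ - φ)

/-! ### Mixed graphs -/

/-- A mixed graph: undirected edges and directed edges on the vertex set `V`. -/
structure MixedGraph (V : Type*) where
  /-- the undirected edges -/
  und : SimpleGraph V
  /-- the directed edges -/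
  dir : Digraph V

namespace MixedGraph

variable {V : Type*} (G : MixedGraph V)

/-- No directed cycles. -/
def IsAcyclic : Prop := ∀ v, ¬ Relation.TransGen G.dir.Adj v v

/-- The underlying undirected graph. -/
def underlying : SimpleGraph V := G.und ⊔ SimpleGraph.fromRel G.dir.Adj

/-- A mixed cycle: a cycle of the underlying graph with at least one directed edge. Two vertices
may be joined both by an undirected and by a directed edge, so the cycle records the set
`directed` of those of its edges that it takes from the directed edges; the others are taken
from the undirected edges. -/
structure MixedCycle where
  /-- the starting point -/
  base : V
  /-- the closed walk -/
  walk : G.underlying.Walk base base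
  isCycle : walk.IsCycle
  /-- the edges that are taken from the directed edges -/
  directed : Set (Sym2 V)
  directed_subset : ∀ e ∈ directed, e ∈ walk.edges
  directed_adj : ∀ e ∈ directed, ∃ u v, G.dir.Adj u v ∧ e = s(u, v)
  directed_nonempty : directed.Nonempty
  undirected_adj : ∀ e ∈ walk.edges, e ∉ directed → e ∈ G.und.edgeSet

/-- The number of undirected edges on a mixed cycle. -/
def MixedCycle.numUndirected {G : MixedGraph V} (c : G.MixedCycle) : ℕ :=
  Set.ncard {e | e ∈ c.walk.edges ∧ e ∉ c.directed}

/-- A near cycle: a mixed cycle of length three with exactly one undirected edge. -/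
def MixedCycle.IsNear {G : MixedGraph V} (c : G.MixedCycle) : Prop :=
  c.walk.length = 3 ∧ c.numUndirected = 1

open Classical in
/-- `m(G)`: the minimum number of undirected edges on a mixed cycle, and the number of vertices
if there is no mixed cycle. -/
def minUndirected [Fintype V] : ℕ :=
  if Nonempty G.MixedCycle then sInf (Set.range fun c : G.MixedCycle => c.numUndirected)
  else Fintype.card V

/-- Weak colorings of a mixed graph. -/
def IsColoring (f : V → ℕ) : Prop :=
  (∀ u v, G.und.Adj u v → f u ≠ f v) ∧ (∀ u v, G.dir.Adj u v → f u ≤ f v)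

/-- The chromatic number `χ(G)`: the least number of colors of a weak coloring. -/
def chromaticNumber : ℕ := sInf {k | ∃ f : V → ℕ, G.IsColoring f ∧ ∀ v, f v < k}

/-- The action of `H` on the vertices is an action by automorphisms of `G`. -/
def IsActedOnBy (H : Type*) [Group H] [MulAction H V] : Prop :=
  ∀ (g : H) (u v : V), (G.und.Adj (g • u) (g • v) ↔ G.und.Adj u v) ∧
    (G.dir.Adj (g • u) (g • v) ↔ G.dir.Adj u v)

section ClassFunctions

variable {H : Type*} [Group H] [MulAction H V]

/-- Weak colorings `f` that are fixed by `g`, where `g f = f ∘ g⁻¹`. -/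
def IsFixedColoring (g : H) (f : V → ℕ) : Prop :=
  G.IsColoring f ∧ ∀ v, f (g⁻¹ • v) = f v

/-- The chromatic quasisymmetric class function `χ(G, H, x; g)`, the sum over all weak colorings
`f` fixed by `g` of `∏_v x_{f v}`: the coefficient of a monomial is the number of colorings that
produce it. -/
def chromaticQ [Fintype V] (g : H) : MvPowerSeries ℕ ℂ := fun μ =>
  (Nat.card {f : V → ℕ // G.IsFixedColoring g f ∧ ∑ v, Finsupp.single (f v) 1 = μ} : ℂ)

/-- The chromatic polynomial class function `χ(G, H, k; g)` at a natural number `k`: the number of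
weak colorings with `k` colors that are fixed by `g`. -/
def chromaticP (k : ℕ) (g : H) : ℂ :=
  (Nat.card {f : V → ℕ // G.IsFixedColoring g f ∧ ∀ v, f v < k} : ℂ)

end ClassFunctions

/-- Order ideals of the poset `P`, the reflexive and transitive closure of the directed edges
(`u ≤ v` if there is a directed path from `u` to `v`). -/
def IsIdeal (I : Finset V) : Prop :=
  ∀ u v, Relation.ReflTransGen G.dir.Adj u v → v ∈ I → u ∈ I

/-- `(I, J)` is stable: there is no undirected edge inside `J \ I`. -/
def IsStable (I J : Finset V) : Prop :=
  ∀ u v, u ∈ J → u ∉ I → v ∈ J → v ∉ I → ¬ G.und.Adj u v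

/-- The order complex `Δ(P)`: chains of order ideals different from `∅` and `V`. -/
def orderComplex [Fintype V] : Set (Finset (Finset V)) :=
  {σ | (∀ I ∈ σ, G.IsIdeal I ∧ I ≠ ∅ ∧ I ≠ Finset.univ) ∧
    IsChain (· ⊆ ·) (σ : Set (Finset V))}

/-- The coloring complex `Φ(G)`: chains `I_1 ⊂ ⋯ ⊂ I_k` in `Δ(P)` such that `(I_j, I_{j+1})` is
stable for `0 ≤ j ≤ k`, where `I_0 = ∅` and `I_{k+1} = V`. -/
def coloringComplex [Fintype V] : Set (Finset (Finset V)) :=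
  {σ | σ ∈ G.orderComplex ∧
    ∀ I ∈ (σ : Set (Finset V)) ∪ {∅, Finset.univ}, ∀ J ∈ (σ : Set (Finset V)) ∪ {∅, Finset.univ},
      I ⊂ J → (¬ ∃ L ∈ σ, I ⊂ L ∧ L ⊂ J) → G.IsStable I J}

/-- `Φ(G)` satisfies `(S_ℓ)` over `K`, with respect to the presentation `(Δ(P), Δ(P) \ Φ(G))` and
the coloring `I ↦ |I|`. -/
def ColoringComplexSatisfiesSerre [Fintype V] [DecidableEq V] (K : Type*) [Field K] (ℓ : ℕ) :
    Prop :=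
  RelComplex.SatisfiesSerre K Finset.card G.orderComplex (G.orderComplex \ G.coloringComplex) ℓ

end MixedGraph

end

/-!
For a preorder on `V`, consider the star of a chain of order ideals in the order complex of the
nonempty proper ideals. Two incomparable vertices can be made comparable in either direction, and
the ideal chains of the two resulting preorders cover the original ones and meet in those of the
preorder that identifies the two vertices. So Mayer–Vietoris reduces the vanishing of homology below
the top dimension to total preorders, where the star is a cone or a single face. Passing from
`Δ(P)` to `Φ(G)`, the requirement that an undirected edge be separated by the chain is imposed one
edge at a time by an exact sequence (deletion and contraction). Contracting fewer than `m(G)`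
undirected edges creates no directed cycle, so the classes of the contracted preorder are the
components of the contracted edges and each edge costs at most one dimension: this yields `(S_m)`.

By `(S_m)` and the Hopf trace formula, the sum of the equivariant flag `h`-vector over a Boolean
interval `[T, Q]` with `|T| ≤ m` is, at each group element, the trace on the top cycles of a
relative complex, hence an effective character. The inequalities on `f` and `h` are consequences of
this positivity on Boolean intervals, by double counting. The expansions hold since a coloring is a
chain in `Φ(G)`, recording its ordered partition into color classes, with a choice of colors.
-/

namespace RelComplex

open Finset

variable {W : Type*} {K : Type*} [Field K] {κ : W → ℕ} {Φ Ψ Θ : Set (Finset W)}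
  {σ τ : Finset W} {v w : W} {i : ℕ}

/-! ### Chains and their boundaries -/

/-- A relative simplicial complex, encoded as an order-convex family of faces, for which `κ` is a
proper coloring. -/
structure IsColoredComplex (κ : W → ℕ) (Φ : Set (Finset W)) : Prop where
  injOn : ∀ σ ∈ Φ, Set.InjOn κ σ
  ordConnected : Φ.OrdConnected

/-- `Θ` is a relative subcomplex of `Φ`: it contains all faces of its members that lie in `Φ`. Its
chains then form a subcomplex of the chain complex of `Φ`, with quotient the chains of `Φ \ Θ`. -/
structure IsSubcomplex (Θ Φ : Set (Finset W)) : Prop where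
  subset : Θ ⊆ Φ
  mem_of_subset : ∀ σ ∈ Θ, ∀ τ ∈ Φ, τ ⊆ σ → τ ∈ Θ

lemma IsColoredComplex.mono (hΦ : IsColoredComplex κ Φ) (hΘ : IsSubcomplex Θ Φ) :
    IsColoredComplex κ Θ where
  injOn σ hσ := hΦ.injOn σ (hΘ.subset hσ)
  ordConnected := ⟨fun _ hρ σ hσ τ hτ => hΘ.mem_of_subset σ hσ τ
    (hΦ.ordConnected.out (hΘ.subset hρ) (hΘ.subset hσ) hτ) hτ.2⟩

/-- The sign with which `σ.erase v` occurs in the boundary of `σ`. -/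
def vertexSign (K : Type*) [Field K] (κ : W → ℕ) (σ : Finset W) (v : W) : K :=
  (-1) ^ #{w ∈ σ | κ w < κ v}

lemma vertexSign_mul_self (σ : Finset W) (v : W) :
    vertexSign K κ σ v * vertexSign K κ σ v = 1 := by
  simp [vertexSign, ← mul_pow]

lemma chains_eq_span (Φ : Set (Finset W)) (i : ℕ) : chains K Φ i =
    Submodule.span K ((fun σ => Finsupp.single σ 1) '' {σ | σ ∈ Φ ∧ #σ = i}) :=
  Finsupp.supported_eq_span_single ..

lemma single_mem_chains (hσ : σ ∈ Φ) (a : K) : Finsupp.single σ a ∈ chains K Φ #σ :=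
  Finsupp.single_mem_supported _ _ ⟨hσ, rfl⟩

lemma chains_mono (h : Θ ⊆ Φ) (i : ℕ) : chains K Θ i ≤ chains K Φ i :=
  Finsupp.supported_mono fun _ hσ => ⟨h hσ.1, hσ.2⟩

lemma eq_of_mem_chains {M : Type*} [AddCommGroup M] [Module K M]
    {f g : (Finset W →₀ K) →ₗ[K] M} {x : Finset W →₀ K} (hx : x ∈ chains K Φ i)
    (h : ∀ σ ∈ Φ, #σ = i → f (Finsupp.single σ 1) = g (Finsupp.single σ 1)) : f x = g x := by
  rw [chains_eq_span] at hx
  refine LinearMap.eqOn_span ?_ hx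
  rintro _ ⟨σ, ⟨hσ, hi⟩, rfl⟩
  exact h σ hσ hi

lemma map_mem_of_mem_chains {M : Type*} [AddCommGroup M] [Module K M]
    {f : (Finset W →₀ K) →ₗ[K] M} {N : Submodule K M} {x : Finset W →₀ K}
    (hx : x ∈ chains K Φ i) (h : ∀ σ ∈ Φ, #σ = i → f (Finsupp.single σ 1) ∈ N) : f x ∈ N := by
  rw [chains_eq_span] at hx
  refine (Submodule.span_le (p := N.comap f)).2 ?_ hx
  rintro _ ⟨σ, ⟨hσ, hi⟩, rfl⟩
  exact h σ hσ hi

open Classical in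
/-- The projection onto the chains supported on `Ψ`. -/
noncomputable def proj (Ψ : Set (Finset W)) : (Finset W →₀ K) →ₗ[K] (Finset W →₀ K) where
  toFun x := x.filter (· ∈ Ψ)
  map_add' _ _ := Finsupp.filter_add
  map_smul' _ _ := Finsupp.filter_smul

open Classical in
lemma proj_apply_of_mem (hσ : σ ∈ Ψ) (x : Finset W →₀ K) : proj Ψ x σ = x σ :=
  Finsupp.filter_apply_pos _ x hσ

open Classical in
lemma proj_apply_of_notMem (hσ : σ ∉ Ψ) (x : Finset W →₀ K) : proj Ψ x σ = 0 :=
  Finsupp.filter_apply_neg _ x hσ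

open Classical in
lemma proj_single_of_mem (hσ : σ ∈ Ψ) (a : K) :
    proj Ψ (Finsupp.single σ a) = Finsupp.single σ a :=
  Finsupp.filter_single_of_pos _ hσ

open Classical in
lemma proj_single_of_notMem (hσ : σ ∉ Ψ) (a : K) : proj Ψ (Finsupp.single σ a) = 0 :=
  Finsupp.filter_single_of_neg _ hσ

lemma proj_mem_chains {x : Finset W →₀ K} (hx : x ∈ chains K Φ i) : proj Ψ x ∈ chains K Ψ i := by
  refine map_mem_of_mem_chains hx fun σ _ hi => ?_
  by_cases hσ : σ ∈ Ψ
  · rw [proj_single_of_mem hσ]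
    exact hi ▸ single_mem_chains hσ 1
  · rw [proj_single_of_notMem hσ]
    exact Submodule.zero_mem _

lemma proj_eq_self {x : Finset W →₀ K} (hx : x ∈ chains K Ψ i) : proj Ψ x = x :=
  eq_of_mem_chains (g := LinearMap.id) hx fun _ hσ _ => proj_single_of_mem hσ 1

lemma proj_sdiff_eq_zero_iff {x : Finset W →₀ K} (hx : x ∈ chains K Φ i) :
    proj (Φ \ Θ) x = 0 ↔ x ∈ chains K Θ i := by
  refine ⟨fun h => (Finsupp.mem_supported _ _).2 fun σ hσ => ?_, fun h =>
    eq_of_mem_chains (g := 0) h fun σ hσ _ => proj_single_of_notMem (fun h' => h'.2 hσ) 1⟩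
  obtain ⟨hΦ, hi⟩ := (Finsupp.mem_supported _ _).1 hx hσ
  refine ⟨by_contra fun hΘ => Finsupp.mem_support_iff.1 hσ ?_, hi⟩
  rw [← proj_apply_of_mem (Ψ := Φ \ Θ) ⟨hΦ, hΘ⟩, h, Finsupp.zero_apply]

variable [DecidableEq W]

/-- The reduced homology of the relative complex `Φ` vanishes in dimension `i - 1`. -/
def Vanishes (K : Type*) [Field K] (κ : W → ℕ) (Φ : Set (Finset W)) (i : ℕ) : Prop :=
  cycles K κ Φ i ≤ boundaries K κ Φ i

lemma vertexSign_erase_of_not_lt (σ : Finset W) (h : ¬ κ v < κ w) :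
    vertexSign K κ (σ.erase v) w = vertexSign K κ σ w := by
  rw [vertexSign, filter_erase, erase_eq_of_notMem (by simp [h]), vertexSign]

lemma vertexSign_erase_of_lt (hv : v ∈ σ) (h : κ v < κ w) :
    vertexSign K κ (σ.erase v) w = -vertexSign K κ σ w := by
  have hmem : v ∈ σ.filter (κ · < κ w) := mem_filter.2 ⟨hv, h⟩
  rw [vertexSign, vertexSign, filter_erase, ← card_erase_add_one hmem, pow_succ]
  ring

lemma vertexSign_mul_vertexSign_erase (hv : v ∈ σ) (hw : w ∈ σ) (h : κ v ≠ κ w) :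
    vertexSign K κ σ v * vertexSign K κ (σ.erase v) w =
      -(vertexSign K κ σ w * vertexSign K κ (σ.erase w) v) := by
  rcases h.lt_or_gt with h | h
  · rw [vertexSign_erase_of_lt hv h, vertexSign_erase_of_not_lt _ h.not_gt]
    ring
  · rw [vertexSign_erase_of_lt hw h, vertexSign_erase_of_not_lt _ h.not_gt]
    ring

lemma vertexSign_union {σ τ : Finset W} (h : Disjoint σ τ) (v : W) :
    vertexSign K κ (σ ∪ τ) v = vertexSign K κ σ v * vertexSign K κ τ v := by
  rw [vertexSign, filter_union, card_union_of_disjoint (disjoint_filter_filter h), pow_add,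
    vertexSign, vertexSign]

lemma vertexSign_insert_self (τ : Finset W) (v : W) :
    vertexSign K κ (insert v τ) v = vertexSign K κ τ v := by
  rw [vertexSign, filter_insert, if_neg (lt_irrefl _), vertexSign]

lemma vertexSign_mul_vertexSign_insert (hv : v ∉ τ) (hw : w ∈ τ) (h : κ v ≠ κ w) :
    vertexSign K κ τ v * vertexSign K κ (insert v τ) w =
      -(vertexSign K κ τ w * vertexSign K κ (τ.erase w) v) := by
  have hwv : v ≠ w := fun h => hv (h ▸ hw)
  have hswap := vertexSign_mul_vertexSign_erase (K := K) (mem_insert_self v τ)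
    (mem_insert_of_mem hw) h
  rw [vertexSign_insert_self, erase_insert hv, erase_insert_of_ne hwv, vertexSign_insert_self]
    at hswap
  linear_combination vertexSign K κ τ w * vertexSign K κ (insert v τ) w * hswap
    - vertexSign K κ τ v * vertexSign K κ (insert v τ) w * vertexSign_mul_self (K := K) (κ := κ) τ w
    - vertexSign K κ τ w * vertexSign K κ (τ.erase w) v *
      vertexSign_mul_self (K := K) (κ := κ) (insert v τ) w

lemma boundary_single (Φ : Set (Finset W)) (σ : Finset W) (a : K) :
    boundary K κ Φ (Finsupp.single σ a) = a • faceBoundary K κ Φ σ :=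
  Finsupp.linearCombination_single ..

lemma boundary_mem_chains {x : Finset W →₀ K} (hx : x ∈ chains K Φ (i + 1)) :
    boundary K κ Φ x ∈ chains K Φ i := by
  refine map_mem_of_mem_chains hx fun σ _ hi => ?_
  rw [boundary_single, one_smul, faceBoundary]
  refine Submodule.sum_mem _ fun v hv => ?_
  split_ifs with h
  · have hcard : #(σ.erase v) = i := by rw [card_erase_of_mem hv, hi, Nat.add_sub_cancel]
    exact hcard ▸ single_mem_chains h _
  · exact Submodule.zero_mem _

lemma boundary_eq_zero_of_mem_chains_zero {x : Finset W →₀ K} (hx : x ∈ chains K Φ 0) :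
    boundary K κ Φ x = 0 :=
  eq_of_mem_chains (g := 0) hx fun σ _ hσ => by
    rw [boundary_single, faceBoundary, card_eq_zero.1 hσ, sum_empty, smul_zero,
      LinearMap.zero_apply]

lemma boundary_faceBoundary (hΦ : IsColoredComplex κ Φ) (hσ : σ ∈ Φ) :
    boundary K κ Φ (faceBoundary K κ Φ σ) = 0 := by
  classical
  let F : W → W → Finset W →₀ K := fun v w => if (σ.erase v).erase w ∈ Φ then
    Finsupp.single ((σ.erase v).erase w) (vertexSign K κ σ v * vertexSign K κ (σ.erase v) w) else 0
  have hsum : boundary K κ Φ (faceBoundary K κ Φ σ) = ∑ v ∈ σ, ∑ w ∈ σ.erase v, F v w := by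
    rw [faceBoundary, map_sum]
    refine sum_congr rfl fun v _ => ?_
    split_ifs with hv
    · rw [boundary_single, faceBoundary, smul_sum]
      refine sum_congr rfl fun w _ => ?_
      rw [smul_ite, smul_zero, Finsupp.smul_single', ← vertexSign, ← vertexSign]
    · refine map_zero (boundary K κ Φ) |>.trans (sum_eq_zero fun w _ => if_neg fun hw => ?_).symm
      exact hv (hΦ.ordConnected.out hw hσ ⟨erase_subset _ _, erase_subset _ _⟩)
  rw [hsum, sum_sigma']
  refine sum_involution (fun p _ => ⟨p.2, p.1⟩) ?_ ?_ ?_ fun _ _ => rfl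
  · rintro ⟨v, w⟩ hp
    simp only [mem_sigma, mem_erase] at hp
    obtain ⟨hv, hwv, hw⟩ := hp
    have hne : κ v ≠ κ w := fun h => hwv (hΦ.injOn σ hσ hv hw h).symm
    simp only [F]
    rw [erase_right_comm, vertexSign_mul_vertexSign_erase hv hw hne]
    split_ifs
    · rw [Finsupp.single_neg, neg_add_cancel]
    · exact add_zero 0
  · rintro ⟨v, w⟩ hp - heq
    rw [mem_sigma, mem_erase] at hp
    exact hp.2.1 (congrArg Sigma.fst heq)
  · rintro ⟨v, w⟩ hp
    simp only [mem_sigma, mem_erase] at hp ⊢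
    exact ⟨hp.2.2, hp.2.1.symm, hp.1⟩

lemma boundary_boundary (hΦ : IsColoredComplex κ Φ) {x : Finset W →₀ K} (hx : x ∈ chains K Φ i) :
    boundary K κ Φ (boundary K κ Φ x) = 0 :=
  eq_of_mem_chains (f := boundary K κ Φ ∘ₗ boundary K κ Φ) (g := 0) hx fun σ hσ _ => by
    rw [LinearMap.comp_apply, boundary_single, one_smul, boundary_faceBoundary hΦ hσ,
      LinearMap.zero_apply]

lemma vanishes_iff : Vanishes K κ Φ i ↔ ∀ z ∈ chains K Φ i, boundary K κ Φ z = 0 →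
    ∃ w ∈ chains K Φ (i + 1), boundary K κ Φ w = z :=
  ⟨fun h _ hz hz' => h ⟨hz, hz'⟩, fun h z hz => h z hz.1 hz.2⟩

lemma vanishes_of_card_ne (h : ∀ σ ∈ Φ, #σ ≠ i) : Vanishes K κ Φ i := by
  refine vanishes_iff.2 fun z hz _ => ⟨0, Submodule.zero_mem _, ?_⟩
  rw [map_zero]
  exact (eq_of_mem_chains (f := LinearMap.id) (g := 0) hz fun σ hσ hi => (h σ hσ hi).elim).symm

/-! ### The long exact sequence of a subcomplex -/

lemma proj_boundary (h : Ψ ⊆ Φ) (x : Finset W →₀ K) :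
    proj Ψ (boundary K κ Φ x) = boundary K κ Ψ x := by
  refine DFunLike.congr_fun (f := proj Ψ ∘ₗ boundary K κ Φ) (Finsupp.lhom_ext fun σ a => ?_) x
  rw [LinearMap.comp_apply, boundary_single, boundary_single, map_smul, faceBoundary, faceBoundary,
    map_sum]
  refine congrArg _ (sum_congr rfl fun v _ => ?_)
  by_cases hΨ : σ.erase v ∈ Ψ
  · rw [if_pos hΨ, if_pos (h hΨ), proj_single_of_mem hΨ]
  · rw [if_neg hΨ]
    split_ifs
    · exact proj_single_of_notMem hΨ _
    · exact map_zero _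

lemma boundary_eq_of_isSubcomplex (hΘ : IsSubcomplex Θ Φ) {x : Finset W →₀ K}
    (hx : x ∈ chains K Θ i) : boundary K κ Φ x = boundary K κ Θ x := by
  refine eq_of_mem_chains hx fun σ hσ _ => ?_
  rw [boundary_single, boundary_single, faceBoundary, faceBoundary]
  refine congrArg _ (sum_congr rfl fun v _ => ?_)
  have hiff : σ.erase v ∈ Φ ↔ σ.erase v ∈ Θ :=
    ⟨fun h => hΘ.mem_of_subset σ hσ _ h (erase_subset _ _), fun h => hΘ.subset h⟩
  by_cases h : σ.erase v ∈ Θ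
  · rw [if_pos h, if_pos (hiff.2 h)]
  · rw [if_neg h, if_neg (mt hiff.1 h)]

lemma boundary_sdiff_eq_zero (hΘ : IsSubcomplex Θ Φ) {x : Finset W →₀ K} (hx : x ∈ chains K Θ i) :
    boundary K κ (Φ \ Θ) x = 0 := by
  rw [← proj_boundary Set.sdiff_subset, boundary_eq_of_isSubcomplex hΘ hx]
  cases i with
  | zero => rw [boundary_eq_zero_of_mem_chains_zero hx, map_zero]
  | succ i =>
    have h := boundary_mem_chains (κ := κ) hx
    exact (proj_sdiff_eq_zero_iff (chains_mono hΘ.subset i h)).2 h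

/-- The homology of the quotient, described by relative cycles: chains of `Φ` whose boundary lies
in `Θ`. -/
lemma vanishes_sdiff_iff (hΘ : IsSubcomplex Θ Φ) : Vanishes K κ (Φ \ Θ) i ↔
    ∀ z ∈ chains K Φ i, proj (Φ \ Θ) (boundary K κ Φ z) = 0 →
      ∃ w ∈ chains K Φ (i + 1), z - boundary K κ Φ w ∈ chains K Θ i := by
  have hproj : ∀ {j : ℕ} {x : Finset W →₀ K}, x ∈ chains K Φ j →
      boundary K κ (Φ \ Θ) (proj (Φ \ Θ) x) = boundary K κ (Φ \ Θ) x := fun {j x} hx => by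
    rw [← sub_eq_zero, ← map_sub, ← neg_sub, map_neg, neg_eq_zero]
    refine boundary_sdiff_eq_zero (i := j) hΘ ?_
    rw [← proj_sdiff_eq_zero_iff (Φ := Φ)
      (sub_mem hx (chains_mono Set.sdiff_subset j (proj_mem_chains hx))), map_sub,
      proj_eq_self (proj_mem_chains hx), sub_self]
  simp only [proj_boundary Set.sdiff_subset]
  refine vanishes_iff.trans ⟨fun h z hz hz' => ?_, fun h z hz hz' => ?_⟩
  · obtain ⟨w, hw, hwz⟩ := h (proj (Φ \ Θ) z) (proj_mem_chains hz) ((hproj hz).trans hz')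
    have hwΦ := chains_mono Set.sdiff_subset _ hw
    refine ⟨w, hwΦ, (proj_sdiff_eq_zero_iff (sub_mem hz (boundary_mem_chains hwΦ))).1 ?_⟩
    rw [map_sub, proj_boundary Set.sdiff_subset, hwz, sub_self]
  · have hzΦ := chains_mono Set.sdiff_subset i hz
    obtain ⟨w, hw, hwz⟩ := h z hzΦ hz'
    refine ⟨proj (Φ \ Θ) w, proj_mem_chains hw, ?_⟩
    have hzero := (proj_sdiff_eq_zero_iff (sub_mem hzΦ (boundary_mem_chains hw))).2 hwz
    rw [map_sub, proj_eq_self hz, proj_boundary Set.sdiff_subset, sub_eq_zero] at hzero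
    rw [hproj hw, ← hzero]

lemma Vanishes.quotient (hΦ : IsColoredComplex κ Φ) (hΘ : IsSubcomplex Θ Φ)
    (hvΦ : Vanishes K κ Φ i) (hvΘ : ∀ j, j + 1 = i → Vanishes K κ Θ j) :
    Vanishes K κ (Φ \ Θ) i := by
  refine (vanishes_sdiff_iff hΘ).2 fun z hz hz' => ?_
  obtain ⟨y, hy, hyz⟩ : ∃ y ∈ chains K Θ i, boundary K κ Φ y = boundary K κ Φ z := by
    cases i with
    | zero => exact ⟨0, Submodule.zero_mem _, by
        rw [map_zero, boundary_eq_zero_of_mem_chains_zero hz]⟩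
    | succ j =>
      have hzΘ := (proj_sdiff_eq_zero_iff (boundary_mem_chains hz)).1 hz'
      obtain ⟨y, hy, hyz⟩ := vanishes_iff.1 (hvΘ j rfl) _ hzΘ
        (by rw [← boundary_eq_of_isSubcomplex hΘ hzΘ, boundary_boundary hΦ hz])
      exact ⟨y, hy, by rw [boundary_eq_of_isSubcomplex hΘ hy, hyz]⟩
  obtain ⟨w, hw, hwz⟩ := vanishes_iff.1 hvΦ (z - y)
    (sub_mem hz (chains_mono hΘ.subset i hy)) (by rw [map_sub, hyz, sub_self])
  exact ⟨w, hw, by rwa [hwz, sub_sub_cancel]⟩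

lemma Vanishes.extension (hΦ : IsColoredComplex κ Φ) (hΘ : IsSubcomplex Θ Φ)
    (hvΘ : Vanishes K κ Θ i) (hv : Vanishes K κ (Φ \ Θ) i) : Vanishes K κ Φ i := by
  refine vanishes_iff.2 fun z hz hz' => ?_
  obtain ⟨w, hw, hwz⟩ := (vanishes_sdiff_iff hΘ).1 hv z hz (by rw [hz', map_zero])
  obtain ⟨y, hy, hyz⟩ := vanishes_iff.1 hvΘ _ hwz (by
    rw [← boundary_eq_of_isSubcomplex hΘ hwz, map_sub, hz', boundary_boundary hΦ hw, sub_zero])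
  refine ⟨w + y, add_mem hw (chains_mono hΘ.subset _ hy), ?_⟩
  rw [map_add, boundary_eq_of_isSubcomplex hΘ hy, hyz, add_sub_cancel]

lemma Vanishes.subcomplex (hΦ : IsColoredComplex κ Φ) (hΘ : IsSubcomplex Θ Φ)
    (hvΦ : Vanishes K κ Φ i) (hv : Vanishes K κ (Φ \ Θ) (i + 1)) : Vanishes K κ Θ i := by
  refine vanishes_iff.2 fun z hz hz' => ?_
  have hzΦ := chains_mono hΘ.subset i hz
  obtain ⟨w, hw, hwz⟩ := vanishes_iff.1 hvΦ z hzΦ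
    (by rw [boundary_eq_of_isSubcomplex hΘ hz, hz'])
  obtain ⟨y, hy, hyw⟩ := (vanishes_sdiff_iff hΘ).1 hv w hw
    (by rw [hwz]; exact (proj_sdiff_eq_zero_iff hzΦ).2 hz)
  refine ⟨_, hyw, ?_⟩
  rw [← boundary_eq_of_isSubcomplex hΘ hyw, map_sub, boundary_boundary hΦ hy, hwz, sub_zero]

lemma Vanishes.union (hΦ : IsColoredComplex κ (Φ ∪ Ψ)) (h₁ : IsSubcomplex Φ (Φ ∪ Ψ))
    (h₂ : IsSubcomplex Ψ (Φ ∪ Ψ)) (v₁ : Vanishes K κ Φ i) (v₂ : Vanishes K κ Ψ i)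
    (v₁₂ : ∀ j, j + 1 = i → Vanishes K κ (Φ ∩ Ψ) j) : Vanishes K κ (Φ ∪ Ψ) i := by
  refine Vanishes.extension hΦ h₁ v₁ ?_
  rw [Set.union_sdiff_left, ← Set.sdiff_inter_self_eq_sdiff]
  exact Vanishes.quotient (hΦ.mono h₂) ⟨Set.inter_subset_right, fun σ hσ τ hτ hle =>
    ⟨h₁.mem_of_subset σ hσ.1 τ (Or.inr hτ) hle, hτ⟩⟩ v₂ v₁₂

lemma vanishes_biUnion {ι : Type*} (s : Finset ι) (Ψ : ι → Set (Finset W))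
    (hΨ : ∀ a ∈ s, IsColoredComplex κ (Ψ a))
    (hsep : ∀ a ∈ s, ∀ b ∈ s, ∀ σ ∈ Ψ a, ∀ τ ∈ Ψ b, τ ⊆ σ → a = b)
    (hv : ∀ a ∈ s, Vanishes K κ (Ψ a) i) : Vanishes K κ (⋃ a ∈ s, Ψ a) i := by
  classical
  have hcolored : ∀ t ⊆ s, IsColoredComplex κ (⋃ a ∈ t, Ψ a) := by
    refine fun t ht => ⟨fun σ hσ => ?_, ⟨fun ρ hρ σ hσ τ hτ => ?_⟩⟩
    · obtain ⟨a, ha, hσ⟩ := Set.mem_iUnion₂.1 hσ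
      exact (hΨ a (ht ha)).injOn σ hσ
    · obtain ⟨a, ha, hσ⟩ := Set.mem_iUnion₂.1 hσ
      obtain ⟨b, hb, hρ⟩ := Set.mem_iUnion₂.1 hρ
      obtain rfl := hsep a (ht ha) b (ht hb) σ hσ ρ hρ (hτ.1.trans hτ.2)
      exact Set.mem_iUnion₂.2 ⟨a, ha, (hΨ a (ht ha)).ordConnected.out hρ hσ hτ⟩
  have hsub : ∀ t ⊆ s, ∀ u ⊆ t, IsSubcomplex (⋃ a ∈ u, Ψ a) (⋃ a ∈ t, Ψ a) := by
    refine fun t ht u hu => ⟨Set.biUnion_subset_biUnion_left hu, fun σ hσ τ hτ hle => ?_⟩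
    obtain ⟨a, ha, hσ⟩ := Set.mem_iUnion₂.1 hσ
    obtain ⟨b, hb, hτ⟩ := Set.mem_iUnion₂.1 hτ
    obtain rfl := hsep a (ht (hu ha)) b (ht hb) σ hσ τ hτ hle
    exact Set.mem_iUnion₂.2 ⟨a, ha, hτ⟩
  suffices ∀ t ⊆ s, Vanishes K κ (⋃ a ∈ t, Ψ a) i from this s subset_rfl
  intro t
  induction t using Finset.induction_on with
  | empty => exact fun _ => vanishes_of_card_ne (by simp)
  | insert a t ha ih =>
    intro ht
    have hts := (subset_insert a t).trans ht
    have hdiff : (⋃ b ∈ insert a t, Ψ b) \ (⋃ b ∈ t, Ψ b) = Ψ a := by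
      rw [set_biUnion_insert, Set.union_sdiff_right, sdiff_eq_left, Set.disjoint_iUnion₂_right]
      refine fun b hb => Set.disjoint_left.2 fun σ hσ hσ' => ha ?_
      exact hsep a (ht (mem_insert_self a t)) b (hts hb) σ hσ σ hσ' subset_rfl ▸ hb
    refine Vanishes.extension (hcolored _ ht) (hsub _ ht t (subset_insert a t)) (ih hts) ?_
    rw [hdiff]
    exact hv a (ht (mem_insert_self a t))

/-! ### Cones -/

/-- The cone operator with apex `v` on chains. -/
noncomputable def coneChain (κ : W → ℕ) (v : W) : (Finset W →₀ K) →ₗ[K] (Finset W →₀ K) :=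
  Finsupp.linearCombination K fun τ =>
    if v ∈ τ then 0 else Finsupp.single (insert v τ) (vertexSign K κ τ v)

lemma coneChain_single_of_mem {τ : Finset W} (hv : v ∈ τ) (a : K) :
    coneChain κ v (Finsupp.single τ a) = 0 := by
  rw [coneChain, Finsupp.linearCombination_single, if_pos hv, smul_zero]

lemma coneChain_single_of_notMem {τ : Finset W} (hv : v ∉ τ) (a : K) :
    coneChain κ v (Finsupp.single τ a) =
      Finsupp.single (insert v τ) (a * vertexSign K κ τ v) := by
  rw [coneChain, Finsupp.linearCombination_single, if_neg hv, Finsupp.smul_single']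

lemma coneChain_faceBoundary (her : ∀ τ ∈ Φ, τ.erase v ∈ Φ) (hτ : τ ∈ Φ) (hv : v ∈ τ) :
    coneChain κ v (faceBoundary K κ Φ τ) = Finsupp.single τ 1 := by
  have hself : vertexSign K κ τ v * vertexSign K κ (τ.erase v) v = 1 := by
    rw [vertexSign_erase_of_not_lt _ (lt_irrefl _), vertexSign_mul_self]
  rw [faceBoundary, map_sum, sum_eq_single_of_mem v hv, if_pos (her τ hτ),
    coneChain_single_of_notMem (notMem_erase v τ), insert_erase hv, ← vertexSign, hself]
  intro w _ hwv
  split_ifs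
  · exact coneChain_single_of_mem (mem_erase.2 ⟨hwv.symm, hv⟩) _
  · exact map_zero _

lemma boundary_coneChain_add_coneChain_faceBoundary (hκ : ∀ τ ∈ Φ, Set.InjOn κ τ)
    (hins : ∀ τ ∈ Φ, insert v τ ∈ Φ) (her : ∀ τ ∈ Φ, τ.erase v ∈ Φ) (hτ : τ ∈ Φ) (hv : v ∉ τ) :
    boundary K κ Φ (coneChain κ v (Finsupp.single τ 1)) + coneChain κ v (faceBoundary K κ Φ τ) =
      Finsupp.single τ 1 := by
  rw [coneChain_single_of_notMem hv, one_mul, boundary_single, faceBoundary, faceBoundary,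
    sum_insert hv, erase_insert hv, if_pos hτ, ← vertexSign, smul_add, Finsupp.smul_single',
    vertexSign_insert_self, vertexSign_mul_self, add_assoc, add_eq_left, smul_sum, map_sum,
    ← sum_add_distrib]
  refine sum_eq_zero fun w hw => ?_
  have hvw : v ≠ w := fun h => hv (h ▸ hw)
  have hv' : v ∉ τ.erase w := fun h => hv (mem_of_mem_erase h)
  have hne : κ v ≠ κ w := fun h => hvw (hκ _ (hins τ hτ) (mem_insert_self v τ)
    (mem_insert_of_mem hw) h)
  rw [erase_insert_of_ne hvw]
  by_cases h : τ.erase w ∈ Φ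
  · rw [if_pos h, if_pos (hins _ h), coneChain_single_of_notMem hv', Finsupp.smul_single',
      ← Finsupp.single_add, ← vertexSign, ← vertexSign, vertexSign_mul_vertexSign_insert hv hw hne,
      neg_add_cancel, Finsupp.single_zero]
  · have h' : insert v (τ.erase w) ∉ Φ := fun h' => h (erase_insert hv' ▸ her _ h')
    rw [if_neg h, if_neg h', smul_zero, map_zero, add_zero]

lemma boundary_coneChain_add (hκ : ∀ τ ∈ Φ, Set.InjOn κ τ) (hins : ∀ τ ∈ Φ, insert v τ ∈ Φ)
    (her : ∀ τ ∈ Φ, τ.erase v ∈ Φ) {x : Finset W →₀ K} (hx : x ∈ chains K Φ i) :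
    boundary K κ Φ (coneChain κ v x) + coneChain κ v (boundary K κ Φ x) = x := by
  refine eq_of_mem_chains (f := boundary K κ Φ ∘ₗ coneChain κ v + coneChain κ v ∘ₗ boundary K κ Φ)
    (g := LinearMap.id) hx fun τ hτ _ => ?_
  simp only [LinearMap.add_apply, LinearMap.comp_apply, LinearMap.id_apply]
  rw [boundary_single Φ τ, one_smul]
  by_cases hv : v ∈ τ
  · rw [coneChain_single_of_mem hv, map_zero, zero_add, coneChain_faceBoundary her hτ hv]
  · exact boundary_coneChain_add_coneChain_faceBoundary hκ hins her hτ hv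

lemma vanishes_of_cone (hκ : ∀ τ ∈ Φ, Set.InjOn κ τ) (hins : ∀ τ ∈ Φ, insert v τ ∈ Φ)
    (her : ∀ τ ∈ Φ, τ.erase v ∈ Φ) (i : ℕ) : Vanishes K κ Φ i := by
  refine vanishes_iff.2 fun z hz hz' => ⟨coneChain κ v z, ?_, ?_⟩
  · refine map_mem_of_mem_chains hz fun τ hτ hi => ?_
    by_cases hv : v ∈ τ
    · rw [coneChain_single_of_mem hv]
      exact Submodule.zero_mem _
    · rw [coneChain_single_of_notMem hv, ← hi, ← card_insert_of_notMem hv]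
      exact single_mem_chains (hins τ hτ) _
  · simpa [hz'] using boundary_coneChain_add hκ hins her hz

end RelComplex

namespace RelComplex

open Finset

variable {W : Type*} {K : Type*} [Field K] {κ : W → ℕ} {Φ : Set (Finset W)}
  {σ ρ τ : Finset W} {i : ℕ}

/-! ### Stars and links -/

/-- The faces of `Φ` that contain `σ`. Up to a shift of the dimension, their chain complex is that
of the link of `σ`. -/
def star (Φ : Set (Finset W)) (σ : Finset W) : Set (Finset W) := {τ ∈ Φ | σ ⊆ τ}

lemma IsColoredComplex.star (hΦ : IsColoredComplex κ Φ) (σ : Finset W) :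
    IsColoredComplex κ (star Φ σ) where
  injOn τ hτ := hΦ.injOn τ hτ.1
  ordConnected := ⟨fun _ hρ _ hρ' _ hτ => ⟨hΦ.ordConnected.out hρ.1 hρ'.1 hτ, hρ.2.trans hτ.1⟩⟩

/-- The sign relating `σ` followed by `ρ` to the increasing order of `σ ∪ ρ`. -/
def joinSign (K : Type*) [Field K] (κ : W → ℕ) (σ ρ : Finset W) : K :=
  ∏ v ∈ ρ, vertexSign K κ σ v

lemma joinSign_mul_self (σ ρ : Finset W) : joinSign K κ σ ρ * joinSign K κ σ ρ = 1 := by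
  rw [joinSign, ← prod_mul_distrib]
  exact prod_eq_one fun v _ => vertexSign_mul_self σ v

variable [DecidableEq W]

/-- The shift from the chains of the link of `σ` to the chains of its star. -/
noncomputable def joinChain (κ : W → ℕ) (σ : Finset W) : (Finset W →₀ K) →ₗ[K] (Finset W →₀ K) :=
  Finsupp.linearCombination K fun ρ => Finsupp.single (σ ∪ ρ) (joinSign K κ σ ρ)

/-- The shift from the chains of the star of `σ` to the chains of its link. -/
noncomputable def sdiffChain (κ : W → ℕ) (σ : Finset W) : (Finset W →₀ K) →ₗ[K] (Finset W →₀ K) :=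
  Finsupp.linearCombination K fun τ => Finsupp.single (τ \ σ) (joinSign K κ σ (τ \ σ))

lemma joinChain_single (ρ : Finset W) (a : K) :
    joinChain κ σ (Finsupp.single ρ a) = Finsupp.single (σ ∪ ρ) (a * joinSign K κ σ ρ) := by
  rw [joinChain, Finsupp.linearCombination_single, Finsupp.smul_single']

lemma sdiffChain_single (τ : Finset W) (a : K) : sdiffChain κ σ (Finsupp.single τ a) =
    Finsupp.single (τ \ σ) (a * joinSign K κ σ (τ \ σ)) := by
  rw [sdiffChain, Finsupp.linearCombination_single, Finsupp.smul_single']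

lemma joinChain_mem_chains {x : Finset W →₀ K} (hx : x ∈ chains K (link Φ σ) i) :
    joinChain κ σ x ∈ chains K (star Φ σ) (i + #σ) := by
  refine map_mem_of_mem_chains hx fun ρ hρ hi => ?_
  rw [joinChain_single, ← hi, add_comm, ← card_union_of_disjoint hρ.1]
  exact single_mem_chains (Φ := star Φ σ) ⟨hρ.2, subset_union_left⟩ _

lemma sdiffChain_mem_chains {x : Finset W →₀ K} (hx : x ∈ chains K (star Φ σ) (i + #σ)) :
    sdiffChain κ σ x ∈ chains K (link Φ σ) i := by
  refine map_mem_of_mem_chains hx fun τ hτ hi => ?_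
  have hcard : #(τ \ σ) = i := by rw [card_sdiff_of_subset hτ.2, hi, Nat.add_sub_cancel]
  rw [sdiffChain_single, ← hcard]
  exact single_mem_chains (Φ := link Φ σ)
    ⟨disjoint_sdiff, (union_sdiff_of_subset hτ.2).symm ▸ hτ.1⟩ _

lemma sdiffChain_joinChain {x : Finset W →₀ K} (hx : x ∈ chains K (link Φ σ) i) :
    sdiffChain κ σ (joinChain κ σ x) = x :=
  eq_of_mem_chains (f := sdiffChain κ σ ∘ₗ joinChain κ σ) (g := LinearMap.id) hx fun ρ hρ _ => by
    rw [LinearMap.comp_apply, joinChain_single, sdiffChain_single, union_sdiff_cancel_left hρ.1,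
      mul_assoc, joinSign_mul_self, mul_one, LinearMap.id_apply]

lemma joinChain_sdiffChain {x : Finset W →₀ K} (hx : x ∈ chains K (star Φ σ) i) :
    joinChain κ σ (sdiffChain κ σ x) = x :=
  eq_of_mem_chains (f := joinChain κ σ ∘ₗ sdiffChain κ σ) (g := LinearMap.id) hx fun τ hτ _ => by
    rw [LinearMap.comp_apply, sdiffChain_single, joinChain_single, union_sdiff_of_subset hτ.2,
      mul_assoc, joinSign_mul_self, mul_one, LinearMap.id_apply]

/-- A vertex of `σ` does not contribute to the boundary, since deleting it leaves the star. -/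
lemma faceBoundary_star_union (h : Disjoint σ ρ) :
    joinSign K κ σ ρ • faceBoundary K κ (star Φ σ) (σ ∪ ρ) =
      joinChain κ σ (faceBoundary K κ (link Φ σ) ρ) := by
  have hzero : ∀ v ∈ σ, (σ ∪ ρ).erase v ∉ star Φ σ := fun v hv h' =>
    notMem_erase v _ (h'.2 hv)
  rw [faceBoundary, faceBoundary, sum_union h, sum_eq_zero fun v hv => if_neg (hzero v hv),
    zero_add, smul_sum, map_sum]
  refine sum_congr rfl fun v hv => ?_
  have hvσ : v ∉ σ := disjoint_right.1 h hv
  have herase : (σ ∪ ρ).erase v = σ ∪ ρ.erase v := by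
    rw [erase_union_distrib, erase_eq_of_notMem hvσ]
  have hsign : joinSign K κ σ ρ * vertexSign K κ (σ ∪ ρ) v =
      vertexSign K κ ρ v * joinSign K κ σ (ρ.erase v) := by
    rw [vertexSign_union h, joinSign, ← mul_prod_erase ρ _ hv, ← joinSign]
    linear_combination joinSign K κ σ (ρ.erase v) * vertexSign K κ ρ v *
      vertexSign_mul_self (K := K) (κ := κ) σ v
  rw [herase]
  by_cases hΦ : σ ∪ ρ.erase v ∈ Φ
  · rw [if_pos ⟨hΦ, subset_union_left⟩, if_pos ⟨h.mono_right (erase_subset _ _), hΦ⟩,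
      joinChain_single, Finsupp.smul_single', ← vertexSign, ← vertexSign, hsign]
  · rw [if_neg fun h => hΦ h.1, if_neg fun h => hΦ h.2, smul_zero, map_zero]

lemma boundary_joinChain {x : Finset W →₀ K} (hx : x ∈ chains K (link Φ σ) i) :
    boundary K κ (star Φ σ) (joinChain κ σ x) = joinChain κ σ (boundary K κ (link Φ σ) x) :=
  eq_of_mem_chains (f := boundary K κ (star Φ σ) ∘ₗ joinChain κ σ)
    (g := joinChain κ σ ∘ₗ boundary K κ (link Φ σ)) hx fun ρ hρ _ => by
    rw [LinearMap.comp_apply, LinearMap.comp_apply, joinChain_single, boundary_single,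
      boundary_single, one_mul, one_smul, faceBoundary_star_union hρ.1]

lemma vanishes_link_of_star (h : Vanishes K κ (star Φ σ) (i + #σ)) :
    Vanishes K κ (link Φ σ) i := by
  refine vanishes_iff.2 fun z hz hz' => ?_
  obtain ⟨y, hy, hyz⟩ := vanishes_iff.1 h (joinChain κ σ z) (joinChain_mem_chains hz)
    (by rw [boundary_joinChain hz, hz', map_zero])
  rw [add_right_comm] at hy
  have hw := sdiffChain_mem_chains (κ := κ) hy
  refine ⟨sdiffChain κ σ y, hw, ?_⟩
  rw [← sdiffChain_joinChain (κ := κ) (boundary_mem_chains hw), ← boundary_joinChain hw,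
    joinChain_sdiffChain hy, hyz, sdiffChain_joinChain hz]

end RelComplex

/-! ### Order complexes of preorders -/

namespace IdealChains

open Finset RelComplex Relation

variable {V : Type*}

/-- `I` is an order ideal of the preorder generated by `r`. -/
def IsDownClosed (r : V → V → Prop) (I : Finset V) : Prop :=
  ∀ u v, r u v → v ∈ I → u ∈ I

/-- `A` contains at most one vertex of each class of the preorder `Q`. -/
def IsPartialTransversal (Q : V → V → Prop) (A : Finset V) : Prop :=
  ∀ x ∈ A, ∀ y ∈ A, AntisymmRel Q x y → x = y

/-- The preorder generated by the preorder `Q` and the relation `u ≤ v`. -/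
def adjoinLE (Q : V → V → Prop) (u v x y : V) : Prop := Q x y ∨ Q x u ∧ Q v y

/-- The relation `r` together with the pairs in `F`, in both directions: up to transitive closure,
this is the contraction of the pairs in `F`. -/
def adjoin (r : V → V → Prop) (F : Finset (V × V)) (x y : V) : Prop :=
  r x y ∨ (x, y) ∈ F ∨ (y, x) ∈ F

/-- Chains of nonempty proper `r`-ideals such that each pair in `E` is separated by some member of
the chain. -/
def idealChains [Fintype V] (r : V → V → Prop) (E : Finset (V × V)) : Set (Finset (Finset V)) :=
  {τ | (∀ I ∈ τ, IsDownClosed r I ∧ I ≠ ∅ ∧ I ≠ univ) ∧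
    IsChain (· ⊆ ·) (τ : Set (Finset V)) ∧ ∀ e ∈ E, ∃ I ∈ τ, ¬ (e.1 ∈ I ↔ e.2 ∈ I)}

variable {r Q : V → V → Prop} {u v : V} {I J A : Finset V} {E : Finset (V × V)}

lemma isDownClosed_reflTransGen_iff : IsDownClosed (ReflTransGen r) I ↔ IsDownClosed r I := by
  refine ⟨fun h u v huv => h u v (.single huv), fun h u v huv => ?_⟩
  induction huv with
  | refl => exact id
  | tail _ hbc ih => exact fun hc => ih (h _ _ hbc hc)

lemma isDownClosed_adjoinLE_iff [IsPreorder V Q] :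
    IsDownClosed (adjoinLE Q u v) I ↔ IsDownClosed Q I ∧ (v ∈ I → u ∈ I) := by
  refine ⟨fun h => ⟨fun x y hxy => h x y (.inl hxy), h u v (.inr ⟨refl_of Q u, refl_of Q v⟩)⟩, ?_⟩
  rintro ⟨h, huv⟩ x y (hxy | ⟨hxu, hvy⟩) hy
  · exact h x y hxy hy
  · exact h x u hxu (huv (h v y hvy hy))

lemma isDownClosed_adjoin_singleton_iff {e : V × V} :
    IsDownClosed (adjoin r {e}) I ↔ IsDownClosed r I ∧ (e.1 ∈ I ↔ e.2 ∈ I) := by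
  refine ⟨fun h => ⟨fun x y hxy => h x y (.inl hxy), h _ _ (.inr (.inr (mem_singleton_self e))),
    h _ _ (.inr (.inl (mem_singleton_self e)))⟩, ?_⟩
  rintro ⟨h, he⟩ x y (hxy | hxy | hxy)
  · exact h x y hxy
  · obtain rfl := mem_singleton.1 hxy
    exact he.2
  · obtain rfl := mem_singleton.1 hxy
    exact he.1

lemma adjoin_empty (r : V → V → Prop) : adjoin r ∅ = r := by
  ext x y
  simp [adjoin]

lemma adjoin_adjoin [DecidableEq V] (r : V → V → Prop) (e : V × V) (F : Finset (V × V)) :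
    adjoin (adjoin r {e}) F = adjoin r (insert e F) := by
  ext x y
  simp only [adjoin, mem_insert, mem_singleton]
  tauto

instance [IsPreorder V Q] : IsPreorder V (adjoinLE Q u v) where
  refl x := .inl (refl_of Q x)
  trans x y z := by
    rintro (hxy | ⟨hxu, hvy⟩) (hyz | ⟨hyu, hvz⟩)
    · exact .inl (trans_of Q hxy hyz)
    · exact .inr ⟨trans_of Q hxy hyu, hvz⟩
    · exact .inr ⟨hxu, trans_of Q hvy hyz⟩
    · exact .inr ⟨hxu, hvz⟩

lemma lt_adjoinLE [IsPreorder V Q] (h : ¬ Q u v) : Q < adjoinLE Q u v :=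
  lt_of_le_not_ge (fun _ _ => .inl) fun hle => h (hle u v (.inr ⟨refl_of Q u, refl_of Q v⟩))

lemma IsPartialTransversal.adjoinLE [IsPreorder V Q] (hA : IsPartialTransversal Q A)
    (h : ¬ Q v u) : IsPartialTransversal (adjoinLE Q u v) A := by
  refine fun x hx y hy hxy => hA x hx y hy ?_
  obtain ⟨hxy | ⟨hxu, hvy⟩, hyx | ⟨hyu, hvx⟩⟩ := hxy
  · exact ⟨hxy, hyx⟩
  · exact absurd (trans_of Q hvx (trans_of Q hxy hyu)) h
  · exact absurd (trans_of Q hvy (trans_of Q hyx hxu)) h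
  · exact absurd (trans_of Q hvy hyu) h

lemma antisymmRel_adjoinLE_adjoinLE [IsPreorder V Q] (h : Q u v ↔ Q v u) {x y : V}
    (hxy : AntisymmRel (adjoinLE (adjoinLE Q u v) v u) x y) : AntisymmRel Q x y ∨
      AntisymmRel Q x u ∧ AntisymmRel Q y v ∨ AntisymmRel Q x v ∧ AntisymmRel Q y u := by
  have trans : ∀ {a b c}, Q a b → Q b c → Q a c := fun h h' => trans_of Q h h'
  simp only [AntisymmRel, IdealChains.adjoinLE] at hxy ⊢
  grind

open Classical in
lemma IsPartialTransversal.adjoinLE_adjoinLE [IsPreorder V Q] (hA : IsPartialTransversal Q A)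
    (h : Q u v ↔ Q v u) :
    IsPartialTransversal (IdealChains.adjoinLE (IdealChains.adjoinLE Q u v) v u)
      {a ∈ A | ¬ AntisymmRel Q a v} := by
  intro x hx y hy hxy
  rw [mem_filter] at hx hy
  rcases antisymmRel_adjoinLE_adjoinLE h hxy with hxy | ⟨-, hyv⟩ | ⟨hxv, -⟩
  · exact hA x hx.1 y hy.1 hxy
  · exact absurd hyv hy.2
  · exact absurd hxv hx.2

open Classical in
lemma IsPartialTransversal.card_le_card_filter_add_one [IsPreorder V Q]
    (hA : IsPartialTransversal Q A) (v : V) : #A ≤ #{a ∈ A | ¬ AntisymmRel Q a v} + 1 := by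
  have hone : #{a ∈ A | AntisymmRel Q a v} ≤ 1 := by
    refine card_le_one.2 fun a ha b hb => ?_
    rw [mem_filter] at ha hb
    exact hA a ha.1 b hb.1 (ha.2.trans hb.2.symm)
  rw [← card_filter_add_card_filter_not (s := A) (fun a => AntisymmRel Q a v)]
  omega

lemma IsPartialTransversal.anti {Q' : V → V → Prop} (h : Q ≤ Q')
    (hA : IsPartialTransversal Q' A) : IsPartialTransversal Q A :=
  fun x hx y hy hxy => hA x hx y hy ⟨h x y hxy.1, h y x hxy.2⟩

open Classical in
lemma reflTransGen_adjoin_insert_le (r : V → V → Prop) (e : V × V) (F : Finset (V × V)) :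
    ReflTransGen (adjoin r (insert e F)) ≤
      adjoinLE (adjoinLE (ReflTransGen (adjoin r F)) e.1 e.2) e.2 e.1 := by
  refine reflTransGen_le_of_le ?_
  have hF : adjoin r F ≤ adjoinLE (adjoinLE (ReflTransGen (adjoin r F)) e.1 e.2) e.2 e.1 :=
    fun x y hxy => .inl (.inl (.single hxy))
  rintro x y (hxy | hxy | hxy)
  · exact hF x y (.inl hxy)
  · rcases mem_insert.1 hxy with rfl | hxy
    · exact .inl (.inr ⟨.refl, .refl⟩)
    · exact hF x y (.inr (.inl hxy))
  · rcases mem_insert.1 hxy with rfl | hxy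
    · exact .inr ⟨.inl .refl, .inl .refl⟩
    · exact hF x y (.inr (.inr hxy))

lemma reflTransGen_adjoin_bot_symm {F : Finset (V × V)} {x y : V}
    (hxy : ReflTransGen (adjoin ⊥ F) x y) : ReflTransGen (adjoin ⊥ F) y x := by
  have : Std.Symm (adjoin (⊥ : V → V → Prop) F) :=
    ⟨fun _ _ hxy => hxy.elim False.elim fun hxy => .inr hxy.symm⟩
  exact symm_of _ hxy

lemma eq_of_card_eq_of_isChain {τ : Finset (Finset V)}
    (h : IsChain (· ⊆ ·) (τ : Set (Finset V))) (hI : I ∈ τ) (hJ : J ∈ τ) (hc : #I = #J) :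
    I = J := by
  rcases h.total hI hJ with h | h
  · exact eq_of_subset_of_card_le h hc.ge
  · exact (eq_of_subset_of_card_le h hc.le).symm

lemma IsDownClosed.subset_or_subset (htot : ∀ x y, Q x y ∨ Q y x) (hI : IsDownClosed Q I)
    (hJ : IsDownClosed Q J) : I ⊆ J ∨ J ⊆ I := by
  by_contra! h
  simp only [not_subset] at h
  obtain ⟨⟨a, haI, haJ⟩, b, hbJ, hbI⟩ := h
  rcases htot a b with hab | hba
  · exact haJ (hJ a b hab hbJ)
  · exact hbI (hI b a hba haI)

variable [Fintype V]

/-- Distinct classes generate distinct principal ideals, all but one of which are proper. -/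
lemma IsPartialTransversal.card_le_card_add_one [IsPreorder V Q] (hA : IsPartialTransversal Q A)
    {s : Finset (Finset V)} (hs : ∀ I, IsDownClosed Q I → I ≠ ∅ → I ≠ univ → I ∈ s) :
    #A ≤ #s + 1 := by
  classical
  let D : V → Finset V := fun a => {x | Q x a}
  have hself : ∀ a, a ∈ D a := fun a => mem_filter_univ a |>.2 (refl_of Q a)
  have hclosed : ∀ a, IsDownClosed Q (D a) := fun a x y hxy hy => by
    rw [mem_filter_univ] at hy ⊢
    exact trans_of Q hxy hy
  have hinj : Set.InjOn D A := fun a ha b hb hab => by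
    have hab' : a ∈ D b := hab ▸ hself a
    have hba' : b ∈ D a := hab ▸ hself b
    exact hA a ha b hb ⟨(mem_filter_univ a).1 hab', (mem_filter_univ b).1 hba'⟩
  calc #A = #(A.image D) := (card_image_of_injOn hinj).symm
    _ ≤ #(insert univ s) := card_le_card <| image_subset_iff.2 fun a _ => by
      by_cases huniv : D a = univ
      · exact huniv ▸ mem_insert_self _ _
      · exact mem_insert_of_mem (hs _ (hclosed a) (ne_empty_of_mem (hself a)) huniv)
    _ ≤ #s + 1 := card_insert_le _ _

lemma exists_isPartialTransversal_adjoin_bot (F : Finset (V × V)) :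
    ∃ A, IsPartialTransversal (ReflTransGen (adjoin ⊥ F)) A ∧ Fintype.card V ≤ #A + #F := by
  classical
  induction F using Finset.induction_on with
  | empty =>
    refine ⟨univ, fun x _ y _ hxy => ?_, by rw [card_univ]; exact Nat.le_add_right _ _⟩
    rw [adjoin_empty] at hxy
    exact (hxy.1.cases_tail.resolve_right fun ⟨_, _, h⟩ => h).symm
  | insert e F he ih =>
    obtain ⟨A, hA, hcard⟩ := ih
    refine ⟨_, (hA.adjoinLE_adjoinLE ⟨reflTransGen_adjoin_bot_symm,
      reflTransGen_adjoin_bot_symm⟩).anti (reflTransGen_adjoin_insert_le ⊥ e F), ?_⟩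
    have hfilter := hA.card_le_card_filter_add_one e.2
    rw [card_insert_of_notMem he]
    omega

lemma isColoredComplex_idealChains (r : V → V → Prop) (E : Finset (V × V)) :
    IsColoredComplex Finset.card (idealChains r E) where
  injOn _ hτ _ hI _ hJ h := eq_of_card_eq_of_isChain hτ.2.1 hI hJ h
  ordConnected := ⟨fun _ hρ _ hσ _ hτ => ⟨fun I hI => hσ.1 I (hτ.2 hI),
    hσ.2.1.mono (coe_subset.2 hτ.2), fun e he => let ⟨I, hI, h⟩ := hρ.2.2 e he; ⟨I, hτ.1 hI, h⟩⟩⟩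

lemma idealChains_reflTransGen (r : V → V → Prop) (E : Finset (V × V)) :
    idealChains (ReflTransGen r) E = idealChains r E := by
  simp only [idealChains, isDownClosed_reflTransGen_iff]

lemma mem_star_idealChains_iff_of_isDownClosed_iff {r' : V → V → Prop} {p : Finset V → Prop}
    (h : ∀ I, IsDownClosed r' I ↔ IsDownClosed r I ∧ p I) {σ τ : Finset (Finset V)} :
    τ ∈ star (idealChains r' E) σ ↔ τ ∈ star (idealChains r E) σ ∧ ∀ I ∈ τ, p I := by
  simp only [RelComplex.star, idealChains, Set.mem_ofPred_eq, h]
  grind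

lemma isSubcomplex_star_idealChains_of_isDownClosed_iff {r' : V → V → Prop} {p : Finset V → Prop}
    (h : ∀ I, IsDownClosed r' I ↔ IsDownClosed r I ∧ p I) (σ : Finset (Finset V)) :
    IsSubcomplex (star (idealChains r' E) σ) (star (idealChains r E) σ) := by
  have hmem := @mem_star_idealChains_iff_of_isDownClosed_iff V r E _ r' p h σ
  exact ⟨fun τ hτ => (hmem.1 hτ).1, fun τ hτ ρ hρ hle =>
    hmem.2 ⟨hρ, fun I hI => (hmem.1 hτ).2 I (hle hI)⟩⟩

/-- The members of a chain cannot separate `u` and `v` in both directions. -/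
lemma star_idealChains_eq_union [IsPreorder V Q] (u v : V) (σ : Finset (Finset V)) :
    star (idealChains Q ∅) σ =
      star (idealChains (adjoinLE Q u v) ∅) σ ∪ star (idealChains (adjoinLE Q v u) ∅) σ := by
  ext τ
  rw [Set.mem_union,
    mem_star_idealChains_iff_of_isDownClosed_iff fun _ => isDownClosed_adjoinLE_iff,
    mem_star_idealChains_iff_of_isDownClosed_iff fun _ => isDownClosed_adjoinLE_iff, ← and_or_left,
    iff_self_and]
  intro hτ
  by_contra! h
  obtain ⟨⟨I, hI, hvI, huI⟩, J, hJ, huJ, hvJ⟩ := h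
  rcases hτ.1.2.1.total hI hJ with hIJ | hJI
  · exact hvJ (hIJ hvI)
  · exact huI (hJI huJ)

lemma star_idealChains_adjoinLE_inter [IsPreorder V Q] (u v : V) (σ : Finset (Finset V)) :
    star (idealChains (adjoinLE Q u v) ∅) σ ∩ star (idealChains (adjoinLE Q v u) ∅) σ =
      star (idealChains (adjoinLE (adjoinLE Q u v) v u) ∅) σ := by
  ext τ
  rw [Set.mem_inter_iff,
    mem_star_idealChains_iff_of_isDownClosed_iff (r' := adjoinLE (adjoinLE Q u v) v u)
      fun _ => isDownClosed_adjoinLE_iff,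
    mem_star_idealChains_iff_of_isDownClosed_iff fun _ => isDownClosed_adjoinLE_iff,
    mem_star_idealChains_iff_of_isDownClosed_iff fun _ => isDownClosed_adjoinLE_iff]
  tauto

variable [DecidableEq V] {K : Type*} [Field K] {j : ℕ}

/-- If some proper ideal is missing from `σ`, then the star is a cone over it; otherwise the star is
a single face, of dimension at least `j`. -/
lemma vanishes_star_of_total [IsPreorder V Q] (htot : ∀ x y, Q x y ∨ Q y x)
    (hA : IsPartialTransversal Q A) (hj : j + 2 ≤ #A) (σ : Finset (Finset V)) :
    Vanishes K Finset.card (star (idealChains Q ∅) σ) j := by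
  by_cases hσ : ∀ I, IsDownClosed Q I → I ≠ ∅ → I ≠ univ → I ∈ σ
  · refine vanishes_of_card_ne fun τ hτ hcard => ?_
    have hle := card_le_card hτ.2
    have hAσ := hA.card_le_card_add_one hσ
    omega
  push Not at hσ
  obtain ⟨I, hI, hne, huniv, hIσ⟩ := hσ
  have hchain : ∀ τ : Finset (Finset V), (∀ J ∈ τ, IsDownClosed Q J ∧ J ≠ ∅ ∧ J ≠ univ) →
      τ ∈ idealChains Q ∅ := fun τ hτ => ⟨hτ, fun J hJ L hL _ =>
    (hτ J hJ).1.subset_or_subset htot (hτ L hL).1, fun _ he => absurd he (notMem_empty _)⟩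
  refine vanishes_of_cone (v := I) ((isColoredComplex_idealChains Q ∅).star σ).injOn
    (fun τ hτ => ⟨hchain _ ?_, hτ.2.trans (subset_insert I τ)⟩)
    (fun τ hτ => ⟨hchain _ fun J hJ => hτ.1.1 J (mem_of_mem_erase hJ),
      subset_erase.2 ⟨hτ.2, hIσ⟩⟩) j
  exact (forall_mem_insert I τ _).2 ⟨⟨hI, hne.ne_empty, huniv⟩, hτ.1.1⟩

lemma vanishes_star_preorder [hQ : IsPreorder V Q] (hA : IsPartialTransversal Q A)
    (hj : j + 2 ≤ #A) (σ : Finset (Finset V)) :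
    Vanishes K Finset.card (star (idealChains Q ∅) σ) j := by
  classical
  induction Q using WellFoundedGT.induction generalizing hQ A j with
  | ind Q ih =>
    by_cases htot : ∀ x y, Q x y ∨ Q y x
    · exact vanishes_star_of_total htot hA hj σ
    push Not at htot
    obtain ⟨u, v, huv, hvu⟩ := htot
    have hcolored := (isColoredComplex_idealChains Q ∅).star σ
    have hsub : ∀ u v, IsSubcomplex (star (idealChains (adjoinLE Q u v) ∅) σ)
        (star (idealChains Q ∅) σ) := fun u v =>
      isSubcomplex_star_idealChains_of_isDownClosed_iff (fun _ => isDownClosed_adjoinLE_iff) σ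
    have hunion := star_idealChains_eq_union (Q := Q) u v σ
    rw [hunion] at hcolored ⊢
    refine Vanishes.union hcolored (hunion ▸ hsub u v) (hunion ▸ hsub v u)
      (ih _ (lt_adjoinLE huv) (hA.adjoinLE hvu) hj) (ih _ (lt_adjoinLE hvu) (hA.adjoinLE huv) hj)
      fun k hk => ?_
    rw [star_idealChains_adjoinLE_inter]
    have hcard := hA.card_le_card_filter_add_one v
    exact ih _ ((lt_adjoinLE huv).trans_le fun _ _ => .inl)
      (hA.adjoinLE_adjoinLE (iff_of_false huv hvu)) (by omega)

lemma star_idealChains_insert (e : V × V) (r : V → V → Prop) (E : Finset (V × V))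
    (σ : Finset (Finset V)) : star (idealChains r (insert e E)) σ =
      star (idealChains r E) σ \ star (idealChains (adjoin r {e}) E) σ := by
  ext τ
  rw [Set.mem_sdiff, mem_star_idealChains_iff_of_isDownClosed_iff fun _ =>
    isDownClosed_adjoin_singleton_iff]
  simp only [RelComplex.star, idealChains, Set.mem_ofPred_eq, forall_mem_insert]
  grind

/-- Deletion and contraction of the pairs in `E`, one at a time. -/
lemma vanishes_star_idealChains {c : ℕ} (σ : Finset (Finset V)) (hj : j + 2 ≤ c)
    (hc : ∀ F ⊆ E, #F + #σ ≤ j →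
      ∃ A, IsPartialTransversal (ReflTransGen (adjoin r F)) A ∧ c ≤ #A + #F) :
    Vanishes K Finset.card (star (idealChains r E) σ) j := by
  induction E using Finset.induction_on generalizing r j c with
  | empty =>
    by_cases hσ : #σ ≤ j
    · obtain ⟨A, hA, hcA⟩ := hc ∅ subset_rfl (by rwa [card_empty, zero_add])
      rw [adjoin_empty] at hA
      rw [← idealChains_reflTransGen]
      exact vanishes_star_preorder hA (hj.trans hcA) σ
    · exact vanishes_of_card_ne fun τ hτ hcard => hσ (hcard ▸ card_le_card hτ.2)
  | insert e E he ih =>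
    rw [star_idealChains_insert]
    refine Vanishes.quotient ((isColoredComplex_idealChains _ _).star σ)
      (isSubcomplex_star_idealChains_of_isDownClosed_iff
        (fun _ => isDownClosed_adjoin_singleton_iff) σ)
      (ih hj fun F hFE => hc F (hFE.trans (subset_insert _ _))) fun k hk => ?_
    refine ih (c := c - 1) (by omega) fun F hFE hFk => ?_
    have hcard : #(insert e F) = #F + 1 := card_insert_of_notMem fun h => he (hFE h)
    obtain ⟨A, hA, hcA⟩ := hc (insert e F) (insert_subset_insert _ hFE) (by omega)
    rw [← adjoin_adjoin] at hA
    exact ⟨A, hA, by omega⟩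

end IdealChains

/-! ### The coloring complex -/

namespace MixedGraph

open Finset RelComplex IdealChains Relation

section OrderIdeals

variable {V : Type*} {S : Set (Finset V)} {I J : Finset V}

lemma ssubset_of_isChain_of_mem_of_notMem (hS : IsChain (· ⊆ ·) S) (hI : I ∈ S) (hJ : J ∈ S)
    {u : V} (huI : u ∉ I) (huJ : u ∈ J) : I ⊂ J :=
  Finset.ssubset_iff_subset_ne.2 ⟨(hS.total hI hJ).resolve_right fun h => huI (h huJ),
    fun h => huI (h ▸ huJ)⟩

variable [Fintype V]

lemma isChain_union_empty_univ (hS : IsChain (· ⊆ ·) S) :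
    IsChain (· ⊆ ·) (S ∪ {∅, univ}) := by
  rw [Set.union_comm, Set.insert_union, Set.singleton_union]
  exact (hS.insert fun I _ _ => .inr (subset_univ I)).insert fun I _ _ => .inl (empty_subset I)

lemma exists_consecutive_of_isChain (hS : IsChain (· ⊆ ·) S) (hempty : ∅ ∈ S) (huniv : univ ∈ S)
    (u : V) : ∃ I ∈ S, ∃ J ∈ S, u ∉ I ∧ u ∈ J ∧ I ⊂ J ∧ ∀ L ∈ S, I ⊂ L → ¬ L ⊂ J := by
  obtain ⟨J, hJ⟩ := (Set.toFinite {J ∈ S | u ∈ J}).exists_minimal ⟨univ, huniv, mem_univ u⟩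
  obtain ⟨I, hI⟩ := (Set.toFinite {I ∈ S | u ∉ I}).exists_maximal ⟨∅, hempty, notMem_empty u⟩
  refine ⟨I, hI.prop.1, J, hJ.prop.1, hI.prop.2, hJ.prop.2,
    ssubset_of_isChain_of_mem_of_notMem hS hI.prop.1 hJ.prop.1 hI.prop.2 hJ.prop.2,
    fun L hL hIL hLJ => ?_⟩
  by_cases huL : u ∈ L
  · exact hJ.not_prop_of_lt hLJ ⟨hL, huL⟩
  · exact hI.not_prop_of_gt hIL ⟨hL, huL⟩

end OrderIdeals

section MixedCycles

variable {V : Type*} (G : MixedGraph V) {u v : V} {F : Finset (V × V)}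

/-- The pairs of vertices joined by a directed edge. -/
def dirEdges : Set (Sym2 V) := {e | ∃ u v, G.dir.Adj u v ∧ e = s(u, v)}

variable {G}

lemma underlying_adj_of_dir_adj (huv : G.dir.Adj u v) (hne : u ≠ v) : G.underlying.Adj u v :=
  .inr ((SimpleGraph.fromRel_adj _ _ _).2 ⟨hne, .inl huv⟩)

lemma reflTransGen_avoiding {r : V → V → Prop} (h : ¬ r v u) {x : V} (hx : ReflTransGen r x u) :
    ReflTransGen (fun x y => r x y ∧ s(x, y) ≠ s(u, v)) x u := by
  induction hx using ReflTransGen.head_induction_on with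
  | refl => exact .refl
  | @head x y hxy _ ih =>
    by_cases hedge : s(x, y) = s(u, v)
    · rcases Sym2.eq_iff.1 hedge with ⟨rfl, -⟩ | ⟨rfl, rfl⟩
      · exact .refl
      · exact absurd hxy h
    · exact .head ⟨hxy, hedge⟩ ih

lemma reachable_fromEdgeSet_of_reflTransGen {r : V → V → Prop} {s : Set (Sym2 V)}
    (h : ∀ x y, r x y → s(x, y) ∈ s) {x y : V} (hxy : ReflTransGen r x y) :
    (SimpleGraph.fromEdgeSet s).Reachable x y := by
  rw [SimpleGraph.reachable_iff_reflTransGen]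
  refine reflTransGen_closed (fun x y hxy => ?_) x y hxy
  rcases eq_or_ne x y with rfl | hne
  · exact .refl
  · exact .single ((SimpleGraph.fromEdgeSet_adj s).2 ⟨h x y hxy, hne⟩)

variable [Fintype V]

lemma minUndirected_le_numUndirected (c : G.MixedCycle) : G.minUndirected ≤ c.numUndirected := by
  rw [minUndirected, if_pos ⟨c⟩]
  exact Nat.sInf_le ⟨c, rfl⟩

lemma minUndirected_le_card_of_reachable {T : Finset (Sym2 V)} (hT : ↑T ⊆ G.und.edgeSet)
    (huv : G.dir.Adj u v) (hne : u ≠ v) (huvT : s(u, v) ∉ T)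
    (hvu : (SimpleGraph.fromEdgeSet ((↑T ∪ G.dirEdges) \ {s(u, v)})).Reachable v u) :
    G.minUndirected ≤ #T := by
  classical
  obtain ⟨p, hp⟩ := hvu.exists_isPath
  have hedges : ∀ e ∈ p.edges, (e ∈ T ∨ e ∈ G.dirEdges) ∧ e ≠ s(u, v) := fun e he => by
    have hmem := p.edges_subset_edgeSet he
    rw [SimpleGraph.edgeSet_fromEdgeSet] at hmem
    exact hmem.1
  have hle : SimpleGraph.fromEdgeSet ((↑T ∪ G.dirEdges) \ {s(u, v)}) ≤ G.underlying := by
    refine (SimpleGraph.fromEdgeSet_le _).2 ?_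
    rintro _ ⟨⟨heT | ⟨x, y, hxy, rfl⟩, -⟩, hdiag⟩
    · exact SimpleGraph.edgeSet_mono le_sup_left (hT heT)
    · exact underlying_adj_of_dir_adj hxy hdiag
  let c : G.MixedCycle :=
    { base := u
      walk := .cons (underlying_adj_of_dir_adj huv hne) (p.mapLe hle)
      isCycle := by
        rw [SimpleGraph.Walk.cons_isCycle_iff, SimpleGraph.Walk.isPath_mapLe,
          SimpleGraph.Walk.edges_mapLe_eq_edges]
        exact ⟨hp, fun he => (hedges _ he).2 rfl⟩
      directed := {e | (e = s(u, v) ∨ e ∈ p.edges) ∧ e ∉ T}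
      directed_subset := fun e he => by simpa using he.1
      directed_adj := by
        rintro e ⟨rfl | he, heT⟩
        · exact ⟨u, v, huv, rfl⟩
        · exact (hedges e he).1.resolve_left heT
      directed_nonempty := ⟨s(u, v), .inl rfl, huvT⟩
      undirected_adj := fun e he hdir => hT <| by_contra fun heT =>
        hdir ⟨by simpa using he, heT⟩ }
  calc G.minUndirected ≤ c.numUndirected := minUndirected_le_numUndirected c
    _ ≤ (T : Set (Sym2 V)).ncard := by
        refine Set.ncard_le_ncard (fun e he => by_contra fun heT => he.2 ?_) T.finite_toSet
        exact ⟨by simpa [c] using he.1, heT⟩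
    _ = #T := Set.ncard_coe_finset T

/-- Otherwise a path from `v` to `u` through directed edges and `F` would close up with the edge
`(u, v)` to a mixed cycle whose undirected edges belong to `F`. -/
lemma reflTransGen_adjoin_bot_of_adj (hG : G.IsAcyclic) (hF : ∀ e ∈ F, G.und.Adj e.1 e.2)
    (hm : #F < G.minUndirected) (huv : G.dir.Adj u v)
    (hvu : ReflTransGen (adjoin G.dir.Adj F) v u) : ReflTransGen (adjoin ⊥ F) u v := by
  classical
  by_contra hcon
  have hne : u ≠ v := fun h => hcon (h ▸ .refl)
  have hdir : ¬ G.dir.Adj v u := fun h => hG u (.tail (.single huv) h)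
  have huvF : (u, v) ∉ F := fun h => hcon (.single (.inr (.inl h)))
  have hvuF : (v, u) ∉ F := fun h => hcon (.single (.inr (.inr h)))
  let T : Finset (Sym2 V) := F.image fun e => s(e.1, e.2)
  have hT : ↑T ⊆ G.und.edgeSet := fun e he => by
    obtain ⟨e, heF, rfl⟩ := mem_image.1 he
    exact hF e heF
  have huvT : s(u, v) ∉ T := fun h => by
    obtain ⟨e, heF, he⟩ := mem_image.1 h
    rcases Sym2.eq_iff.1 he with ⟨rfl, rfl⟩ | ⟨rfl, rfl⟩
    · exact huvF heF
    · exact hvuF heF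
  have hedge : ∀ x y, adjoin G.dir.Adj F x y ∧ s(x, y) ≠ s(u, v) →
      s(x, y) ∈ (↑T ∪ G.dirEdges) \ {s(u, v)} := by
    rintro x y ⟨hxy | hxy | hxy, hxyuv⟩
    · exact ⟨.inr ⟨x, y, hxy, rfl⟩, hxyuv⟩
    · exact ⟨.inl (mem_image_of_mem _ hxy), hxyuv⟩
    · exact ⟨.inl (mem_image.2 ⟨_, hxy, Sym2.eq_swap⟩), hxyuv⟩
  have hreach := reachable_fromEdgeSet_of_reflTransGen hedge
    (reflTransGen_avoiding (by simp only [adjoin]; tauto) hvu)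
  exact (hm.trans_le (minUndirected_le_card_of_reachable hT huv hne huvT hreach)).not_ge
    card_image_le

lemma reflTransGen_adjoin_bot_of_antisymmRel (hG : G.IsAcyclic) (hF : ∀ e ∈ F, G.und.Adj e.1 e.2)
    (hm : #F < G.minUndirected) {x y : V}
    (hxy : AntisymmRel (ReflTransGen (adjoin G.dir.Adj F)) x y) :
    ReflTransGen (adjoin ⊥ F) x y := by
  obtain ⟨hxy, hyx⟩ := hxy
  induction hxy using ReflTransGen.head_induction_on with
  | refl => exact .refl
  | @head x z hxz hzy ih =>
    refine ReflTransGen.trans ?_ (ih (hyx.tail hxz))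
    rcases hxz with hdir | hmem
    · exact reflTransGen_adjoin_bot_of_adj hG hF hm hdir (hzy.trans hyx)
    · exact .single (.inr hmem)

end MixedCycles

section Flags

variable {V : Type*} [Fintype V] {G : MixedGraph V} {τ : Finset (Finset V)} {I : Finset V}

/-- A chain of nonempty proper subsets of `V`, that is, a face of the order complex of an
antichain. -/
structure IsFlag (τ : Finset (Finset V)) : Prop where
  isChain : IsChain (· ⊆ ·) (τ : Set (Finset V))
  ne_empty : ∀ I ∈ τ, I ≠ ∅
  ne_univ : ∀ I ∈ τ, I ≠ univ

lemma isFlag_of_mem_orderComplex (hτ : τ ∈ G.orderComplex) : IsFlag τ :=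
  ⟨hτ.2, fun I hI => (hτ.1 I hI).2.1, fun I hI => (hτ.1 I hI).2.2⟩

lemma IsFlag.card_mem_Icc (hτ : IsFlag τ) (hI : I ∈ τ) : #I ∈ Icc 1 (Fintype.card V - 1) := by
  have hpos := card_pos.2 (nonempty_iff_ne_empty.2 (hτ.ne_empty I hI))
  have hlt := (card_lt_iff_ne_univ I).2 (hτ.ne_univ I hI)
  rw [mem_Icc]
  omega

lemma IsFlag.card_image_card (hτ : IsFlag τ) : #(τ.image card) = #τ :=
  card_image_of_injOn fun _ hI _ hJ h => eq_of_card_eq_of_isChain hτ.isChain hI hJ h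

lemma IsFlag.card_insert_image_card [Nonempty V] (hτ : IsFlag τ) :
    #(insert 0 (insert (Fintype.card V) (τ.image card))) = #τ + 2 := by
  have hpos : 0 < Fintype.card V := Fintype.card_pos
  have hcard : ∀ k ∈ τ.image card, 0 < k ∧ k < Fintype.card V := by
    intro k hk
    obtain ⟨I, hI, rfl⟩ := mem_image.1 hk
    have hmem := mem_Icc.1 (hτ.card_mem_Icc hI)
    omega
  have htop : Fintype.card V ∉ τ.image card := fun h => (hcard _ h).2.false
  have hzero : 0 ∉ insert (Fintype.card V) (τ.image card) := fun h =>
    (mem_insert.1 h).elim hpos.ne fun h => (hcard _ h).1.false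
  rw [card_insert_of_notMem hzero, card_insert_of_notMem htop, hτ.card_image_card]

end Flags

section ColoringComplex

variable {V : Type*} [Fintype V] {G : MixedGraph V} {τ : Finset (Finset V)} {I : Finset V}

open Classical in
/-- The ordered pairs of vertices joined by an undirected edge. -/
noncomputable def undPairs (G : MixedGraph V) : Finset (V × V) := {e | G.und.Adj e.1 e.2}

lemma mem_undPairs {e : V × V} : e ∈ G.undPairs ↔ G.und.Adj e.1 e.2 := by
  classical exact mem_filter_univ e

lemma orderComplex_eq_idealChains (G : MixedGraph V) :
    G.orderComplex = idealChains G.dir.Adj ∅ := by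
  rw [← idealChains_reflTransGen]
  ext τ
  simp [orderComplex, idealChains, IsIdeal, IsDownClosed]

lemma exists_separating_of_mem_coloringComplex (hτ : τ ∈ G.coloringComplex) {u v : V}
    (huv : G.und.Adj u v) : ∃ I ∈ τ, ¬ (u ∈ I ↔ v ∈ I) := by
  by_contra! hsep
  obtain ⟨I, hI, J, hJ, huI, huJ, hIJ, hno⟩ := exists_consecutive_of_isChain
    (isChain_union_empty_univ hτ.1.2) (.inr (.inl rfl)) (.inr (.inr rfl)) u
  have hiff : ∀ L ∈ (τ : Set (Finset V)) ∪ {∅, univ}, u ∈ L ↔ v ∈ L := by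
    rintro L (hL | rfl | rfl)
    · exact hsep L hL
    · exact iff_of_false (notMem_empty u) (notMem_empty v)
    · exact iff_of_true (mem_univ u) (mem_univ v)
  exact hτ.2 I hI J hJ hIJ (fun ⟨L, hL, hIL, hLJ⟩ => hno L (.inl hL) hIL hLJ) u v huJ huI
    ((hiff J hJ).1 huJ) (fun hvI => huI ((hiff I hI).2 hvI)) huv

lemma mem_coloringComplex_of_forall_exists_separating (hτ : τ ∈ G.orderComplex)
    (h : ∀ u v, G.und.Adj u v → ∃ I ∈ τ, ¬ (u ∈ I ↔ v ∈ I)) : τ ∈ G.coloringComplex := by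
  refine ⟨hτ, fun I hI J hJ _ hno u v huJ huI hvJ hvI huv => ?_⟩
  have hchain := isChain_union_empty_univ hτ.2
  have hbetween : ∀ L ∈ τ, ∀ a ∈ L, a ∉ I → ∀ b ∈ J, b ∉ L → False :=
    fun L hL a haL haI b hbJ hbL => hno ⟨L, hL,
      ssubset_of_isChain_of_mem_of_notMem hchain hI (.inl hL) haI haL,
      ssubset_of_isChain_of_mem_of_notMem hchain (.inl hL) hJ hbL hbJ⟩
  obtain ⟨L, hL, hsep⟩ := h u v huv
  by_cases huL : u ∈ L
  · exact hbetween L hL u huL huI v hvJ fun hvL => hsep (iff_of_true huL hvL)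
  · exact hbetween L hL v (by_contra fun hvL => hsep (iff_of_false huL hvL)) hvI u huJ huL

lemma coloringComplex_eq_idealChains (G : MixedGraph V) :
    G.coloringComplex = idealChains G.dir.Adj G.undPairs := by
  ext τ
  refine ⟨fun hτ => ?_, fun hτ => mem_coloringComplex_of_forall_exists_separating ?_
    fun u v huv => hτ.2.2 (u, v) (mem_undPairs.2 huv)⟩
  · have hchain := hτ.1
    rw [orderComplex_eq_idealChains] at hchain
    exact ⟨hchain.1, hchain.2.1, fun e he =>
      exists_separating_of_mem_coloringComplex hτ (mem_undPairs.1 he)⟩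
  · rw [orderComplex_eq_idealChains]
    exact ⟨hτ.1, hτ.2.1, fun _ he => absurd he (notMem_empty _)⟩

lemma isColoredComplex_coloringComplex (G : MixedGraph V) :
    IsColoredComplex Finset.card G.coloringComplex := by
  rw [coloringComplex_eq_idealChains]
  exact isColoredComplex_idealChains _ _

lemma card_le_of_mem_orderComplex (hτ : τ ∈ G.orderComplex) : #τ ≤ Fintype.card V - 1 := by
  have hflag := isFlag_of_mem_orderComplex hτ
  rw [← hflag.card_image_card]
  calc #(τ.image card) ≤ #(Icc 1 (Fintype.card V - 1)) :=
        card_le_card (image_subset_iff.2 fun I hI => hflag.card_mem_Icc hI)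
    _ = Fintype.card V - 1 := Nat.card_Icc _ _

lemma link_sdiff_link_orderComplex (G : MixedGraph V) [DecidableEq V] (σ : Finset (Finset V)) :
    link G.orderComplex σ \ link (G.orderComplex \ G.coloringComplex) σ =
      link G.coloringComplex σ := by
  ext τ
  refine ⟨fun ⟨hτ, hnot⟩ => ⟨hτ.1, ?_⟩, fun ⟨hdisj, hτ⟩ =>
    ⟨⟨hdisj, hτ.1⟩, fun hnot => hnot.2.2 hτ⟩⟩
  by_contra hcol
  exact hnot ⟨hτ.1, hτ.2, hcol⟩

/-- The faces of the coloring complex whose set of ranks lies between `B` and `N`. -/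
def rankInterval (G : MixedGraph V) (B N : Finset ℕ) : Set (Finset (Finset V)) :=
  {τ ∈ G.coloringComplex | B ⊆ τ.image card ∧ τ.image card ⊆ N}

lemma isColoredComplex_rankInterval (G : MixedGraph V) (B N : Finset ℕ) :
    IsColoredComplex Finset.card (G.rankInterval B N) where
  injOn τ hτ := (isColoredComplex_coloringComplex G).injOn τ hτ.1
  ordConnected := ⟨fun _ hρ _ hσ _ hτ =>
    ⟨(isColoredComplex_coloringComplex G).ordConnected.out hρ.1 hσ.1 hτ,
      hρ.2.1.trans (image_subset_image hτ.1), (image_subset_image hτ.2).trans hσ.2.2⟩⟩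

lemma isSubcomplex_rankInterval (G : MixedGraph V) (B : Finset ℕ) {N N' : Finset ℕ} (h : N ⊆ N') :
    IsSubcomplex (G.rankInterval B N) (G.rankInterval B N') where
  subset _ hτ := ⟨hτ.1, hτ.2.1, hτ.2.2.trans h⟩
  mem_of_subset _ hσ _ hτ hle := ⟨hτ.1, hτ.2.1, (image_subset_image hle).trans hσ.2.2⟩

lemma rankInterval_insert_sdiff (G : MixedGraph V) {B N : Finset ℕ} {a : ℕ} (ha : a ∉ N) :
    G.rankInterval B (insert a N) \ G.rankInterval B N =
      G.rankInterval (insert a B) (insert a N) := by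
  ext τ
  constructor
  · rintro ⟨⟨hτ, hB, hN⟩, hnot⟩
    refine ⟨hτ, insert_subset ?_ hB, hN⟩
    by_contra haτ
    exact hnot ⟨hτ, hB, (subset_insert_iff_of_notMem haτ).1 hN⟩
  · rintro ⟨hτ, hB, hN⟩
    rw [insert_subset_iff] at hB
    exact ⟨⟨hτ, hB.2, hN⟩, fun h => ha (h.2.2 hB.1)⟩

open Classical in
lemma rankInterval_Icc_eq_biUnion_star (G : MixedGraph V) (B : Finset ℕ) :
    G.rankInterval B (Icc 1 (Fintype.card V - 1)) =
      ⋃ σ ∈ ({σ | σ ∈ G.orderComplex ∧ σ.image card = B} : Finset (Finset (Finset V))),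
        star G.coloringComplex σ := by
  ext τ
  simp only [Set.mem_iUnion, mem_filter_univ, exists_prop]
  constructor
  · rintro ⟨hτ, hB, -⟩
    refine ⟨{I ∈ τ | #I ∈ B}, ⟨⟨fun I hI => hτ.1.1 I (mem_of_mem_filter I hI),
      hτ.1.2.mono (coe_subset.2 (filter_subset _ _))⟩, ?_⟩, hτ, filter_subset _ _⟩
    rw [← filter_image (p := (· ∈ B)), filter_mem_eq_inter, inter_eq_right.2 hB]
  · rintro ⟨σ, ⟨-, rfl⟩, hτ, hστ⟩
    exact ⟨hτ, image_subset_image hστ,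
      image_subset_iff.2 fun I hI => (isFlag_of_mem_orderComplex hτ.1).card_mem_Icc hI⟩

lemma subset_of_image_card_eq (hτ : τ ∈ G.orderComplex) {σ ρ : Finset (Finset V)}
    (h : σ.image card = ρ.image card) (hσ : σ ⊆ τ) (hρ : ρ ⊆ τ) : σ ⊆ ρ := fun I hI => by
  obtain ⟨J, hJ, hIJ⟩ := mem_image.1 (h ▸ mem_image_of_mem card hI)
  rwa [← eq_of_card_eq_of_isChain hτ.2 (hρ hJ) (hσ hI) hIJ]

variable [DecidableEq V] {K : Type*} [Field K]

lemma vanishes_star_coloringComplex (hG : G.IsAcyclic) (σ : Finset (Finset V)) {j : ℕ}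
    (hj : j + 2 ≤ Fintype.card V) (hm : j < G.minUndirected + #σ) :
    Vanishes K Finset.card (star G.coloringComplex σ) j := by
  rw [coloringComplex_eq_idealChains]
  refine vanishes_star_idealChains σ hj fun F hF hFj => ?_
  obtain ⟨A, hA, hcard⟩ := exists_isPartialTransversal_adjoin_bot F
  have hconn := fun {x y} => reflTransGen_adjoin_bot_of_antisymmRel (x := x) (y := y) hG
    (fun e he => mem_undPairs.1 (hF he)) (by omega)
  exact ⟨A, fun x hx y hy hxy => hA x hx y hy ⟨hconn hxy, hconn hxy.symm⟩, hcard⟩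

theorem coloringComplexSatisfiesSerre_minUndirected (hG : G.IsAcyclic) :
    G.ColoringComplexSatisfiesSerre K G.minUndirected := by
  intro σ _ i hdim hi
  change Vanishes K Finset.card _ i
  rw [link_sdiff_link_orderComplex] at hdim ⊢
  obtain ⟨τ, ⟨hdisj, hτ⟩, hi'⟩ := hdim
  have hcard := card_le_of_mem_orderComplex hτ.1
  rw [card_union_of_disjoint hdisj] at hcard
  exact vanishes_link_of_star (vanishes_star_coloringComplex hG σ (by omega) (by omega))

lemma vanishes_rankInterval_Icc (hG : G.IsAcyclic) {j : ℕ} {B : Finset ℕ}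
    (hj : j + 2 ≤ Fintype.card V) (hm : j < G.minUndirected + #B) :
    Vanishes K Finset.card (G.rankInterval B (Icc 1 (Fintype.card V - 1))) j := by
  classical
  rw [rankInterval_Icc_eq_biUnion_star]
  refine vanishes_biUnion _ _ (fun σ _ => (isColoredComplex_coloringComplex G).star σ) ?_ ?_
  · intro σ hσ ρ hρ τ hτ τ' hτ' hle
    rw [mem_filter_univ] at hσ hρ
    have hρτ := hτ'.2.trans hle
    exact subset_antisymm (subset_of_image_card_eq hτ.1.1 (hσ.2.trans hρ.2.symm) hτ.2 hρτ)
      (subset_of_image_card_eq hτ.1.1 (hρ.2.trans hσ.2.symm) hρτ hτ.2)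
  · intro σ hσ
    rw [mem_filter_univ] at hσ
    rw [← hσ.2, (isFlag_of_mem_orderComplex hσ.1).card_image_card] at hm
    exact vanishes_star_coloringComplex hG σ hj hm

lemma vanishes_rankInterval (hG : G.IsAcyclic) {j : ℕ} {B N : Finset ℕ} (hB : B ⊆ N)
    (hN : N ⊆ Icc 1 (Fintype.card V - 1)) (hj : j < #N) (hm : j < G.minUndirected + #B) :
    Vanishes K Finset.card (G.rankInterval B N) j := by
  induction hM : #(Icc 1 (Fintype.card V - 1) \ N) generalizing N B j with
  | zero =>
    obtain rfl := hN.antisymm (sdiff_eq_empty_iff_subset.1 (card_eq_zero.1 hM))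
    rw [Nat.card_Icc] at hj
    exact vanishes_rankInterval_Icc hG (by omega) hm
  | succ M ih =>
    obtain ⟨a, ha⟩ := card_pos.1 (M.succ_pos.trans_eq hM.symm)
    have hcard : #(Icc 1 (Fintype.card V - 1) \ insert a N) = M := by
      rw [sdiff_insert, card_erase_of_mem ha, hM, Nat.add_sub_cancel]
    rw [mem_sdiff] at ha
    have hN' := insert_subset ha.1 hN
    have hcardN : #(insert a N) = #N + 1 := card_insert_of_notMem ha.2
    have hcardB : #(insert a B) = #B + 1 := card_insert_of_notMem fun h => ha.2 (hB h)
    refine Vanishes.subcomplex (isColoredComplex_rankInterval G B (insert a N))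
      (isSubcomplex_rankInterval G B (subset_insert a N))
      (ih (hB.trans (subset_insert a N)) hN' (by omega) hm hcard) ?_
    rw [rankInterval_insert_sdiff G ha.2]
    exact ih (insert_subset_insert a hB) hN' (by omega) (by omega) hcard

end ColoringComplex

end MixedGraph

/-! ### Effective characters -/

section EffectiveCharacters

variable {H : Type*} [Group H] {φ ψ : H → ℂ}

lemma isEffectiveCharacter_character {M : Type*} [AddCommGroup M] [Module ℂ M]
    [FiniteDimensional ℂ M] (ρ : Representation ℂ H M) : IsEffectiveCharacter ρ.character := by
  let e : M ≃ₗ[ℂ] (Fin (Module.finrank ℂ M) → ℂ) := (Module.finBasis ℂ M).equivFun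
  refine ⟨Module.finrank ℂ M,
    { toFun := fun g => e.conj (ρ g)
      map_one' := by rw [map_one]; exact LinearEquiv.conj_id e
      map_mul' := fun g h => by rw [map_mul]; exact LinearEquiv.conj_comp e _ _ }, ?_⟩
  ext g
  exact (LinearMap.trace_conj' (ρ g) e).symm

lemma IsEffectiveCharacter.zero : IsEffectiveCharacter (0 : H → ℂ) := by
  refine ⟨0, 1, funext fun g => ?_⟩
  rw [Representation.character, Subsingleton.elim ((1 : Representation ℂ H (Fin 0 → ℂ)) g) 0,
    map_zero, Pi.zero_apply]

lemma EffLE.refl (φ : H → ℂ) : EffLE φ φ := by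
  rw [EffLE, sub_self]
  exact IsEffectiveCharacter.zero

lemma IsEffectiveCharacter.add (hφ : IsEffectiveCharacter φ) (hψ : IsEffectiveCharacter ψ) :
    IsEffectiveCharacter (φ + ψ) := by
  obtain ⟨k, ρ, rfl⟩ := hφ
  obtain ⟨l, τ, rfl⟩ := hψ
  convert isEffectiveCharacter_character (ρ.prod τ) using 1
  ext g
  exact (LinearMap.trace_prodMap' (ρ g) (τ g)).symm

end EffectiveCharacters

section Trace

variable {F M N P : Type*} [Field F] [AddCommGroup M] [Module F M] [AddCommGroup N]
  [Module F N] [AddCommGroup P] [Module F P]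

lemma trace_restrict_congr {a : M →ₗ[F] M} {p q : Submodule F M} (h : p = q)
    (hp : ∀ x ∈ p, a x ∈ p) (hq : ∀ x ∈ q, a x ∈ q) :
    LinearMap.trace F p (a.restrict hp) = LinearMap.trace F q (a.restrict hq) := by
  subst h
  rfl

variable [Module.Finite F M] [Module.Finite F N] [Module.Finite F P]

lemma trace_eq_add_of_exact {i : N →ₗ[F] M} {f : M →ₗ[F] P} (hi : Function.Injective i)
    (hf : Function.Surjective f) (hif : Function.Exact i f) {a : M →ₗ[F] M} {b : N →ₗ[F] N}
    {c : P →ₗ[F] P} (hab : a ∘ₗ i = i ∘ₗ b) (hac : f ∘ₗ a = c ∘ₗ f) :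
    LinearMap.trace F M a = LinearMap.trace F N b + LinearMap.trace F P c := by
  obtain ⟨s, hs⟩ := f.exists_rightInverse_of_surjective (LinearMap.range_eq_top.2 hf)
  obtain ⟨r, hr⟩ := i.exists_leftInverse_of_injective (LinearMap.ker_eq_bot.2 hi)
  have hfs : ∀ x, f (s x) = x := LinearMap.congr_fun hs
  have hri : ∀ x, r (i x) = x := LinearMap.congr_fun hr
  let π : M →ₗ[F] N := r ∘ₗ (LinearMap.id - s ∘ₗ f)
  have hiπ : ∀ x, i (π x) = x - s (f x) := by
    intro x
    obtain ⟨y, hy⟩ := (hif (x - s (f x))).1 (by rw [map_sub, hfs, sub_self])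
    simp only [π, LinearMap.comp_apply, LinearMap.sub_apply, LinearMap.id_apply]
    rw [← hy, hri]
  have hsplit : a = (a ∘ₗ i) ∘ₗ π + (a ∘ₗ s) ∘ₗ f := by
    ext x
    simp [hiπ]
  have hsub : π ∘ₗ (a ∘ₗ i) = b := by
    rw [hab]
    ext x
    simp [π, hif.apply_apply_eq_zero, hri]
  have hquot : f ∘ₗ (a ∘ₗ s) = c := by
    rw [← LinearMap.comp_assoc, hac, LinearMap.comp_assoc, hs, LinearMap.comp_id]
  rw [hsplit, map_add, LinearMap.trace_comp_comm' π, LinearMap.trace_comp_comm' f, hsub, hquot]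

lemma trace_restrict_eq_add {a f : M →ₗ[F] M} (hcomm : ∀ x, f (a x) = a (f x))
    {p q r : Submodule F M} (hq : q = p ⊓ LinearMap.ker f) (hr : r = p.map f)
    (hap : ∀ x ∈ p, a x ∈ p) (haq : ∀ x ∈ q, a x ∈ q) (har : ∀ x ∈ r, a x ∈ r) :
    LinearMap.trace F p (a.restrict hap) =
      LinearMap.trace F q (a.restrict haq) + LinearMap.trace F r (a.restrict har) := by
  subst hq hr
  refine trace_eq_add_of_exact (i := Submodule.inclusion inf_le_left)
    (f := f.restrict fun x hx => Submodule.mem_map_of_mem hx)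
    (Submodule.inclusion_injective _) ?_ ?_ rfl (LinearMap.ext fun x => Subtype.ext (hcomm x))
  · rintro ⟨_, x, hx, rfl⟩
    exact ⟨⟨x, hx⟩, rfl⟩
  · rintro ⟨x, hx⟩
    constructor
    · intro h
      exact ⟨⟨x, hx, congrArg Subtype.val h⟩, rfl⟩
    · rintro ⟨⟨y, hy⟩, h⟩
      obtain rfl : y = x := congrArg Subtype.val h
      exact Subtype.ext hy.2

end Trace

namespace RelComplex

open Finset
open scoped Pointwise

variable {W : Type*} [DecidableEq W] {κ : W → ℕ} {Φ : Set (Finset W)} {i : ℕ}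
  {H : Type*} [Group H] [MulAction H W] (g : H)

/-- The permutation representation on the chains of all finite sets. -/
noncomputable def chainRep (H W : Type*) [DecidableEq W] [Group H] [MulAction H W] :
    Representation ℂ H (Finset W →₀ ℂ) where
  toFun g := Finsupp.lmapDomain ℂ ℂ (g • ·)
  map_one' := Finsupp.lhom_ext fun τ c => by simp
  map_mul' g h := Finsupp.lhom_ext fun τ c => by simp [mul_smul]

lemma chainRep_single (τ : Finset W) (c : ℂ) :
    chainRep H W g (Finsupp.single τ c) = Finsupp.single (g • τ) c := by
  simp [chainRep]

lemma vertexSign_smul {K : Type*} [Field K] (hκ : ∀ (g : H) w, κ (g • w) = κ w) (σ : Finset W)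
    (v : W) : vertexSign K κ (g • σ) (g • v) = vertexSign K κ σ v := by
  have hfilter : (g • σ).filter (κ · < κ (g • v)) = g • σ.filter (κ · < κ v) := by
    ext w
    rw [mem_filter, ← inv_smul_mem_iff, ← inv_smul_mem_iff, mem_filter, hκ, hκ]
  rw [vertexSign, vertexSign, hfilter, card_smul_finset]

lemma faceBoundary_smul (hκ : ∀ (g : H) w, κ (g • w) = κ w)
    (hΦ : ∀ (g : H) τ, g • τ ∈ Φ ↔ τ ∈ Φ) (σ : Finset W) :
    faceBoundary ℂ κ Φ (g • σ) = chainRep H W g (faceBoundary ℂ κ Φ σ) := by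
  rw [faceBoundary, faceBoundary, map_sum, smul_finset_def,
    sum_image (MulAction.injective g).injOn]
  refine sum_congr rfl fun v _ => ?_
  have herase : (σ.image (g • ·)).erase (g • v) = g • σ.erase v :=
    (image_erase (MulAction.injective g) σ v).symm
  rw [herase, apply_ite (chainRep H W g), chainRep_single, map_zero, ← smul_finset_def,
    ← vertexSign, ← vertexSign, vertexSign_smul g hκ]
  by_cases hv : σ.erase v ∈ Φ
  · rw [if_pos hv, if_pos ((hΦ g _).2 hv)]
  · rw [if_neg hv, if_neg (mt (hΦ g _).1 hv)]

lemma boundary_chainRep (hκ : ∀ (g : H) w, κ (g • w) = κ w)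
    (hΦ : ∀ (g : H) τ, g • τ ∈ Φ ↔ τ ∈ Φ) (x : Finset W →₀ ℂ) :
    boundary ℂ κ Φ (chainRep H W g x) = chainRep H W g (boundary ℂ κ Φ x) := by
  refine DFunLike.congr_fun (f := boundary ℂ κ Φ ∘ₗ chainRep H W g)
    (g := chainRep H W g ∘ₗ boundary ℂ κ Φ) (Finsupp.lhom_ext fun σ c => ?_) x
  rw [LinearMap.comp_apply, LinearMap.comp_apply, chainRep_single, boundary_single,
    boundary_single, map_smul, faceBoundary_smul g hκ hΦ]

lemma chainRep_mem_chains (hΦ : ∀ (g : H) τ, g • τ ∈ Φ ↔ τ ∈ Φ) {x : Finset W →₀ ℂ}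
    (hx : x ∈ chains ℂ Φ i) : chainRep H W g x ∈ chains ℂ Φ i := by
  refine map_mem_of_mem_chains hx fun σ hσ hi => ?_
  rw [chainRep_single, ← hi, ← card_smul_finset g σ]
  exact single_mem_chains ((hΦ g σ).2 hσ) 1

lemma chainRep_mem_cycles (hκ : ∀ (g : H) w, κ (g • w) = κ w)
    (hΦ : ∀ (g : H) τ, g • τ ∈ Φ ↔ τ ∈ Φ) {x : Finset W →₀ ℂ} (hx : x ∈ cycles ℂ κ Φ i) :
    chainRep H W g x ∈ cycles ℂ κ Φ i := by
  refine ⟨chainRep_mem_chains g hΦ hx.1, LinearMap.mem_ker.2 ?_⟩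
  rw [boundary_chainRep g hκ hΦ, LinearMap.mem_ker.1 hx.2, map_zero]

lemma cycles_zero : cycles ℂ κ Φ 0 = chains ℂ Φ 0 :=
  le_antisymm inf_le_left fun _ hx =>
    ⟨hx, LinearMap.mem_ker.2 (boundary_eq_zero_of_mem_chains_zero hx)⟩

lemma Vanishes.cycles_eq (hrel : IsColoredComplex κ Φ) (hv : Vanishes ℂ κ Φ i) :
    cycles ℂ κ Φ i = (chains ℂ Φ (i + 1)).map (boundary ℂ κ Φ) := by
  refine le_antisymm hv ?_
  rintro _ ⟨x, hx, rfl⟩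
  exact ⟨boundary_mem_chains hx, LinearMap.mem_ker.2 (boundary_boundary hrel hx)⟩

lemma trace_eq_sum_single {ι : Type*} [Fintype ι] (f : (ι →₀ ℂ) →ₗ[ℂ] (ι →₀ ℂ)) :
    LinearMap.trace ℂ _ f = ∑ a, f (Finsupp.single a 1) a := by
  classical
  rw [LinearMap.trace_eq_matrix_trace ℂ Finsupp.basisSingleOne, Matrix.trace]
  simp [Matrix.diag_apply, LinearMap.toMatrix_apply]

variable [Fintype W]

open Classical in
lemma trace_chainRep_chains (hΦ : ∀ (g : H) τ, g • τ ∈ Φ ↔ τ ∈ Φ) (i : ℕ) :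
    LinearMap.trace ℂ (chains ℂ Φ i)
      ((chainRep H W g).restrict fun _ hx => chainRep_mem_chains g hΦ hx)
      = (#{τ : Finset W | τ ∈ Φ ∧ #τ = i ∧ g • τ = τ} : ℂ) := by
  let Ψ : Set (Finset W) := {τ | τ ∈ Φ ∧ #τ = i}
  have hproj : ∀ x, chainRep H W g (proj Ψ x) ∈ chains ℂ Φ i := fun x =>
    chainRep_mem_chains g hΦ <| by
      refine (Finsupp.mem_supported _ _).2 fun σ hσ => by_contra fun hσΨ => ?_
      exact Finsupp.mem_support_iff.1 hσ (proj_apply_of_notMem hσΨ x)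
  have hrestrict : (chainRep H W g).restrict (fun _ hx => chainRep_mem_chains g hΦ hx) =
      (chainRep H W g ∘ₗ proj Ψ).restrict (p := chains ℂ Φ i) fun x _ => hproj x := by
    ext1 x
    refine Subtype.ext (congrArg (chainRep H W g) ?_)
    exact (eq_of_mem_chains (g := LinearMap.id) x.2 fun σ hσ hi =>
      proj_single_of_mem (Ψ := Ψ) ⟨hσ, hi⟩ 1).symm
  rw [hrestrict, LinearMap.trace_restrict_eq_of_forall_mem _ _ hproj, trace_eq_sum_single,
    card_filter, Nat.cast_sum]
  refine sum_congr rfl fun τ _ => ?_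
  rw [LinearMap.comp_apply]
  by_cases hτ : τ ∈ Ψ
  · rw [proj_single_of_mem hτ, chainRep_single, Finsupp.single_apply]
    simp [hτ.1, hτ.2]
  · rw [proj_single_of_notMem hτ, map_zero, if_neg fun h => hτ ⟨h.1, h.2.1⟩]
    simp

open Classical in
lemma trace_cycles_succ (hrel : IsColoredComplex κ Φ) (hκ : ∀ (g : H) w, κ (g • w) = κ w)
    (hΦ : ∀ (g : H) τ, g • τ ∈ Φ ↔ τ ∈ Φ) (hv : Vanishes ℂ κ Φ i) :
    LinearMap.trace ℂ (cycles ℂ κ Φ (i + 1))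
        ((chainRep H W g).restrict fun _ hx => chainRep_mem_cycles g hκ hΦ hx) =
      (#{τ : Finset W | τ ∈ Φ ∧ #τ = i + 1 ∧ g • τ = τ} : ℂ) -
      LinearMap.trace ℂ (cycles ℂ κ Φ i)
        ((chainRep H W g).restrict fun _ hx => chainRep_mem_cycles g hκ hΦ hx) := by
  rw [← trace_chainRep_chains g hΦ, eq_sub_iff_add_eq]
  exact (trace_restrict_eq_add (boundary_chainRep g hκ hΦ) rfl (hv.cycles_eq hrel) _ _ _).symm

open Classical in
lemma trace_cycles (hrel : IsColoredComplex κ Φ) (hκ : ∀ (g : H) w, κ (g • w) = κ w)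
    (hΦ : ∀ (g : H) τ, g • τ ∈ Φ ↔ τ ∈ Φ) {N : ℕ} (hv : ∀ j < N, Vanishes ℂ κ Φ j) :
    LinearMap.trace ℂ (cycles ℂ κ Φ N)
        ((chainRep H W g).restrict fun _ hx => chainRep_mem_cycles g hκ hΦ hx) =
      ∑ j ∈ range (N + 1),
        (-1 : ℂ) ^ (N - j) * (#{τ : Finset W | τ ∈ Φ ∧ #τ = j ∧ g • τ = τ} : ℂ) := by
  induction N with
  | zero =>
    rw [trace_restrict_congr cycles_zero _ fun _ hx => chainRep_mem_chains g hΦ hx,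
      trace_chainRep_chains g hΦ, zero_add, sum_range_one, Nat.sub_zero, pow_zero, one_mul]
  | succ N ih =>
    rw [trace_cycles_succ g hrel hκ hΦ (hv N N.lt_succ_self),
      ih fun j hj => hv j (hj.trans N.lt_succ_self), sum_range_succ _ (N + 1), Nat.sub_self,
      pow_zero, one_mul, sub_eq_add_neg, add_comm, ← sum_neg_distrib]
    refine congrArg (· + _) (sum_congr rfl fun j hj => ?_)
    rw [Nat.succ_sub (mem_range_succ_iff.1 hj), pow_succ]
    ring

open Classical in
/-- By the Hopf trace formula this alternating sum is the character of the space of cycles in the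
top dimension. -/
lemma isEffectiveCharacter_alternating (hrel : IsColoredComplex κ Φ)
    (hκ : ∀ (g : H) w, κ (g • w) = κ w) (hΦ : ∀ (g : H) τ, g • τ ∈ Φ ↔ τ ∈ Φ) {N : ℕ}
    (hv : ∀ j < N, Vanishes ℂ κ Φ j) :
    IsEffectiveCharacter fun g : H => ∑ j ∈ range (N + 1),
      (-1 : ℂ) ^ (N - j) * (#{τ : Finset W | τ ∈ Φ ∧ #τ = j ∧ g • τ = τ} : ℂ) := by
  convert isEffectiveCharacter_character (M := cycles ℂ κ Φ N)
    ((chainRep H W).subrepresentation _ fun g _ hx => chainRep_mem_cycles g hκ hΦ hx) using 1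
  exact funext fun g => (trace_cycles g hrel hκ hΦ hv).symm

end RelComplex

/-! ### Sums over Boolean intervals -/

section BooleanIntervals

open Finset

variable {ι : Type*}

open Classical in
lemma exists_injective_powersetCard_superset (Ω : Finset ι) {a b : ℕ} (hab : a ≤ b)
    (hΩ : a + b ≤ #Ω) : ∃ ψ : powersetCard a Ω → Finset ι, Function.Injective ψ ∧
      ∀ R, ψ R ∈ powersetCard b Ω ∧ R.1 ⊆ ψ R := by
  let t : powersetCard a Ω → Finset (Finset ι) := fun R => {Q ∈ powersetCard b Ω | R.1 ⊆ Q}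
  suffices hHall : ∀ s : Finset (powersetCard a Ω), #s ≤ #(s.biUnion t) by
    obtain ⟨ψ, hψ, hψt⟩ := (all_card_le_biUnion_card_iff_exists_injective t).1 hHall
    exact ⟨ψ, hψ, fun R => mem_filter.1 (hψt R)⟩
  intro s
  have hup : ∀ R ∈ s, (#Ω - a).choose (b - a) ≤
      #((s.biUnion t).bipartiteAbove (fun R Q => R.1 ⊆ Q) R) := by
    intro R hR
    obtain ⟨hRΩ, hRa⟩ := mem_powersetCard.1 R.2
    have hcard := card_filter_powersetCard_subset R.1 Ω b hRΩ (hRa.trans_le hab)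
    rw [hRa] at hcard
    rw [← hcard]
    exact card_le_card fun Q hQ => mem_filter.2
      ⟨mem_biUnion.2 ⟨R, hR, hQ⟩, (mem_filter.1 hQ).2⟩
  have hdown : ∀ Q ∈ s.biUnion t,
      #(s.bipartiteBelow (fun R Q => R.1 ⊆ Q) Q) ≤ b.choose a := by
    intro Q hQ
    obtain ⟨R, -, hQR⟩ := mem_biUnion.1 hQ
    rw [← (mem_powersetCard.1 (mem_filter.1 hQR).1).2, ← card_powersetCard]
    refine card_le_card_of_injOn Subtype.val (fun R' hR' => ?_) Subtype.val_injective.injOn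
    exact mem_powersetCard.2 ⟨(mem_filter.1 hR').2, (mem_powersetCard.1 R'.2).2⟩
  have hcount := card_mul_le_card_mul _ hup hdown
  have hchoose : b.choose a ≤ (#Ω - a).choose (b - a) := by
    rw [← Nat.choose_symm hab]
    exact Nat.choose_le_choose _ (by lia)
  exact Nat.le_of_mul_le_mul_right (hcount.trans (Nat.mul_le_mul_left _ hchoose))
    (Nat.choose_pos (by lia))

variable [DecidableEq ι] {Y : Type*} [AddCommGroup Y] {P : AddSubmonoid Y} {f β : Finset ι → Y}
  {m q : ℕ} {x : ι} {T Q R X Ω D : Finset ι}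

lemma sum_Icc_eq_erase_add_insert {M : Type*} [AddCommMonoid M] (f : Finset ι → M)
    (T Q : Finset ι) (x : ι) :
    ∑ S ∈ Icc T Q, f S = ∑ S ∈ Icc T (Q.erase x), f S + ∑ S ∈ Icc (insert x T) Q, f S := by
  rw [← sum_filter_not_add_sum_filter _ (x ∈ ·)]
  congr 2
  · ext S
    simp only [mem_filter, mem_Icc, subset_erase, and_assoc]
  · ext S
    simp only [mem_filter, mem_Icc, insert_subset_iff]
    tauto

/-- The sums of `β` over the intervals `[T, Q]` of subsets of `D` with `|T| ≤ m` lie in `P`. -/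
def IntervalPositive (P : AddSubmonoid Y) (β : Finset ι → Y) (D : Finset ι) (m : ℕ) : Prop :=
  ∀ T Q, T ⊆ Q → Q ⊆ D → #T ≤ m → ∑ S ∈ Icc T Q, β S ∈ P

lemma sum_Icc_choose_smul (f : Finset ι → Y) (T Q : Finset ι) (p : ℕ) :
    ∑ S ∈ Icc T Q, (#S - #T).choose p • f S =
      ∑ A ∈ powersetCard p (Q \ T), ∑ S ∈ Icc (T ∪ A) Q, f S := by
  have hcount : ∀ S ∈ Icc T Q, (#S - #T).choose p • f S = ∑ _A ∈ powersetCard p (S \ T), f S := by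
    intro S hS
    rw [sum_const, card_powersetCard, card_sdiff_of_subset (mem_Icc.1 hS).1]
  rw [sum_congr rfl hcount]
  refine sum_comm' fun S A => ?_
  simp only [mem_Icc, mem_powersetCard, union_subset_iff, subset_sdiff]
  constructor
  · rintro ⟨⟨hTS, hSQ⟩, ⟨hAS, hdisj⟩, hp⟩
    exact ⟨⟨⟨hTS, hAS⟩, hSQ⟩, ⟨hAS.trans hSQ, hdisj⟩, hp⟩
  · rintro ⟨⟨⟨hTS, hAS⟩, hSQ⟩, ⟨-, hdisj⟩, hp⟩
    exact ⟨⟨hTS, hSQ⟩, ⟨hAS, hdisj⟩, hp⟩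

namespace IntervalPositive

lemma sum_choose_card_sub_mem (h : IntervalPositive P β D m) (hTQ : T ⊆ Q) (hQ : Q ⊆ D) {p : ℕ}
    (hp : #T + p ≤ m) : ∑ S ∈ Icc T Q, (#S - #T).choose p • β S ∈ P := by
  rw [sum_Icc_choose_smul]
  refine sum_mem fun A hA => ?_
  obtain ⟨hAQ, hAp⟩ := mem_powersetCard.1 hA
  exact h _ _ (union_subset hTQ (hAQ.trans sdiff_subset)) hQ
    ((card_union_le _ _).trans (hAp.symm ▸ hp))

lemma sum_choose_mem (h : IntervalPositive P β D m) (hq : q ≤ m) {i : ℕ} (hTQ : T ⊆ Q)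
    (hQ : Q ⊆ D) (hi : i + #T ≤ q) :
    ∑ S ∈ Icc T Q with q ≤ #S, (i + #S - q).choose i • β S ∈ P := by
  induction hn : #(Q \ T) using Nat.strong_induction_on generalizing T Q with
  | _ n ih =>
  rw [sum_filter]
  rcases hi.eq_or_lt with rfl | hi
  · convert h.sum_choose_card_sub_mem hTQ hQ (p := i) (by lia) using 1
    refine sum_congr rfl fun S hS => ?_
    have hTS := card_le_card (mem_Icc.1 hS).1
    split_ifs with hS'
    · rw [Nat.add_sub_add_left]
    · rw [Nat.choose_eq_zero_of_lt (by lia), zero_smul]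
  rcases (Q \ T).eq_empty_or_nonempty with hempty | ⟨a, ha⟩
  · obtain rfl := hTQ.antisymm (sdiff_eq_empty_iff_subset.1 hempty)
    rw [Icc_self, sum_singleton, if_neg (by lia)]
    exact zero_mem P
  · obtain ⟨haQ, haT⟩ := mem_sdiff.1 ha
    have hlt := card_erase_lt_of_mem ha
    rw [sum_Icc_eq_erase_add_insert _ T Q a, ← sum_filter, ← sum_filter]
    refine add_mem (ih _ ?_ (subset_erase.2 ⟨hTQ, haT⟩) ((erase_subset a Q).trans hQ) hi.le rfl)
      (ih _ ?_ (insert_subset haQ hTQ) hQ ?_ rfl)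
    · rwa [← erase_sdiff_comm, hn] at hlt
    · rwa [sdiff_insert, ← hn]
    · rw [card_insert_of_notMem haT]
      lia

lemma sum_Icc_sub_mem (h : IntervalPositive P β D m) {Q' : Finset ι} (hTQ : T ⊆ Q)
    (hQ : Q ⊆ Q') (hD : Q' ⊆ D) (hT : #T + 1 ≤ m) :
    ∑ S ∈ Icc T Q', β S - ∑ S ∈ Icc T Q, β S ∈ P := by
  induction Q' using Finset.strongInduction with
  | H Q' ih =>
  rcases hQ.eq_or_ssubset with rfl | hlt
  · rw [sub_self]
    exact zero_mem P
  · obtain ⟨x, hxQ', hxQ⟩ := exists_of_ssubset hlt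
    have hxT : x ∉ T := fun hx => hxQ (hTQ hx)
    have hsmaller := ih (Q'.erase x) (erase_ssubset hxQ') (subset_erase.2 ⟨hQ, hxQ⟩)
      ((erase_subset x Q').trans hD)
    have hupper := h (insert x T) Q' (insert_subset hxQ' (hTQ.trans hQ)) hD
      (by rwa [card_insert_of_notMem hxT])
    rw [sum_Icc_eq_erase_add_insert β T Q' x, add_sub_right_comm]
    exact add_mem hsmaller hupper

end IntervalPositive

lemma sum_powersetCard_succ_eq_add (G : Finset ι → Y) (hx : x ∈ Ω) (c : ℕ) :
    ∑ R ∈ powersetCard (c + 1) Ω, G R = ∑ R ∈ powersetCard (c + 1) (Ω.erase x), G R +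
      ∑ R ∈ powersetCard c (Ω.erase x), G (insert x R) := by
  have hxR : ∀ {d : ℕ}, ∀ R ∈ powersetCard d (Ω.erase x), x ∉ R := fun R hR hxR =>
    notMem_erase x Ω ((mem_powersetCard.1 hR).1 hxR)
  conv_lhs => rw [← insert_erase hx, powersetCard_succ_insert (notMem_erase x Ω)]
  rw [sum_union, sum_image fun R hR R' hR' hRR' => by
    rw [← erase_insert (hxR R hR), hRR', erase_insert (hxR R' hR')]]
  refine disjoint_left.2 fun R hR hR' => ?_
  obtain ⟨R', -, rfl⟩ := mem_image.1 hR'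
  exact hxR _ hR (mem_insert_self x R')

lemma sum_powersetCard_inter_insert (f : Finset ι → Y) (hxΩ : x ∈ Ω) (hxX : x ∉ X) (hxT : x ∉ T)
    (c : ℕ) :
    ∑ R ∈ powersetCard (c + 1) Ω, ∑ S ∈ Icc T (T ∪ R ∩ insert x X), f S =
      ∑ R ∈ powersetCard (c + 1) Ω, ∑ S ∈ Icc T (T ∪ R ∩ X), f S +
        ∑ R ∈ powersetCard c (Ω.erase x), ∑ S ∈ Icc (insert x T) (insert x T ∪ R ∩ X), f S := by
  have hnotMem : ∀ R ∈ powersetCard (c + 1) (Ω.erase x), R ∩ insert x X = R ∩ X := fun R hR =>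
    inter_insert_of_notMem fun hxR => notMem_erase x Ω ((mem_powersetCard.1 hR).1 hxR)
  have hmem : ∀ R ∈ powersetCard c (Ω.erase x),
      ∑ S ∈ Icc T (T ∪ insert x R ∩ insert x X), f S = ∑ S ∈ Icc T (T ∪ insert x R ∩ X), f S +
        ∑ S ∈ Icc (insert x T) (insert x T ∪ R ∩ X), f S := by
    intro R _
    have hxRX : x ∉ T ∪ R ∩ X := by simp [hxX, hxT]
    rw [← insert_inter_distrib, union_insert, insert_inter_of_notMem hxX,
      sum_Icc_eq_erase_add_insert f T _ x, erase_insert hxRX, insert_union]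
  rw [sum_powersetCard_succ_eq_add _ hxΩ, sum_powersetCard_succ_eq_add _ hxΩ,
    sum_congr rfl hmem, sum_add_distrib, add_assoc]
  congr 1
  exact sum_congr rfl fun R hR => by rw [hnotMem R hR]

lemma sum_powersetCard_sdiff (α : Finset ι → Y) (D : Finset ι) (k : ℕ) :
    ∑ Q ∈ powersetCard k D, ∑ _x ∈ D \ Q, α Q =
      ∑ R ∈ powersetCard (k + 1) D, ∑ x ∈ R, α (R.erase x) := by
  rw [sum_sigma', sum_sigma']
  refine sum_bij' (fun p _ => ⟨insert p.2 p.1, p.2⟩) (fun p _ => ⟨p.1.erase p.2, p.2⟩)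
    ?_ ?_ ?_ ?_ ?_ <;> rintro ⟨Q, x⟩ hQx <;>
    simp only [mem_sigma, mem_powersetCard, mem_sdiff] at hQx ⊢
  · exact ⟨⟨insert_subset hQx.2.1 hQx.1.1, by rw [card_insert_of_notMem hQx.2.2, hQx.1.2]⟩,
      mem_insert_self x Q⟩
  · exact ⟨⟨(erase_subset x Q).trans hQx.1.1, by rw [card_erase_of_mem hQx.2, hQx.1.2]; rfl⟩,
      hQx.1.1 hQx.2, notMem_erase x Q⟩
  · rw [erase_insert hQx.2.2]
  · rw [insert_erase hQx.2]
  · rw [erase_insert hQx.2.2]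

lemma sum_sum_powerset_erase (β : Finset ι → Y) (R : Finset ι) :
    ∑ x ∈ R, ∑ S ∈ (R.erase x).powerset, β S = ∑ S ∈ R.powerset, ((#R : ℤ) - #S) • β S := by
  have hcount : ∀ S ∈ R.powerset, ((#R : ℤ) - #S) • β S = ∑ _x ∈ R \ S, β S := by
    intro S hS
    have hSR := mem_powerset.1 hS
    rw [sum_const, card_sdiff_of_subset hSR, ← natCast_zsmul, Nat.cast_sub (card_le_card hSR)]
  rw [sum_congr rfl hcount]
  refine sum_comm' fun x S => ?_
  simp only [mem_powerset, mem_sdiff, subset_erase]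
  tauto

lemma card_sub_smul_sum_powersetCard {α : Type*} (β : Finset α → Y) (D : Finset α) (k : ℕ) :
    ((#D : ℤ) - k) • ∑ R ∈ powersetCard k D, ∑ S ∈ R.powerset, β S =
      ∑ R ∈ powersetCard (k + 1) D, ∑ S ∈ R.powerset, ((k : ℤ) + 1 - #S) • β S := by
  classical
  have hcount : ∀ Q ∈ powersetCard k D, ((#D : ℤ) - k) • ∑ S ∈ Q.powerset, β S =
      ∑ _x ∈ D \ Q, ∑ S ∈ Q.powerset, β S := by
    intro Q hQ
    obtain ⟨hQD, hQk⟩ := mem_powersetCard.1 hQ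
    rw [sum_const, card_sdiff_of_subset hQD, ← natCast_zsmul, Nat.cast_sub (card_le_card hQD), hQk]
  rw [smul_sum, sum_congr rfl hcount,
    sum_powersetCard_sdiff fun Q => ∑ S ∈ Q.powerset, β S]
  refine sum_congr rfl fun R hR => ?_
  rw [sum_sum_powerset_erase, (mem_powersetCard.1 hR).2, Nat.cast_succ]

namespace IntervalPositive

lemma sum_powersetCard_sub_mem_of_le_card (h : IntervalPositive P β D m) (hT : #T + 1 ≤ m)
    (hD : T ∪ X ⊆ D) {a b : ℕ} (hab : a ≤ b) (hΩ : a + b ≤ #Ω) :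
    ∑ R ∈ powersetCard b Ω, ∑ S ∈ Icc T (T ∪ R ∩ X), β S -
      ∑ R ∈ powersetCard a Ω, ∑ S ∈ Icc T (T ∪ R ∩ X), β S ∈ P := by
  obtain ⟨ψ, hψ, hψΩ⟩ := exists_injective_powersetCard_superset Ω hab hΩ
  have himage : univ.image ψ ⊆ powersetCard b Ω := by
    intro Q hQ
    obtain ⟨R, -, rfl⟩ := mem_image.1 hQ
    exact (hψΩ R).1
  have hsub : ∀ R : Finset ι, T ∪ R ∩ X ⊆ D := fun R =>
    (union_subset_union_right inter_subset_right).trans hD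
  rw [← sum_sdiff himage, sum_image hψ.injOn, ← sum_coe_sort (powersetCard a Ω), add_sub_assoc,
    ← sum_sub_distrib]
  refine add_mem (sum_mem fun R _ => h T _ subset_union_left (hsub R) (by lia))
    (sum_mem fun R _ => ?_)
  exact h.sum_Icc_sub_mem subset_union_left
    (union_subset_union_right (inter_subset_inter_right (hψΩ R).2)) (hsub _) hT

lemma sum_powersetCard_sub_mem (h : IntervalPositive P β D m) (hq : q + 1 ≤ m)
    (hTX : Disjoint T X) (hD : T ∪ X ⊆ D) (hX : X ⊆ Ω) {a b e : ℕ} (hT : #T + e = q) (hea : e ≤ a)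
    (hab : a ≤ b) (hΩ : a + b ≤ #Ω + e) :
    ∑ R ∈ powersetCard b Ω, ∑ S ∈ Icc T (T ∪ R ∩ X) with q ≤ #S, β S -
      ∑ R ∈ powersetCard a Ω, ∑ S ∈ Icc T (T ∪ R ∩ X) with q ≤ #S, β S ∈ P := by
  induction X using Finset.strongInduction generalizing T Ω a b e with
  | H X ih =>
  rcases e with _ | e
  · have htrunc : ∀ R, ∑ S ∈ Icc T (T ∪ R ∩ X) with q ≤ #S, β S =
        ∑ S ∈ Icc T (T ∪ R ∩ X), β S := fun R => by
      rw [filter_true_of_mem fun S hS => hT.ge.trans (card_le_card (mem_Icc.1 hS).1)]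
    simp only [htrunc]
    exact h.sum_powersetCard_sub_mem_of_le_card (by lia) hD hab hΩ
  rcases X.eq_empty_or_nonempty with rfl | hne
  · have htrunc : ∀ R : Finset ι, ∑ S ∈ Icc T (T ∪ R ∩ ∅) with q ≤ #S, β S = 0 := fun R => by
      rw [inter_empty, union_empty, Icc_self, sum_filter, sum_singleton, if_neg (by lia)]
    simp only [htrunc, sum_const_zero, sub_zero, zero_mem]
  obtain ⟨X, x, hx, rfl⟩ := hne.exists_cons_eq
  rw [cons_eq_insert] at *
  obtain ⟨hxT, hTX⟩ := disjoint_insert_right.1 hTX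
  obtain ⟨hxΩ, hX⟩ := insert_subset_iff.1 hX
  obtain ⟨a, rfl⟩ := Nat.exists_eq_add_one.2 (e.succ_pos.trans_le hea)
  obtain ⟨b, rfl⟩ := Nat.exists_eq_add_one.2 (e.succ_pos.trans_le (hea.trans hab))
  simp only [sum_filter, sum_powersetCard_inter_insert _ hxΩ hx hxT]
  rw [add_sub_add_comm]
  simp only [← sum_filter]
  refine add_mem (ih X (ssubset_insert hx) hTX
      ((union_subset_union_right (subset_insert x X)).trans hD) hX hT hea hab hΩ)
    (ih X (ssubset_insert hx) (disjoint_insert_left.2 ⟨hx, hTX⟩) ?_ (subset_erase.2 ⟨hX, hx⟩)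
      ?_ (Nat.le_of_succ_le_succ hea) (Nat.le_of_succ_le_succ hab) ?_)
  · rwa [insert_union, ← union_insert]
  · rw [card_insert_of_notMem hxT, add_right_comm]
    exact hT
  · have hΩcard := card_erase_add_one hxΩ
    lia

lemma sum_sub_sum_mem (h : IntervalPositive P β D m) {e a b : ℕ}
    (hβ : ∀ S ⊆ D, #S < e → β S = 0) (hm : e + 1 ≤ m) (ha : e ≤ a) (hab : a ≤ b)
    (hD : a + b ≤ #D + e) :
    ∑ R ∈ powersetCard b D, ∑ S ∈ R.powerset, β S -
      ∑ R ∈ powersetCard a D, ∑ S ∈ R.powerset, β S ∈ P := by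
  have htrunc : ∀ c, ∑ R ∈ powersetCard c D, ∑ S ∈ Icc ∅ (∅ ∪ R ∩ D) with e ≤ #S, β S =
      ∑ R ∈ powersetCard c D, ∑ S ∈ R.powerset, β S := by
    intro c
    refine sum_congr rfl fun R hR => ?_
    have hRD := (mem_powersetCard.1 hR).1
    rw [empty_union, inter_eq_left.2 hRD, ← bot_eq_empty, Icc_bot, Iic_eq_powerset]
    refine sum_filter_of_ne fun S hS hne => ?_
    by_contra hlt
    exact hne (hβ S ((mem_powerset.1 hS).trans hRD) (not_le.1 hlt))
  rw [← htrunc, ← htrunc]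
  exact h.sum_powersetCard_sub_mem hm (disjoint_empty_left D) (by rw [empty_union]) subset_rfl
    (by rw [card_empty, zero_add]) ha hab hD

lemma smul_sum_sub_smul_sum_mem (h : IntervalPositive P β D m) {e k : ℕ}
    (hβ : ∀ S ⊆ D, #S < e → β S = 0) (hm : e + 1 ≤ m) :
    ((k : ℤ) + 1 - e) • ∑ R ∈ powersetCard (k + 1) D, ∑ S ∈ R.powerset, β S -
      ((#D : ℤ) - k) • ∑ R ∈ powersetCard k D, ∑ S ∈ R.powerset, β S ∈ P := by
  rw [card_sub_smul_sum_powersetCard, smul_sum, ← sum_sub_distrib]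
  refine sum_mem fun R hR => ?_
  have hRD := (mem_powersetCard.1 hR).1
  have hmem := h.sum_choose_mem hm (i := 1) (empty_subset R) hRD (by rw [card_empty]; lia)
  rw [← bot_eq_empty, Icc_bot, Iic_eq_powerset, sum_filter] at hmem
  rw [smul_sum, ← sum_sub_distrib]
  convert hmem using 1
  refine sum_congr rfl fun S hS => ?_
  rw [← sub_smul, sub_sub_sub_cancel_left, Nat.choose_one_right, ← natCast_zsmul]
  split_ifs with heS
  · congr 1
    lia
  rcases Nat.lt_or_ge #S e with hlt | hge
  · rw [hβ S ((mem_powerset.1 hS).trans hRD) hlt, smul_zero]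
  · rw [show #S = e by lia, sub_self, zero_smul]

end IntervalPositive

end BooleanIntervals

/-! ### Flag counts and their alternating sums -/

/-- The additive submonoid of effective characters, so that sums of effective characters can be
handled by the general theory of submonoids. -/
def effectiveCharacters (H : Type*) [Group H] : AddSubmonoid (H → ℂ) where
  carrier := {φ | IsEffectiveCharacter φ}
  add_mem' := IsEffectiveCharacter.add
  zero_mem' := IsEffectiveCharacter.zero

section AlternatingSum

open Finset

variable {ι Y : Type*} [DecidableEq ι] [AddCommGroup Y]

/-- The alternating sum of `α` over the interval `[B, N]`, in which `α N` has coefficient `1`. For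
`B = ∅` this is the Möbius inverse of summation over subsets. -/
def alternatingSum (α : Finset ι → Y) (B N : Finset ι) : Y :=
  ∑ A ∈ Icc B N, (-1 : ℤ) ^ (#N - #A) • α A

lemma alternatingSum_insert (α : Finset ι → Y) (B : Finset ι) {N : Finset ι} {x : ι}
    (hx : x ∈ N) :
    alternatingSum α (insert x B) N = alternatingSum α B N + alternatingSum α B (N.erase x) := by
  have hneg : ∑ A ∈ Icc B (N.erase x), (-1 : ℤ) ^ (#N - #A) • α A =
      -alternatingSum α B (N.erase x) := by
    rw [alternatingSum, ← sum_neg_distrib]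
    refine sum_congr rfl fun A hA => ?_
    have hle := card_le_card (mem_Icc.1 hA).2
    rw [← card_erase_add_one hx, Nat.sub_add_comm hle, pow_succ', neg_one_mul, neg_smul]
  rw [alternatingSum, alternatingSum, sum_Icc_eq_erase_add_insert _ B N x, hneg, neg_add_eq_sub,
    sub_add_cancel]

lemma sum_alternatingSum_empty (α : Finset ι → Y) {T N : Finset ι} (hTN : T ⊆ N) :
    ∑ S ∈ Icc T N, alternatingSum α ∅ S = alternatingSum α (N \ T) N := by
  induction hn : #(N \ T) generalizing T N with
  | zero =>
    obtain rfl := hTN.antisymm (sdiff_eq_empty_iff_subset.1 (card_eq_zero.1 hn))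
    rw [Icc_self, sum_singleton, sdiff_self, bot_eq_empty]
  | succ n ih =>
    obtain ⟨x, hx⟩ := card_pos.1 (hn.ge.trans_lt' n.succ_pos)
    obtain ⟨hxN, hxT⟩ := mem_sdiff.1 hx
    have hcard : #((N \ T).erase x) = n := by rw [card_erase_of_mem hx, hn, Nat.add_sub_cancel]
    rw [sum_Icc_eq_erase_add_insert _ T N x, ih (subset_erase.2 ⟨hTN, hxT⟩)
      (by rwa [erase_sdiff_comm]), ih (insert_subset hxN hTN) (by rwa [sdiff_insert]),
      erase_sdiff_comm, sdiff_insert, add_comm, ← alternatingSum_insert α _ hxN, insert_erase hx]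

end AlternatingSum

namespace MixedGraph

open Finset RelComplex IdealChains
open scoped Pointwise

variable {V : Type*} [Fintype V] [DecidableEq V] {G : MixedGraph V}
  {H : Type*} [Group H] [MulAction H V]

lemma smul_mem_orderComplex (hH : G.IsActedOnBy H) (g : H) {τ : Finset (Finset V)}
    (hτ : τ ∈ G.orderComplex) : g • τ ∈ G.orderComplex := by
  refine ⟨fun I hI => ?_, fun I hI J hJ _ => ?_⟩
  · obtain ⟨J, hJ, rfl⟩ := mem_smul_finset.1 hI
    obtain ⟨hideal, hempty, huniv⟩ := hτ.1 J hJ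
    refine ⟨fun u v huv hv => ?_, by rwa [Ne, smul_finset_eq_empty],
      by rwa [Ne, smul_finset_eq_univ]⟩
    rw [← inv_smul_mem_iff] at hv ⊢
    exact hideal _ _ (huv.lift (g⁻¹ • ·) fun a b hab => (hH g⁻¹ a b).2.2 hab) hv
  · obtain ⟨I', hI', rfl⟩ := mem_smul_finset.1 (mem_coe.1 hI)
    obtain ⟨J', hJ', rfl⟩ := mem_smul_finset.1 (mem_coe.1 hJ)
    exact (hτ.2.total hI' hJ').imp smul_finset_subset_smul_finset smul_finset_subset_smul_finset

lemma smul_mem_coloringComplex (hH : G.IsActedOnBy H) (g : H) {τ : Finset (Finset V)}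
    (hτ : τ ∈ G.coloringComplex) : g • τ ∈ G.coloringComplex := by
  refine mem_coloringComplex_of_forall_exists_separating (smul_mem_orderComplex hH g hτ.1)
    fun u v huv => ?_
  obtain ⟨I, hI, hsep⟩ := exists_separating_of_mem_coloringComplex hτ ((hH g⁻¹ u v).1.2 huv)
  exact ⟨g • I, smul_mem_smul_finset hI, by simpa only [inv_smul_mem_iff] using hsep⟩

lemma smul_mem_coloringComplex_iff (hH : G.IsActedOnBy H) (g : H) {τ : Finset (Finset V)} :
    g • τ ∈ G.coloringComplex ↔ τ ∈ G.coloringComplex := by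
  refine ⟨fun hτ => ?_, smul_mem_coloringComplex hH g⟩
  rw [← inv_smul_smul g τ]
  exact smul_mem_coloringComplex hH g⁻¹ hτ

lemma image_card_smul {W : Type*} [DecidableEq W] [MulAction H W] (g : H) (τ : Finset (Finset W)) :
    (g • τ).image card = τ.image card := by
  rw [← image_smul, image_image]
  exact image_congr fun I _ => card_smul_finset g I

open Classical in
/-- The flag `f`-vector of the coloring complex as a family of class functions: the number of
faces with rank set `S` fixed by `g`. -/
noncomputable def flagCount (G : MixedGraph V) (S : Finset ℕ) (g : H) : ℂ :=
  (#{τ : Finset (Finset V) | τ ∈ G.coloringComplex ∧ τ.image card = S ∧ g • τ = τ} : ℂ)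

/-- The flag `h`-vector of the coloring complex; its entry at `S` turns out to be the coefficient
of the fundamental quasisymmetric function `F_S` in the chromatic quasisymmetric function. -/
noncomputable def flagCoeff (G : MixedGraph V) (S : Finset ℕ) : H → ℂ :=
  alternatingSum G.flagCount ∅ S

lemma sum_flagCoeff (R : Finset ℕ) :
    ∑ S ∈ R.powerset, G.flagCoeff (H := H) S = G.flagCount R := by
  rw [← Iic_eq_powerset, ← Icc_bot, bot_eq_empty]
  simp only [flagCoeff]
  rw [sum_alternatingSum_empty _ (empty_subset R), sdiff_empty, alternatingSum, Icc_self,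
    sum_singleton, Nat.sub_self, pow_zero, one_smul]

open Classical in
lemma alternatingSum_flagCount (B N : Finset ℕ) (g : H) :
    alternatingSum G.flagCount B N g =
      ∑ τ : Finset (Finset V) with τ ∈ G.rankInterval B N ∧ g • τ = τ, (-1 : ℂ) ^ (#N - #τ) := by
  have hfiber : ∀ A ∈ Icc B N, #{τ | τ ∈ G.coloringComplex ∧ τ.image card = A ∧ g • τ = τ} =
      #{τ ∈ {τ | τ ∈ G.rankInterval B N ∧ g • τ = τ} | τ.image card = A} := by
    intro A hA
    rw [filter_filter]
    refine congrArg card (filter_congr fun τ _ => ⟨?_, ?_⟩)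
    · rintro ⟨hτ, rfl, hg⟩
      exact ⟨⟨⟨hτ, mem_Icc.1 hA⟩, hg⟩, rfl⟩
    · rintro ⟨⟨⟨hτ, -⟩, hg⟩, hτA⟩
      exact ⟨hτ, hτA, hg⟩
  calc alternatingSum G.flagCount B N g
      = ∑ A ∈ Icc B N, ∑ τ ∈ {τ | τ ∈ G.rankInterval B N ∧ g • τ = τ} with τ.image card = A,
          (-1 : ℂ) ^ (#N - #A) := by
        rw [alternatingSum, Finset.sum_apply]
        refine sum_congr rfl fun A hA => ?_
        rw [sum_const, ← hfiber A hA, Pi.smul_apply, flagCount, zsmul_eq_mul, nsmul_eq_mul,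
          mul_comm]
        norm_cast
    _ = ∑ τ with τ ∈ G.rankInterval B N ∧ g • τ = τ, (-1 : ℂ) ^ (#N - #(τ.image card)) :=
        sum_fiberwise_of_maps_to' (fun τ hτ => mem_Icc.2 (mem_filter.1 hτ).2.1.2)
          fun A => (-1 : ℂ) ^ (#N - #A)
    _ = _ := sum_congr rfl fun τ hτ => by
        rw [(isFlag_of_mem_orderComplex (mem_filter.1 hτ).2.1.1.1).card_image_card]

open Classical in
lemma sum_card_rankInterval (B N : Finset ℕ) (g : H) :
    ∑ j ∈ range (#N + 1), (-1 : ℂ) ^ (#N - j) *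
        (#{τ : Finset (Finset V) | τ ∈ G.rankInterval B N ∧ #τ = j ∧ g • τ = τ} : ℂ) =
      ∑ τ : Finset (Finset V) with τ ∈ G.rankInterval B N ∧ g • τ = τ, (-1 : ℂ) ^ (#N - #τ) := by
  have hmaps : ∀ τ ∈ ({τ | τ ∈ G.rankInterval B N ∧ g • τ = τ} : Finset (Finset (Finset V))),
      #τ ∈ range (#N + 1) := by
    intro τ hτ
    obtain ⟨hτ, -, hN⟩ := (mem_filter.1 hτ).2.1
    rw [mem_range_succ_iff, ← (isFlag_of_mem_orderComplex hτ.1).card_image_card]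
    exact card_le_card hN
  rw [← sum_fiberwise_of_maps_to' hmaps fun j => (-1 : ℂ) ^ (#N - j)]
  refine sum_congr rfl fun j _ => ?_
  rw [sum_const, filter_filter, nsmul_eq_mul, mul_comm]
  simp only [and_assoc, and_comm (a := #_ = j)]

lemma intervalPositive_flagCoeff (hG : G.IsAcyclic) (hH : G.IsActedOnBy H) :
    IntervalPositive (effectiveCharacters H) G.flagCoeff (Icc 1 (Fintype.card V - 1))
      G.minUndirected := by
  classical
  intro T Q hTQ hQ hT
  have hcard := card_sdiff_add_card_eq_card hTQ
  have heff := isEffectiveCharacter_alternating (H := H)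
    (isColoredComplex_rankInterval G (Q \ T) Q) (fun g I => card_smul_finset g I)
    (fun g τ => by
      simp only [rankInterval, Set.mem_ofPred_eq, smul_mem_coloringComplex_iff hH,
        image_card_smul])
    fun j (hj : j < #Q) => vanishes_rankInterval hG sdiff_subset hQ hj (by lia)
  simp only [flagCoeff]
  rw [sum_alternatingSum_empty _ hTQ]
  change IsEffectiveCharacter _
  convert heff using 1
  ext g
  rw [alternatingSum_flagCount, sum_card_rankInterval]

end MixedGraph

/-! ### Colorings and flags -/

namespace MixedGraph

open Finset
open scoped Pointwise

section Blocks

variable {V : Type*} [DecidableEq V] {τ : Finset (Finset V)}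

/-- The index of the block of the ordered partition `I₁, I₂ \ I₁, …, V \ I_k` defined by the
chain `τ = {I₁ ⊂ ⋯ ⊂ I_k}` that contains `v`; the blocks are numbered from `0` to `k`. -/
def block (τ : Finset (Finset V)) (v : V) : ℕ := #{I ∈ τ | v ∉ I}

lemma block_le (τ : Finset (Finset V)) (v : V) : block τ v ≤ #τ := card_filter_le _ _

lemma mem_iff_block_le (hτ : IsChain (· ⊆ ·) (τ : Set (Finset V))) {I : Finset V} (hI : I ∈ τ)
    (v : V) : v ∈ I ↔ block τ v ≤ #{J ∈ τ | J ⊂ I} := by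
  refine ⟨fun hv => card_le_card fun J hJ => ?_, fun hle => by_contra fun hv => ?_⟩
  · obtain ⟨hJ, hvJ⟩ := mem_filter.1 hJ
    have hJI := (hτ.total hJ hI).resolve_right fun hIJ => hvJ (hIJ hv)
    exact mem_filter.2 ⟨hJ, hJI.ssubset_of_ne fun h => hvJ (h ▸ hv)⟩
  · refine absurd (card_lt_card ?_) hle.not_gt
    refine (ssubset_iff_of_subset fun J hJ => ?_).2 ⟨I, mem_filter.2 ⟨hI, hv⟩, by simp⟩
    exact mem_filter.2 ⟨(mem_filter.1 hJ).1, fun hvJ => hv ((mem_filter.1 hJ).2.subset hvJ)⟩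

lemma block_lt_block_iff (hτ : IsChain (· ⊆ ·) (τ : Set (Finset V))) {u v : V} :
    block τ u < block τ v ↔ ∃ I ∈ τ, u ∈ I ∧ v ∉ I := by
  constructor
  · intro hlt
    by_contra! hsep
    exact hlt.not_ge (card_le_card (monotone_filter_right _ fun I hI hv hu => hv (hsep I hI hu)))
  · rintro ⟨I, hI, hu, hv⟩
    rw [← not_le]
    exact fun hle => hv ((mem_iff_block_le hτ hI v).2 (hle.trans ((mem_iff_block_le hτ hI u).1 hu)))

lemma image_card_ssubset (hτ : IsChain (· ⊆ ·) (τ : Set (Finset V))) :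
    τ.image (fun I => #{J ∈ τ | J ⊂ I}) = range #τ := by
  have hlt : ∀ I ∈ τ, ∀ J, I ⊂ J → #{L ∈ τ | L ⊂ I} < #{L ∈ τ | L ⊂ J} := by
    intro I hI J hIJ
    refine card_lt_card ((ssubset_iff_of_subset fun L hL => ?_).2
      ⟨I, mem_filter.2 ⟨hI, hIJ⟩, by simp⟩)
    exact mem_filter.2 ⟨(mem_filter.1 hL).1, (mem_filter.1 hL).2.trans hIJ⟩
  refine eq_of_subset_of_card_le (image_subset_iff.2 fun I hI => mem_range.2 ?_) ?_
  · exact card_lt_card ((ssubset_iff_of_subset (filter_subset _ _)).2 ⟨I, hI, by simp⟩)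
  · rw [card_range, card_image_of_injOn]
    intro I hI J hJ heq
    by_contra hne
    rcases hτ.total hI hJ with hIJ | hJI
    · exact (hlt I hI J (hIJ.ssubset_of_ne hne)).ne heq
    · exact (hlt J hJ I (hJI.ssubset_of_ne (Ne.symm hne))).ne' heq

lemma block_smul {H : Type*} [Group H] [MulAction H V] (g : H) (τ : Finset (Finset V)) (v : V) :
    block (g • τ) v = block τ (g⁻¹ • v) := by
  refine card_nbij' (g⁻¹ • ·) (g • ·) (fun I hI => ?_) (fun I hI => ?_)
    (fun I _ => smul_inv_smul g I) (fun I _ => inv_smul_smul g I)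
  · obtain ⟨hI, hv⟩ := mem_filter.1 hI
    exact mem_filter.2 ⟨inv_smul_mem_iff.2 hI, by rwa [smul_mem_smul_finset_iff]⟩
  · obtain ⟨hI, hv⟩ := mem_filter.1 hI
    exact mem_filter.2 ⟨smul_mem_smul_finset_iff g |>.2 hI, by rwa [← inv_smul_mem_iff]⟩

variable [Fintype V]

lemma IsFlag.card_block_le (hτ : IsFlag τ) {I : Finset V} (hI : I ∈ τ) :
    #{v | block τ v < #{J ∈ τ | J ⊂ I} + 1} = #I := by
  simp only [Nat.lt_succ_iff, ← mem_iff_block_le hτ.isChain hI, filter_univ_mem]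

lemma IsFlag.image_card_block_lt (hτ : IsFlag τ) :
    (range (#τ + 2)).image (fun j => #{v | block τ v < j}) =
      insert 0 (insert (Fintype.card V) (τ.image card)) := by
  have hrange : range (#τ + 2) =
      insert 0 (insert (#τ + 1) (τ.image fun I => #{J ∈ τ | J ⊂ I} + 1)) := by
    have hsucc : τ.image (fun I => #{J ∈ τ | J ⊂ I} + 1) = (range #τ).image (· + 1) := by
      rw [← image_card_ssubset hτ.isChain, image_image]
      rfl
    rw [hsucc, insert_comm, range_add_one, range_add_one', map_eq_image]
    rfl
  have htop : #{v | block τ v < #τ + 1} = Fintype.card V := by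
    rw [filter_true_of_mem fun v _ => Nat.lt_succ_of_le (block_le τ v), card_univ]
  rw [hrange, image_insert, image_insert, image_image, htop]
  congr 1
  · simp
  · exact congrArg _ (image_congr fun I hI => hτ.card_block_le hI)

variable [Nonempty V]

lemma IsFlag.strictMonoOn_card_block_lt (hτ : IsFlag τ) :
    StrictMonoOn (fun j => #{v | block τ v < j}) (Set.Iio (#τ + 2)) := by
  have hinj : Set.InjOn (fun j => #{v | block τ v < j}) (Set.Iio (#τ + 2)) := by
    rw [← coe_range, ← card_image_iff, hτ.image_card_block_lt, hτ.card_insert_image_card,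
      card_range]
  refine MonotoneOn.strictMonoOn_of_injOn (fun i _ j _ hij => card_le_card ?_) hinj
  exact monotone_filter_right _ fun v _ hv => hv.trans_le hij

lemma IsFlag.exists_block_eq (hτ : IsFlag τ) {j : ℕ} (hj : j ≤ #τ) : ∃ v, block τ v = j := by
  have hlt := hτ.strictMonoOn_card_block_lt (show j < #τ + 2 by omega)
    (show j + 1 < #τ + 2 by omega) j.lt_succ_self
  obtain ⟨v, hv, hvj⟩ := exists_mem_notMem_of_card_lt_card hlt
  rw [mem_filter_univ] at hv hvj
  exact ⟨v, by omega⟩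

lemma IsFlag.cut_image_card (hτ : IsFlag τ) {j : ℕ} (hj : j < #τ + 2) :
    QSymFun.cut (Fintype.card V) (τ.image card) j = #{v | block τ v < j} := by
  have hfin : (Set.ofPred fun k => k ∈ insert 0 (insert (Fintype.card V) (τ.image card))).Finite :=
    finite_toSet _
  have htoFinset : hfin.toFinset = insert 0 (insert (Fintype.card V) (τ.image card)) :=
    finite_toSet_toFinset _
  have hcard : #hfin.toFinset = #τ + 2 := by rw [htoFinset, hτ.card_insert_image_card]
  have hmem : ∀ i : Fin #hfin.toFinset, #{v | block τ v < i} ∈ hfin.toFinset := fun i => by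
    refine htoFinset.ge (hτ.image_card_block_lt.subset ?_)
    exact mem_image_of_mem (fun j => #{v | block τ v < j}) (mem_range.2 (hcard ▸ i.2))
  have hmono : StrictMono fun i : Fin #hfin.toFinset => #{v | block τ v < i} := fun i i' hii' =>
    hτ.strictMonoOn_card_block_lt (hcard ▸ i.2) (hcard ▸ i'.2) hii'
  rw [QSymFun.cut, Nat.nth_eq_orderEmbOfFin hfin (hcard ▸ hj)]
  exact (congrFun (orderEmbOfFin_unique rfl hmem hmono) ⟨j, hcard ▸ hj⟩).symm

end Blocks

section BlockIdx

variable {V : Type*} [DecidableEq V] {τ : Finset (Finset V)}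

/-- The block index as a function to `Fin (k + 1)`, with `k` written as the number of ranks of `τ`
because this is the form in which it occurs in the definition of `QSymFun.monomialQ`. -/
def blockIdx (τ : Finset (Finset V)) (v : V) : Fin (#(τ.image card) + 1) :=
  Fin.ofNat _ (block τ v)

variable [Fintype V]

lemma IsFlag.val_blockIdx (hτ : IsFlag τ) (v : V) : (blockIdx τ v : ℕ) = block τ v := by
  have hle := block_le τ v
  rw [← hτ.card_image_card] at hle
  exact Nat.mod_eq_of_lt (by omega)

variable [Nonempty V]

lemma IsFlag.blockIdx_surjective (hτ : IsFlag τ) : Function.Surjective (blockIdx τ) := by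
  intro j
  obtain ⟨v, hv⟩ := hτ.exists_block_eq (j := j) (hτ.card_image_card ▸ Nat.le_of_lt_succ j.2)
  exact ⟨v, Fin.ext (by rw [hτ.val_blockIdx, hv])⟩

lemma IsFlag.card_blockIdx_eq (hτ : IsFlag τ) (j : Fin (#(τ.image card) + 1)) :
    #{v | blockIdx τ v = j} = QSymFun.cut (Fintype.card V) (τ.image card) (j + 1) -
      QSymFun.cut (Fintype.card V) (τ.image card) j := by
  have hj := j.2
  have hcard := hτ.card_image_card
  have hsub : ({v | block τ v < j} : Finset V) ⊆ ({v | block τ v < j + 1} : Finset V) :=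
    fun v hv => mem_filter.2 ⟨mem_univ v, (mem_filter.1 hv).2.trans j.1.lt_succ_self⟩
  rw [hτ.cut_image_card (by omega), hτ.cut_image_card (by omega), ← card_sdiff_of_subset hsub]
  congr 1
  ext v
  simp only [mem_sdiff, mem_filter_univ, Fin.ext_iff, hτ.val_blockIdx]
  omega

lemma IsFlag.sum_single_blockIdx (hτ : IsFlag τ) (i : Fin (#(τ.image card) + 1) → ℕ) :
    ∑ v, Finsupp.single (i (blockIdx τ v)) 1 = ∑ j : Fin (#(τ.image card) + 1),
      Finsupp.single (i j) (QSymFun.cut (Fintype.card V) (τ.image card) (j + 1) -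
        QSymFun.cut (Fintype.card V) (τ.image card) j) := by
  rw [← sum_fiberwise_of_maps_to' (fun _ _ => mem_univ _) fun j => Finsupp.single (i j) 1]
  refine sum_congr rfl fun j _ => ?_
  rw [sum_const, hτ.card_blockIdx_eq, Finsupp.smul_single, smul_eq_mul, mul_one]

end BlockIdx

section LevelChain

variable {V α : Type*} [Fintype V] [DecidableEq V] [LinearOrder α] {τ : Finset (Finset V)}

/-- The chain of the proper subsets of the form `{v | f v ≤ f u}`, which records the ordered
partition of `V` into the fibers of `f`. -/
def levelChain (f : V → α) : Finset (Finset V) :=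
  (univ.image fun u => ({v | f v ≤ f u} : Finset V)).erase univ

lemma mem_levelChain {f : V → α} {I : Finset V} :
    I ∈ levelChain f ↔ I ≠ univ ∧ ∃ u, ({v | f v ≤ f u} : Finset V) = I := by
  simp [levelChain]

lemma isFlag_levelChain (f : V → α) : IsFlag (levelChain f) where
  isChain := by
    intro I hI J hJ _
    obtain ⟨-, u, rfl⟩ := mem_levelChain.1 (mem_coe.1 hI)
    obtain ⟨-, v, rfl⟩ := mem_levelChain.1 (mem_coe.1 hJ)
    exact (le_total (f u) (f v)).imp (fun h => monotone_filter_right _ fun _ _ hw => hw.trans h)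
      fun h => monotone_filter_right _ fun _ _ hw => hw.trans h
  ne_empty I hI := by
    obtain ⟨-, u, rfl⟩ := mem_levelChain.1 hI
    exact ne_empty_of_mem (mem_filter.2 ⟨mem_univ u, le_rfl⟩)
  ne_univ I hI := (mem_levelChain.1 hI).1

lemma exists_mem_levelChain {f : V → α} {u v : V} :
    (∃ I ∈ levelChain f, u ∈ I ∧ v ∉ I) ↔ f u < f v := by
  constructor
  · rintro ⟨I, hI, hu, hv⟩
    obtain ⟨-, w, rfl⟩ := mem_levelChain.1 hI
    rw [mem_filter_univ] at hu hv
    exact hu.trans_lt (not_le.1 hv)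
  · intro huv
    have hv : v ∉ ({w | f w ≤ f u} : Finset V) := by rwa [mem_filter_univ, not_le]
    exact ⟨_, mem_levelChain.2 ⟨ne_of_mem_of_not_mem' (mem_univ v) hv |>.symm, u, rfl⟩, by simp, hv⟩

lemma levelChain_comp {β : Type*} [LinearOrder β] {i : α → β} (hi : StrictMono i) (f : V → α) :
    levelChain (fun v => i (f v)) = levelChain f := by
  simp only [levelChain, hi.le_iff_le]

lemma block_levelChain_lt_iff {f : V → α} {u v : V} :
    block (levelChain f) u < block (levelChain f) v ↔ f u < f v := by
  rw [block_lt_block_iff (isFlag_levelChain f).isChain, exists_mem_levelChain]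

lemma block_levelChain_eq_iff {f : V → α} {u v : V} :
    block (levelChain f) u = block (levelChain f) v ↔ f u = f v := by
  simp only [eq_iff_le_not_lt, ← not_lt, block_levelChain_lt_iff]

lemma forall_inv_smul_eq_iff {H : Type*} [Group H] [MulAction H V] (g : H) (f : V → α) :
    (∀ v, f (g⁻¹ • v) = f v) ↔ g • levelChain f = levelChain f := by
  constructor
  · intro hf
    refine (image_congr fun I hI => ?_).trans image_id
    obtain ⟨-, u, rfl⟩ := mem_levelChain.1 (mem_coe.1 hI)
    ext v
    rw [id, ← inv_smul_mem_iff, mem_filter_univ, mem_filter_univ, hf]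
  · intro hg v
    rw [← block_levelChain_eq_iff, ← block_smul, hg]

variable [Nonempty V]

lemma IsFlag.levelChain_block (hτ : IsFlag τ) : levelChain (block τ) = τ := by
  have hlevel : ∀ I ∈ τ, ∀ u, block τ u = #{J ∈ τ | J ⊂ I} →
      ({v | block τ v ≤ block τ u} : Finset V) = I := by
    intro I hI u hu
    ext v
    rw [mem_filter_univ, hu, mem_iff_block_le hτ.isChain hI]
  ext I
  rw [mem_levelChain]
  constructor
  · rintro ⟨hne, u, rfl⟩
    obtain ⟨w, hw⟩ : ∃ w, block τ u < block τ w := by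
      by_contra! hle
      exact hne (filter_true_of_mem fun v _ => hle v)
    have hpos : block τ u ∈ range #τ := mem_range.2 (hw.trans_le (block_le τ w))
    rw [← image_card_ssubset hτ.isChain] at hpos
    obtain ⟨I, hI, hIu⟩ := mem_image.1 hpos
    exact (hlevel I hI u hIu.symm).symm ▸ hI
  · intro hI
    obtain ⟨u, hu⟩ := hτ.exists_block_eq (card_filter_le τ (· ⊂ I))
    exact ⟨hτ.ne_univ I hI, u, hlevel I hI u hu⟩

lemma IsFlag.levelChain_comp_blockIdx (hτ : IsFlag τ) {i : Fin (#(τ.image card) + 1) → α}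
    (hi : StrictMono i) : levelChain (fun v => i (blockIdx τ v)) = τ := by
  rw [levelChain_comp hi, ← levelChain_comp Fin.val_strictMono]
  simp only [hτ.val_blockIdx]
  exact hτ.levelChain_block

lemma exists_strictMono_comp_blockIdx (f : V → α) :
    ∃ i : Fin (#((levelChain f).image card) + 1) → α, StrictMono i ∧
      (fun v => i (blockIdx (levelChain f) v)) = f := by
  have hflag := isFlag_levelChain f
  choose s hs using hflag.blockIdx_surjective
  refine ⟨fun j => f (s j), fun j j' hj => ?_, funext fun v => ?_⟩
  · rwa [← block_levelChain_lt_iff, ← hflag.val_blockIdx, ← hflag.val_blockIdx, hs, hs]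
  · rw [← block_levelChain_eq_iff, ← hflag.val_blockIdx, ← hflag.val_blockIdx, hs]

lemma IsFlag.card_levelChain_eq (hτ : IsFlag τ) (Q : (V → α) → Prop) :
    Nat.card {f : V → α // levelChain f = τ ∧ Q f} =
      Nat.card {i : Fin (#(τ.image card) + 1) → α // StrictMono i ∧
        Q fun v => i (blockIdx τ v)} := by
  refine (Nat.card_congr (Equiv.ofBijective (fun i => ⟨fun v => i.1 (blockIdx τ v),
    hτ.levelChain_comp_blockIdx i.2.1, i.2.2⟩) ⟨fun i i' h => ?_, ?_⟩)).symm
  · refine Subtype.ext (funext fun j => ?_)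
    obtain ⟨v, rfl⟩ := hτ.blockIdx_surjective j
    exact congrFun (congrArg Subtype.val h) v
  · rintro ⟨f, rfl, hQ⟩
    obtain ⟨i, hi, hif⟩ := exists_strictMono_comp_blockIdx f
    exact ⟨⟨i, hi, hif.symm ▸ hQ⟩, Subtype.ext hif⟩

end LevelChain

section FixedColorings

variable {V : Type*} [Fintype V] [DecidableEq V] {G : MixedGraph V} {H : Type*} [Group H]
  [MulAction H V]

lemma isColoring_iff_levelChain_mem {f : V → ℕ} :
    G.IsColoring f ↔ levelChain f ∈ G.coloringComplex := by
  have hflag := isFlag_levelChain f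
  constructor
  · rintro ⟨hund, hdir⟩
    refine mem_coloringComplex_of_forall_exists_separating
      ⟨fun I hI => ⟨fun u v huv hv => ?_, hflag.ne_empty I hI, hflag.ne_univ I hI⟩,
        hflag.isChain⟩ fun u v huv => ?_
    · have hle : f u ≤ f v := by
        clear hv
        induction huv with
        | refl => rfl
        | tail _ hdirected ih => exact ih.trans (hdir _ _ hdirected)
      obtain ⟨-, w, rfl⟩ := mem_levelChain.1 hI
      rw [mem_filter_univ] at hv ⊢
      exact hle.trans hv
    · rcases lt_or_gt_of_ne (hund u v huv) with hlt | hgt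
      · obtain ⟨I, hI, hu, hv⟩ := exists_mem_levelChain.2 hlt
        exact ⟨I, hI, fun h => hv (h.1 hu)⟩
      · obtain ⟨I, hI, hv, hu⟩ := exists_mem_levelChain.2 hgt
        exact ⟨I, hI, fun h => hu (h.2 hv)⟩
  · refine fun hf => ⟨fun u v huv heq => ?_, fun u v huv => ?_⟩
    · obtain ⟨I, hI, hsep⟩ := exists_separating_of_mem_coloringComplex hf huv
      obtain ⟨-, w, rfl⟩ := mem_levelChain.1 hI
      simp [heq] at hsep
    · by_contra! hlt
      obtain ⟨I, hI, hv, hu⟩ := exists_mem_levelChain.2 hlt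
      exact hu ((hf.1.1 I hI).1 u v (.single huv) hv)

lemma isFixedColoring_iff {g : H} {f : V → ℕ} : G.IsFixedColoring g f ↔
    levelChain f ∈ G.coloringComplex ∧ g • levelChain f = levelChain f := by
  rw [IsFixedColoring, isColoring_iff_levelChain_mem, forall_inv_smul_eq_iff]

variable [Nonempty V]

open Classical in
lemma card_isFixedColoring_and (g : H) {Q : (V → ℕ) → Prop} (hQ : {f | Q f}.Finite) :
    Nat.card {f : V → ℕ // G.IsFixedColoring g f ∧ Q f} =
      ∑ τ : Finset (Finset V) with τ ∈ G.coloringComplex ∧ g • τ = τ,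
        Nat.card {i : Fin (#(τ.image card) + 1) → ℕ //
          StrictMono i ∧ Q fun v => i (blockIdx τ v)} := by
  have hfin : {f | G.IsFixedColoring g f ∧ Q f}.Finite := hQ.subset fun f hf => hf.2
  have hmaps : ∀ f ∈ hfin.toFinset,
      levelChain f ∈ ({τ | τ ∈ G.coloringComplex ∧ g • τ = τ} : Finset (Finset (Finset V))) :=
    fun f hf => mem_filter.2 ⟨mem_univ _, isFixedColoring_iff.1 (hfin.mem_toFinset.1 hf).1⟩
  calc Nat.card {f : V → ℕ // G.IsFixedColoring g f ∧ Q f}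
      = #hfin.toFinset := Nat.card_eq_card_finite_toFinset hfin
    _ = ∑ τ with τ ∈ G.coloringComplex ∧ g • τ = τ, #{f ∈ hfin.toFinset | levelChain f = τ} :=
        card_eq_sum_card_fiberwise hmaps
    _ = _ := sum_congr rfl fun τ hτ => ?_
  obtain ⟨hτ, hg⟩ := (mem_filter.1 hτ).2
  rw [← (isFlag_of_mem_orderComplex hτ.1).card_levelChain_eq, ← Fintype.card_coe,
    ← Nat.card_eq_fintype_card]
  refine Nat.card_congr (Equiv.subtypeEquivRight fun f => ?_)
  rw [mem_filter, hfin.mem_toFinset, Set.mem_ofPred_eq, isFixedColoring_iff]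
  constructor
  · rintro ⟨⟨-, hQf⟩, hf⟩
    exact ⟨hf, hQf⟩
  · rintro ⟨rfl, hQf⟩
    exact ⟨⟨⟨hτ, hg⟩, hQf⟩, rfl⟩

end FixedColorings

lemma card_strictMono_and_lt (t k : ℕ) :
    Nat.card {i : Fin t → ℕ // StrictMono i ∧ ∀ j, i j < k} = k.choose t := by
  let e : {i : Fin t → ℕ // StrictMono i ∧ ∀ j, i j < k} ≃ (Fin t ↪o Fin k) :=
    { toFun := fun i => OrderEmbedding.ofStrictMono (fun j => ⟨i.1 j, i.2.2 j⟩)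
        fun _ _ h => i.2.1 h
      invFun := fun i => ⟨fun j => i j, fun _ _ h => i.strictMono h, fun j => (i j).2⟩ }
  rw [Nat.card_congr (e.trans Set.powersetCard.ofFinEmbEquiv), Set.powersetCard.card, Nat.card_fin]

end MixedGraph

/-! ### Expansions of the chromatic functions -/

section PowersetSums

open Finset

lemma sum_Icc_choose_card {ι : Type*} [DecidableEq ι] (k a : ℕ) {T Q : Finset ι} (hTQ : T ⊆ Q) :
    ∑ S ∈ Icc T Q, k.choose (#S + a) = (k + #(Q \ T)).choose (#Q + a) := by
  induction hn : #(Q \ T) generalizing T Q with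
  | zero =>
    obtain rfl := hTQ.antisymm (sdiff_eq_empty_iff_subset.1 (card_eq_zero.1 hn))
    rw [Icc_self, sum_singleton, add_zero]
  | succ n ih =>
    obtain ⟨x, hx⟩ := card_pos.1 (hn.ge.trans_lt' n.succ_pos)
    obtain ⟨hxQ, hxT⟩ := mem_sdiff.1 hx
    have hcard : #((Q \ T).erase x) = n := by rw [card_erase_of_mem hx, hn, Nat.add_sub_cancel]
    rw [sum_Icc_eq_erase_add_insert _ T Q x, ih (subset_erase.2 ⟨hTQ, hxT⟩)
      (by rwa [erase_sdiff_comm]), ih (insert_subset hxQ hTQ) (by rwa [sdiff_insert]),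
      ← card_erase_add_one hxQ, add_right_comm, ← add_assoc, Nat.choose_succ_succ]

lemma sum_powerset_Icc_card {M : Type*} [AddCommMonoid M] {n : ℕ} (hn : 0 < n)
    (x : Finset ℕ → M) : ∑ S ∈ (Icc 1 (n - 1)).powerset, x S =
      ∑ j ∈ range n, ∑ S ∈ powersetCard j (Icc 1 (n - 1)), x S := by
  rw [sum_powerset, Nat.card_Icc, Nat.add_sub_cancel, Nat.sub_add_cancel hn]

end PowersetSums

namespace MixedGraph

open Finset
open scoped Pointwise

section ChromaticNumber

variable {V : Type*} [Fintype V] [Nonempty V] {G : MixedGraph V} {τ : Finset (Finset V)}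

lemma exists_isColoring_lt (hτ : τ ∈ G.coloringComplex) :
    ∃ f : V → ℕ, G.IsColoring f ∧ ∀ v, f v < #(τ.image card) + 1 := by
  classical
  refine ⟨fun v => blockIdx τ v, ?_, fun v => (blockIdx τ v).2⟩
  rwa [isColoring_iff_levelChain_mem,
    (isFlag_of_mem_orderComplex hτ.1).levelChain_comp_blockIdx Fin.val_strictMono]

lemma chromaticNumber_pos_of_mem (hτ : τ ∈ G.coloringComplex) :
    0 < G.chromaticNumber := by
  obtain ⟨f, -, hf⟩ := Nat.sInf_mem (s := {k | ∃ f : V → ℕ, G.IsColoring f ∧ ∀ v, f v < k})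
    ⟨_, exists_isColoring_lt hτ⟩
  exact Nat.zero_lt_of_lt (hf (Classical.arbitrary V))

end ChromaticNumber

variable {V : Type*} [Fintype V] [DecidableEq V] {G : MixedGraph V}
  {H : Type*} [Group H] [MulAction H V]

lemma sum_flagCount_smul {M : Type*} [AddCommGroup M] [Module ℂ M] (D : Finset ℕ)
    (x : Finset ℕ → M) (g : H) : ∑ T ∈ D.powerset, G.flagCount T g • x T =
      ∑ S ∈ D.powerset, G.flagCoeff S g • ∑ T ∈ D.powerset with S ⊆ T, x T := by
  simp only [← sum_flagCoeff, Finset.sum_apply, sum_smul, smul_sum]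
  refine sum_comm' fun T S => ?_
  simp only [mem_powerset, mem_filter]
  exact ⟨fun h => ⟨⟨h.1, h.2⟩, h.2.trans h.1⟩, fun h => ⟨h.1.1, h.1.2⟩⟩

open Classical in
lemma sum_image_card_eq_sum_flagCount (w : Finset ℕ → ℂ) (g : H) :
    ∑ τ : Finset (Finset V) with τ ∈ G.coloringComplex ∧ g • τ = τ, w (τ.image card) =
      ∑ S ∈ (Icc 1 (Fintype.card V - 1)).powerset, G.flagCount S g • w S := by
  rw [← sum_fiberwise_of_maps_to' (t := (Icc 1 (Fintype.card V - 1)).powerset) fun τ hτ => ?_]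
  · refine sum_congr rfl fun S _ => ?_
    rw [sum_const, filter_filter, flagCount, Nat.cast_smul_eq_nsmul]
    simp only [and_assoc, and_comm (a := image card _ = S)]
  · refine mem_powerset.2 (image_subset_iff.2 fun I hI => ?_)
    exact (isFlag_of_mem_orderComplex (mem_filter.1 hτ).2.1.1).card_mem_Icc hI

section Expansions

variable [Nonempty V]

lemma chromaticQ_eq_sum_monomialQ (g : H) :
    G.chromaticQ g = ∑ S ∈ (Icc 1 (Fintype.card V - 1)).powerset,
      G.flagCount S g • QSymFun.monomialQ (Fintype.card V) S := by
  classical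
  ext μ
  have hfin : {f : V → ℕ | ∑ v, Finsupp.single (f v) 1 = μ}.Finite := by
    refine (Set.Finite.pi' fun _ : V => μ.support.finite_toSet).subset ?_
    rintro f rfl u
    rw [mem_coe, Finsupp.mem_support_iff, Finsupp.finsetSum_apply]
    exact (sum_pos' (fun _ _ => Nat.zero_le _) ⟨u, mem_univ u, by simp⟩).ne'
  calc MvPowerSeries.coeff μ (G.chromaticQ g)
      = (Nat.card {f : V → ℕ // G.IsFixedColoring g f ∧ ∑ v, Finsupp.single (f v) 1 = μ} : ℂ) :=
        rfl
    _ = ∑ τ : Finset (Finset V) with τ ∈ G.coloringComplex ∧ g • τ = τ,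
          QSymFun.monomialQ (Fintype.card V) (τ.image card) μ := by
        rw [card_isFixedColoring_and g hfin, Nat.cast_sum]
        refine sum_congr rfl fun τ hτ => ?_
        have hflag := isFlag_of_mem_orderComplex (mem_filter.1 hτ).2.1.1
        simp only [hflag.sum_single_blockIdx]
        rfl
    _ = ∑ S ∈ (Icc 1 (Fintype.card V - 1)).powerset,
          G.flagCount S g • QSymFun.monomialQ (Fintype.card V) S μ :=
        sum_image_card_eq_sum_flagCount (fun S => QSymFun.monomialQ (Fintype.card V) S μ) g
    _ = _ := by
        rw [map_sum]
        rfl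

lemma chromaticP_eq_sum_choose (k : ℕ) (g : H) :
    G.chromaticP k g = ∑ S ∈ (Icc 1 (Fintype.card V - 1)).powerset,
      G.flagCount S g • (k.choose (#S + 1) : ℂ) := by
  classical
  have hfin : {f : V → ℕ | ∀ v, f v < k}.Finite := Set.Finite.pi' fun _ => Set.finite_Iio k
  rw [chromaticP, card_isFixedColoring_and g hfin, Nat.cast_sum,
    ← sum_image_card_eq_sum_flagCount fun S => (k.choose (#S + 1) : ℂ)]
  refine sum_congr rfl fun τ hτ => ?_
  have hflag := isFlag_of_mem_orderComplex (mem_filter.1 hτ).2.1.1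
  rw [← card_strictMono_and_lt]
  simp only [hflag.blockIdx_surjective.forall]

lemma chromaticQ_eq_sum_fundamentalQ (g : H) :
    G.chromaticQ g = ∑ S ∈ (Icc 1 (Fintype.card V - 1)).powerset,
      G.flagCoeff S g • QSymFun.fundamentalQ (Fintype.card V) S := by
  rw [chromaticQ_eq_sum_monomialQ, sum_flagCount_smul]
  rfl

lemma chromaticP_eq_sum_flagCoeff (k : ℕ) (g : H) :
    G.chromaticP k g = ∑ S ∈ (Icc 1 (Fintype.card V - 1)).powerset,
      G.flagCoeff S g * ((k + Fintype.card V - (#S + 1)).choose (Fintype.card V) : ℂ) := by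
  have hn : 0 < Fintype.card V := Fintype.card_pos
  rw [chromaticP_eq_sum_choose, sum_flagCount_smul]
  refine sum_congr rfl fun S hS => ?_
  have hSD := mem_powerset.1 hS
  have hcard := card_le_card hSD
  rw [Nat.card_Icc] at hcard
  rw [← Icc_eq_filter_powerset, ← Nat.cast_sum, sum_Icc_choose_card k 1 hSD,
    card_sdiff_of_subset hSD, Nat.card_Icc, smul_eq_mul]
  congr 3 <;> lia

end Expansions

/-! ### The equivariant `f`- and `h`-vectors -/

section Vanishing

variable [Nonempty V]

lemma flagCount_eq_zero {S : Finset ℕ}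
    (hS : G.chromaticNumber = 0 ∨ #S + 1 < G.chromaticNumber) :
    G.flagCount (H := H) S = 0 := by
  classical
  ext g
  rw [flagCount, Pi.zero_apply, Nat.cast_eq_zero, card_eq_zero, filter_eq_empty_iff]
  rintro τ - ⟨hτ, rfl, -⟩
  have hle : G.chromaticNumber ≤ _ := Nat.sInf_le (exists_isColoring_lt hτ)
  have hpos := chromaticNumber_pos_of_mem hτ
  lia

lemma flagCoeff_eq_zero {S : Finset ℕ} (hS : #S + 1 < G.chromaticNumber) :
    G.flagCoeff (H := H) S = 0 := by
  refine sum_eq_zero fun A hA => ?_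
  have hle := card_le_card (mem_Icc.1 hA).2
  rw [flagCount_eq_zero (Or.inr (by lia)), smul_zero]

end Vanishing

/-- The `f`-vector `f_i` of the coloring complex as a family of class functions, indexed by the
dimension `i` of the faces counted and zero for `i < -1`. -/
noncomputable def fVector (G : MixedGraph V) (i : ℤ) : H → ℂ :=
  if i < -1 then 0 else
    ∑ S ∈ powersetCard (i + 1).toNat (Icc 1 (Fintype.card V - 1)), G.flagCount S

/-- The `h`-vector `h_i` of the coloring complex as a family of class functions, the sum of the
entries of the flag `h`-vector at the rank sets of size `i`; it is zero for `i < 0`. -/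
noncomputable def hVector (G : MixedGraph V) (i : ℤ) : H → ℂ :=
  if i < 0 then 0 else
    ∑ S ∈ powersetCard i.toNat (Icc 1 (Fintype.card V - 1)), G.flagCoeff S

lemma fVector_natCast_sub_one (j : ℕ) : G.fVector (H := H) ((j : ℤ) - 1) =
    ∑ S ∈ powersetCard j (Icc 1 (Fintype.card V - 1)), G.flagCount S := by
  rw [fVector, if_neg (by lia), sub_add_cancel, Int.toNat_natCast]

lemma fVector_natCast (j : ℕ) : G.fVector (H := H) (j : ℤ) =
    ∑ S ∈ powersetCard (j + 1) (Icc 1 (Fintype.card V - 1)), G.flagCount S := by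
  rw [← fVector_natCast_sub_one, Nat.cast_succ, add_sub_cancel_right]

lemma hVector_natCast (j : ℕ) : G.hVector (H := H) (j : ℤ) =
    ∑ S ∈ powersetCard j (Icc 1 (Fintype.card V - 1)), G.flagCoeff S := by
  rw [hVector, if_neg (by lia), Int.toNat_natCast]

lemma hVector_eq_zero_of_neg {i : ℤ} (hi : i < 0) : G.hVector (H := H) i = 0 := if_pos hi

section Nonempty

variable [Nonempty V]

lemma fVector_eq_zero {i : ℤ} (hi : i < -1 ∨ (Fintype.card V : ℤ) - 2 < i) :
    G.fVector (H := H) i = 0 := by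
  have hn : 0 < Fintype.card V := Fintype.card_pos
  rw [fVector, ite_eq_left_iff]
  intro hneg
  rw [powersetCard_eq_empty.2 (by rw [Nat.card_Icc]; lia), sum_empty]

lemma hVector_eq_zero {i : ℤ} (hi : i < 0 ∨ (Fintype.card V : ℤ) - 1 < i) :
    G.hVector (H := H) i = 0 := by
  have hn : 0 < Fintype.card V := Fintype.card_pos
  rw [hVector, ite_eq_left_iff]
  intro hneg
  rw [powersetCard_eq_empty.2 (by rw [Nat.card_Icc]; lia), sum_empty]

lemma fVector_eq_zero_of_chromaticNumber_eq_zero (h : G.chromaticNumber = 0) (i : ℤ) :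
    G.fVector (H := H) i = 0 := by
  rw [fVector, ite_eq_left_iff]
  exact fun _ => sum_eq_zero fun S _ => flagCount_eq_zero (Or.inl h)

lemma chromaticP_eq_sum_fVector (k : ℕ) (g : H) : G.chromaticP k g =
    ∑ i ∈ range (Fintype.card V + 1), G.fVector ((i : ℤ) - 2) g * (k.choose i : ℂ) := by
  rw [sum_range_succ', fVector_eq_zero (Or.inl (by norm_num)), Pi.zero_apply, zero_mul, add_zero,
    chromaticP_eq_sum_choose, sum_powerset_Icc_card Fintype.card_pos]
  refine sum_congr rfl fun j _ => ?_
  rw [show ((j + 1 : ℕ) : ℤ) - 2 = (j : ℤ) - 1 by push_cast; ring, fVector_natCast_sub_one,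
    Finset.sum_apply, sum_mul]
  exact sum_congr rfl fun S hS => by rw [(mem_powersetCard.1 hS).2, smul_eq_mul]

lemma chromaticP_eq_sum_hVector (k : ℕ) (g : H) : G.chromaticP k g =
    ∑ i ∈ range (Fintype.card V + 1), G.hVector ((i : ℤ) - 1) g *
      ((k + Fintype.card V - i).choose (Fintype.card V) : ℂ) := by
  rw [sum_range_succ', hVector_eq_zero (Or.inl (by norm_num)), Pi.zero_apply, zero_mul, add_zero,
    chromaticP_eq_sum_flagCoeff, sum_powerset_Icc_card Fintype.card_pos]
  refine sum_congr rfl fun j _ => ?_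
  rw [Nat.cast_succ, add_sub_cancel_right, hVector_natCast, Finset.sum_apply, sum_mul]
  exact sum_congr rfl fun S hS => by rw [(mem_powersetCard.1 hS).2]

end Nonempty

/-! ### Effectivity -/

lemma isEffectiveCharacter_flagCoeff (hG : G.IsAcyclic) (hH : G.IsActedOnBy H) {S : Finset ℕ}
    (hS : S ⊆ Icc 1 (Fintype.card V - 1)) (hm : #S ≤ G.minUndirected) :
    IsEffectiveCharacter (G.flagCoeff (H := H) S) := by
  have hmem := intervalPositive_flagCoeff hG hH S S Subset.rfl hS hm
  rwa [Icc_self, sum_singleton] at hmem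

lemma isEffectiveCharacter_hVector (hG : G.IsAcyclic) (hH : G.IsActedOnBy H) {i : ℤ}
    (hi : i ≤ G.minUndirected) : IsEffectiveCharacter (G.hVector (H := H) i) := by
  rcases lt_or_ge i 0 with hneg | hnonneg
  · rw [hVector_eq_zero_of_neg hneg]
    exact IsEffectiveCharacter.zero
  · lift i to ℕ using hnonneg
    rw [hVector_natCast]
    refine sum_mem (S := effectiveCharacters H) fun S hS => ?_
    obtain ⟨hSD, hcard⟩ := mem_powersetCard.1 hS
    exact isEffectiveCharacter_flagCoeff hG hH hSD (by lia)

variable [Nonempty V]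

lemma isEffectiveCharacter_sum_choose_hVector (hG : G.IsAcyclic) (hH : G.IsActedOnBy H) {i : ℕ}
    (hi : i ≤ G.minUndirected) : IsEffectiveCharacter
      (∑ j ∈ Icc G.minUndirected (Fintype.card V - 1),
        (i + j - G.minUndirected).choose i • G.hVector (H := H) (j : ℤ)) := by
  have hn : 0 < Fintype.card V := Fintype.card_pos
  have hmem := (intervalPositive_flagCoeff hG hH).sum_choose_mem le_rfl (empty_subset _)
    Subset.rfl (i := i) hi
  rw [← bot_eq_empty, Icc_bot, Iic_eq_powerset, sum_filter,
    sum_powerset_Icc_card hn] at hmem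
  have hIcc : Icc G.minUndirected (Fintype.card V - 1) =
      {j ∈ range (Fintype.card V) | G.minUndirected ≤ j} := by
    ext j
    rw [mem_Icc, mem_filter, mem_range]
    lia
  change _ ∈ effectiveCharacters H
  convert hmem using 1
  rw [hIcc, sum_filter]
  refine sum_congr rfl fun j _ => ?_
  rw [hVector_natCast, smul_sum, ite_sum_zero]
  exact sum_congr rfl fun S hS => by rw [(mem_powersetCard.1 hS).2]

lemma effLE_smul_fVector (hG : G.IsAcyclic) (hH : G.IsActedOnBy H)
    (hm : G.chromaticNumber ≤ G.minUndirected) {i : ℤ} (hi : G.chromaticNumber ≤ i) :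
    EffLE (((Fintype.card V : ℤ) - 1 - i) • G.fVector (H := H) (i - 1))
      ((i - G.chromaticNumber + 2) • G.fVector (H := H) i) := by
  rcases Nat.eq_zero_or_pos G.chromaticNumber with hzero | hpos
  · simp only [fVector_eq_zero_of_chromaticNumber_eq_zero hzero, smul_zero]
    exact EffLE.refl 0
  lift i to ℕ using (Nat.cast_nonneg _).trans hi
  have hn : 0 < Fintype.card V := Fintype.card_pos
  have hmem := (intervalPositive_flagCoeff hG hH).smul_sum_sub_smul_sum_mem
    (e := G.chromaticNumber - 1) (k := i) (fun S _ hS => flagCoeff_eq_zero (by lia)) (by lia)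
  simp only [sum_flagCoeff, ← fVector_natCast, ← fVector_natCast_sub_one, Nat.card_Icc] at hmem
  change _ ∈ effectiveCharacters H
  convert hmem using 3 <;> lia

lemma effLE_fVector (hG : G.IsAcyclic) (hH : G.IsActedOnBy H)
    (hm : G.chromaticNumber ≤ G.minUndirected) {a b : ℤ}
    (ha : (G.chromaticNumber : ℤ) - 1 ≤ a) (hab : a ≤ b)
    (hsum : a + b + 2 ≤ Fintype.card V + G.chromaticNumber) :
    EffLE (G.fVector (H := H) (a - 1)) (G.fVector (H := H) (b - 1)) := by
  rcases Nat.eq_zero_or_pos G.chromaticNumber with hzero | hpos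
  · simp only [fVector_eq_zero_of_chromaticNumber_eq_zero hzero]
    exact EffLE.refl 0
  lift a to ℕ using by lia
  lift b to ℕ using by lia
  have hmem := (intervalPositive_flagCoeff hG hH).sum_sub_sum_mem
    (e := G.chromaticNumber - 1) (a := a) (b := b) (fun S _ hS => flagCoeff_eq_zero (by lia))
    (by lia) (by lia) (by lia) (by rw [Nat.card_Icc]; lia)
  simp only [sum_flagCoeff, ← fVector_natCast_sub_one] at hmem
  exact hmem

end MixedGraph

theorem mainTheorem9_general {V : Type*} [Fintype V] [DecidableEq V] [Nonempty V]
    (G : MixedGraph V) (hG : G.IsAcyclic)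
    {H : Type*} [Group H] [MulAction H V] (hH : G.IsActedOnBy H)
    (K : Type*) [Field K]
    (n m : ℕ) (hn : n = Fintype.card V) (hm : m = G.minUndirected)
    (d χ : ℤ) (hd : d = n - 1) (hχ : χ = G.chromaticNumber) :
    G.ColoringComplexSatisfiesSerre K m ∧
    (∃ c : Finset ℕ → H → ℂ,
      (∀ g : H, G.chromaticQ g =
        ∑ S ∈ (Finset.Icc 1 (n - 1)).powerset, c S g • QSymFun.fundamentalQ n S) ∧
      ∀ S ⊆ Finset.Icc 1 (n - 1), S.card ≤ m → IsEffectiveCharacter (c S)) ∧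
    ∃ f h : ℤ → H → ℂ,
      (∀ i, i < -2 ∨ (n : ℤ) - 2 < i → f i = 0) ∧
      (∀ i, i < -1 ∨ (n : ℤ) - 1 < i → h i = 0) ∧
      (∀ (k : ℕ) (g : H), G.chromaticP k g =
        ∑ i ∈ Finset.range (n + 1), f ((i : ℤ) - 2) g * (k.choose i : ℂ)) ∧
      (∀ (k : ℕ) (g : H), G.chromaticP k g =
        ∑ i ∈ Finset.range (n + 1), h ((i : ℤ) - 1) g * ((k + n - i).choose n : ℂ)) ∧
      (∀ i : ℤ, i ≤ m → IsEffectiveCharacter (h i)) ∧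
      (∀ i : ℕ, i ≤ m → IsEffectiveCharacter
        (∑ j ∈ Finset.Icc m (n - 1), (i + j - m).choose i • h (j : ℤ))) ∧
      (χ ≤ m →
        (∀ i : ℤ, χ ≤ i → EffLE ((d - i) • f (i - 1)) ((i - χ + 2) • f i)) ∧
        (∀ i : ℤ, χ - 1 ≤ i → i ≤ (d + χ - 2) / 2 → EffLE (f (i - 1)) (f i)) ∧
        (∀ i : ℤ, χ - 1 ≤ i → i ≤ (d + χ - 1) / 2 →
          EffLE (f (i - 1)) (f (d + χ - i - 2)))) := by
  subst hn hm hd hχ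
  refine ⟨MixedGraph.coloringComplexSatisfiesSerre_minUndirected hG,
    ⟨G.flagCoeff, MixedGraph.chromaticQ_eq_sum_fundamentalQ,
      fun _ => MixedGraph.isEffectiveCharacter_flagCoeff hG hH⟩,
    G.fVector, G.hVector, fun i hi => MixedGraph.fVector_eq_zero (by lia),
    fun i hi => MixedGraph.hVector_eq_zero (by lia), MixedGraph.chromaticP_eq_sum_fVector,
    MixedGraph.chromaticP_eq_sum_hVector, fun _ => MixedGraph.isEffectiveCharacter_hVector hG hH,
    fun _ => MixedGraph.isEffectiveCharacter_sum_choose_hVector hG hH, fun hχm => ?_⟩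
  have hχm' : G.chromaticNumber ≤ G.minUndirected := by exact_mod_cast hχm
  refine ⟨fun _ => MixedGraph.effLE_smul_fVector hG hH hχm', fun i hχi hi => ?_,
    fun i hχi hi => ?_⟩
  · convert MixedGraph.effLE_fVector (H := H) hG hH hχm' hχi (b := i + 1) (by lia) (by lia) using 2
    ring
  · convert MixedGraph.effLE_fVector (H := H) hG hH hχm' hχi
      (b := (Fintype.card V : ℤ) - 1 + G.chromaticNumber - i - 1) (by lia) (by lia) using 2
    ring

theorem mainTheorem9 {V : Type*} [Fintype V] [DecidableEq V] [Nonempty V]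
    (G : MixedGraph V) (hG : G.IsAcyclic) (hnear : ∀ c : G.MixedCycle, ¬ c.IsNear)
    {H : Type*} [Group H] [Finite H] [MulAction H V] (hH : G.IsActedOnBy H)
    (K : Type*) [Field K]
    (n m : ℕ) (hn : n = Fintype.card V) (hm : m = G.minUndirected)
    (d χ : ℤ) (hd : d = n - 1) (hχ : χ = G.chromaticNumber) :
    -- `Φ(G)` satisfies `(S_{m(G)})`
    G.ColoringComplexSatisfiesSerre K m ∧
    -- the coefficients `c S = [F_{S,n}] χ(G, H, x)`
    (∃ c : Finset ℕ → H → ℂ,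
      (∀ g : H, G.chromaticQ g =
        ∑ S ∈ (Finset.Icc 1 (n - 1)).powerset, c S g • QSymFun.fundamentalQ n S) ∧
      ∀ S ⊆ Finset.Icc 1 (n - 1), S.card ≤ m → IsEffectiveCharacter (c S)) ∧
    -- the `f`-vector `f_{-2}, …, f_{n-2}` and the `h`-vector `h_{-1}, …, h_{n-1}`
    ∃ f h : ℤ → H → ℂ,
      (∀ i, i < -2 ∨ (n : ℤ) - 2 < i → f i = 0) ∧
      (∀ i, i < -1 ∨ (n : ℤ) - 1 < i → h i = 0) ∧
      (∀ (k : ℕ) (g : H), G.chromaticP k g =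
        ∑ i ∈ Finset.range (n + 1), f ((i : ℤ) - 2) g * (k.choose i : ℂ)) ∧
      (∀ (k : ℕ) (g : H), G.chromaticP k g =
        ∑ i ∈ Finset.range (n + 1), h ((i : ℤ) - 1) g * ((k + n - i).choose n : ℂ)) ∧
      (∀ i : ℤ, i ≤ m → IsEffectiveCharacter (h i)) ∧
      (∀ i : ℕ, i ≤ m → IsEffectiveCharacter
        (∑ j ∈ Finset.Icc m (n - 1), (i + j - m).choose i • h (j : ℤ))) ∧
      (χ ≤ m →
        (∀ i : ℤ, χ ≤ i → EffLE ((d - i) • f (i - 1)) ((i - χ + 2) • f i)) ∧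
        (∀ i : ℤ, χ - 1 ≤ i → i ≤ (d + χ - 2) / 2 → EffLE (f (i - 1)) (f i)) ∧
        (∀ i : ℤ, χ - 1 ≤ i → i ≤ (d + χ - 1) / 2 →
          EffLE (f (i - 1)) (f (d + χ - i - 2)))) :=
  mainTheorem9_general G hG hH K n m hn hm d χ hd hχ
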